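/- **Setting.** A stochastic game with independent chains has $n$ players; player $i$ has finite state and action sets $S_i,A_i$, a transition kernel $P_i(s_i'\mid s_i,a_i)$ and a reward $r_i(s,a)\in[0,1]$ depending on the joint state $s$ and joint action $a$. The joint state moves with probability $\prod_i P_i(s_i'\mid s_i,a_i)$. Every stationary policy $\pi_i$ of every player $i$ induces an ergodic (irreducible, aperiodic) chain $P^{\pi_i}$ on $S_i$, and for a fixed $\tau>0$, $\|(v-v')P^{\pi_i}\|_1\le e^{-1/\tau}\|v-v'\|_1$ for all probability vectors $v,v'$ on $S_i$. Let $\mathcal P_i$ be the polytope of $\rho_i\in\mathbb R_+^{S_i\times A_i}$ with $\sum_{s_i,a_i}\rho_i(s_i,a_i)=1$ and $\sum_{s_i,a_i}(P_i(s_i'\mid s_i,a_i)-\mathbb I_{\{s_i=s_i'\}})\rho_i(s_i,a_i)=0$ for all $s_i'$; put $\mathcal P=\prod_i\mathcal P_i$, $\mathcal P_i^{\delta_i}=\{\rho_i\in\mathcal P_i:\rho_i\ge\delta_i\mathbf 1\}$ and $\mathcal P^\delta=\prod_i\mathcal P_i^{\delta_i}$. The virtual game has action sets $\mathcal P_i$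 and payoffs $V_i(\rho)=\sum_{s,a}\prod_j\rho_j(s_j,a_j)\,r_i(s,a)$; $v(\rho)=(\nabla_{\rho_i}V_i(\rho))_i$, and $\Psi(\theta,\rho)=\sum_i[V_i(\theta_i,\rho_{-i})-V_i(\rho)]$. A point $\rho^*\in\mathcal P$ is a *stable NE* if $\langle v(\rho),\rho^*-\rho\rangle\ge0$ for all $\rho\in\mathcal P$, with equality iff $\rho=\rho^*$; it is *$L$-strongly stable* ($L>0$) if moreover $\langle v(\rho),\rho^*-\rho\rangle\ge L\|\rho^*-\rho\|^2$ for all $\rho\in\mathcal P$ (Euclidean norms). **Algorithm.** Inputs: thresholds $\delta_i>0$, $\rho_i^0\in\mathcal P_i^{\delta_i}$, step-sizes $\eta^k>0$ $(k\ge1)$, $d\in\mathbb N$, and continuous $K$-strongly convex regularizers $h_i:\mathcal P_i^{\delta_i}\to\mathbb R$ ($K>0$). Play starts at a fixed joint state and proceeds in batches $k=0,1,2,\dots$. In batch $k$, player $i$ draws its action at each time, independently of the others given the past and the current joint state, from $\pi_i^k(a_i\mid s_i)=\rho_i^k(s_i,a_i)/\sum_{a_i'}\rho_i^k(s_i,a_i')$.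 From the time at which $d$ steps of the batch have been made, player $i$ records the first visit to each of its states; if action $a_i$ is taken at the first such visit to $s_i$ and reward $r$ is received, then $R_i^k(s_i,a_i)=r/\pi_i^k(a_i\mid s_i)$, and all other entries of $R_i^k$ are $0$. The batch ends once every player has so visited all of its states. Then $Y_i^{k+1}=Y_i^k+\eta^kR_i^k$ and $\rho_i^{k+1}=\operatorname{argmax}_{\rho_i\in\mathcal P_i^{\delta_i}}\{\langle\rho_i,Y_i^{k+1}\rangle-h_i(\rho_i)\}$, where $Y^0=0$ and $\eta^0:=0$. Put $w^k=\sum_{\ell=1}^k\eta^\ell$. **Theorem.** Let $\epsilon>0$, let $\rho^*$ be a stable NE of the virtual game, and let all players run the algorithm with $$d\ge\tau\ln\Big(\frac{6n}{\epsilon}\sum_i|A_i||S_i|\Big),\qquad \sum_{\ell\ge1}\eta^\ell=\infty,\qquad \sum_{\ell\ge1}(\eta^\ell)^2<\infty.$$ Assume that the thresholds $\delta_i$ are small enough that some $\hat\rho\in\mathcal P^\delta$ satisfies $\sum_i\sqrt{|S_i||A_i|}\,\|\rho^*_i-\hat\rho_i\|\le\epsilon/2$ (for example, $\rho^*\in\mathcal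 P^\delta$). Let $d(k)=\sum_{\ell=1}^k\frac{\eta^\ell}{w^k}\Psi(\rho^*,\rho^\ell)$. 1. Almost surely, $\limsup_{k\to\infty}d(k)<\epsilon$. 2. If $\rho^*$ is $L$-strongly stable, then almost surely $\|\rho^*-\rho^k\|^2<\epsilon/L$ for infinitely many $k$. 3. Suppose in addition that $h=\sum_ih_i$ satisfies $\max_{\mathcal P^\delta}h-\min_{\mathcal P^\delta}h\le\sum_i|S_i||A_i|$ and that $\max\{K,K^2\}\le\sum_{\ell\ge1}(\eta^\ell)^2$ (for example, $K\le1$ and $\eta^1=1$). Then for every $\alpha\in(0,1)$, with probability at least $1-\alpha$, one has $d(k)<\epsilon$ simultaneously for all $k$ with $$w^k\ \ge\ \frac{72\,n}{\alpha\,\epsilon\,K}\Big(\sum_i\frac{|S_i||A_i|}{\delta_i}\Big)\sum_{\ell=1}^\infty(\eta^\ell)^2 .$$ -/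

import Mathlib

/-- An `n`-player stochastic game with independent chains: player `i` has its own finite state
space `S i`, action space `A i` and transition kernel `P i`, where `P i s a s'` is the probability
of moving from `s` to `s'` under action `a`; the players are coupled through the rewards
`r i s a ∈ [0, 1]`, which depend on all states and all actions. -/
structure StochGame (n : ℕ) (S A : Fin n → Type*) [∀ i, Fintype (S i)] where
  P : ∀ i, S i → A i → S i → ℝ
  P_mem : ∀ i s a, P i s a ∈ stdSimplex ℝ (S i)
  r : Fin n → (∀ j, S j) → (∀ j, A j) → ℝ
  r_mem : ∀ i s a, r i s a ∈ Set.Icc (0 : ℝ) 1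

/-- One vector over `S i × A i` for each player `i`. -/
abbrev Profile {n : ℕ} (S A : Fin n → Type*) := ∀ i, EuclideanSpace ℝ (S i × A i)

namespace StochGame

variable {n : ℕ} {S A : Fin n → Type*} [∀ i, Fintype (S i)] [∀ i, Fintype (A i)]
  [∀ i, DecidableEq (S i)] [∀ i, DecidableEq (A i)]

/-- Stationary policies of player `i`: `π s a` is the probability of action `a` in state `s`. -/
def IsPolicy {i : Fin n} (π : S i → A i → ℝ) : Prop := ∀ s, π s ∈ stdSimplex ℝ (A i)

/-- The transition matrix of the chain on `S i` induced by a stationary policy `π`. -/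
def inducedChain (G : StochGame n S A) (i : Fin n) (π : S i → A i → ℝ) :
    Matrix (S i) (S i) ℝ :=
  Matrix.of fun s s' => ∑ a, G.P i s a s' * π s a

/-- Every stationary policy of every player induces an ergodic (irreducible and aperiodic, that
is, primitive) chain whose mixing time is at most `τ`. -/
def UniformlyErgodic (G : StochGame n S A) (τ : ℝ) : Prop :=
  ∀ (i : Fin n) (π : S i → A i → ℝ), IsPolicy π →
    (G.inducedChain i π).IsPrimitive ∧
    ∀ v ∈ stdSimplex ℝ (S i), ∀ v' ∈ stdSimplex ℝ (S i),
      ∑ s, |Matrix.vecMul (v - v') (G.inducedChain i π) s|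
        ≤ Real.exp (-1 / τ) * ∑ s, |v s - v' s|

/-! ### The virtual game -/

/-- The polytope of feasible occupation measures of player `i`. -/
def polytope (G : StochGame n S A) (i : Fin n) : Set (EuclideanSpace ℝ (S i × A i)) :=
  {ρ | (∀ x, 0 ≤ ρ x) ∧
    (∀ s', ∑ s, ∑ a, (G.P i s a s' - if s = s' then 1 else 0) * ρ (s, a) = 0) ∧
    ∑ s, ∑ a, ρ (s, a) = 1}

/-- The shrunk occupation polytope of player `i`. -/
def shrunk (G : StochGame n S A) (i : Fin n) (δ : ℝ) : Set (EuclideanSpace ℝ (S i × A i)) :=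
  {ρ | ρ ∈ G.polytope i ∧ ∀ x, δ ≤ ρ x}

/-- The payoff `V_i(ρ)` of player `i` in the virtual game. -/
noncomputable def payoff (G : StochGame n S A) (i : Fin n) (ρ : Profile S A) : ℝ :=
  ∑ s : ∀ j, S j, ∑ a : ∀ j, A j, (∏ j, ρ j (s j, a j)) * G.r i s a

/-- The payoff gradient `v_i(ρ_{-i})` of player `i` with respect to its own strategy. The sum is
over the joint states and actions whose `i`-th components are the given ones. -/
noncomputable def grad (G : StochGame n S A) (ρ : Profile S A) : Profile S A := fun i =>
  WithLp.toLp 2 fun x =>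
    ∑ s : ∀ j, S j, ∑ a : ∀ j, A j,
      if s i = x.1 ∧ a i = x.2 then
        (∏ j ∈ Finset.univ.erase i, ρ j (s j, a j)) * G.r i s a
      else 0

/-- The Euclidean inner product of two profiles, regarded as concatenated vectors. -/
noncomputable def dot (x y : Profile S A) : ℝ := ∑ i, inner ℝ (x i) (y i)

/-- The squared Euclidean distance of two profiles, regarded as concatenated vectors. -/
noncomputable def distSq (x y : Profile S A) : ℝ := ∑ i, ‖x i - y i‖ ^ 2

/-- `ρs` is a stable Nash equilibrium of the virtual game. -/
def IsStableNE (G : StochGame n S A) (ρs : Profile S A) : Prop :=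
  (∀ i, ρs i ∈ G.polytope i) ∧
  ∀ ρ : Profile S A, (∀ i, ρ i ∈ G.polytope i) →
    0 ≤ dot (G.grad ρ) (ρs - ρ) ∧ (dot (G.grad ρ) (ρs - ρ) = 0 ↔ ρ = ρs)

/-- `ρs` is an `L`-strongly stable Nash equilibrium of the virtual game. -/
def IsStronglyStableNE (G : StochGame n S A) (L : ℝ) (ρs : Profile S A) : Prop :=
  G.IsStableNE ρs ∧ 0 < L ∧
  ∀ ρ : Profile S A, (∀ i, ρ i ∈ G.polytope i) →
    L * distSq ρs ρ ≤ dot (G.grad ρ) (ρs - ρ)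

/-- The Nikaido–Isoda function. -/
noncomputable def nikaidoIsoda (G : StochGame n S A) (θ ρ : Profile S A) : ℝ :=
  ∑ i, (G.payoff i (Function.update ρ i (θ i)) - G.payoff i ρ)

/-! ### The dual averaging algorithm -/

/-- The stationary policy that corresponds to an occupation measure. -/
noncomputable def policyOf {i : Fin n} (ρ : EuclideanSpace ℝ (S i × A i)) (s : S i) (a : A i) :
    ℝ :=
  ρ (s, a) / ∑ a', ρ (s, a')

/-- The inputs of the algorithm: thresholds `δ`, regularizers `h`, step-sizes `η k` for
`k = 1, 2, …`, the waiting time `d` and the initial occupation measures `ρ0`. -/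
structure AlgInput {n : ℕ} (S A : Fin n → Type*) where
  δ : Fin n → ℝ
  h : ∀ i, EuclideanSpace ℝ (S i × A i) → ℝ
  η : ℕ → ℝ
  d : ℕ
  ρ0 : Profile S A

/-- What the players hold just before time `t`: the index of the current batch, the number of
time steps since it began, the dual scores, the occupation measures in use, the partial gradient
estimators, and the states that remain to be sampled in the batch. -/
structure Memory {n : ℕ} (S A : Fin n → Type*) where
  batch : ℕ
  elapsed : ℕ
  Y : Profile S A
  ρ : Profile S A
  R : Profile S A
  unvisited : ∀ i, Finset (S i)

open Classical in
/-- The maximizer of `⟨ρ, Y⟩ - h ρ` over the shrunk polytope of player `i`. -/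
noncomputable def argmax (G : StochGame n S A) (i : Fin n) (δ : ℝ)
    (h : EuclideanSpace ℝ (S i × A i) → ℝ) (Y : EuclideanSpace ℝ (S i × A i)) :
    EuclideanSpace ℝ (S i × A i) :=
  Classical.epsilon fun ρ =>
    ρ ∈ G.shrunk i δ ∧ IsMaxOn (fun ρ' => inner ℝ ρ' Y - h ρ') (G.shrunk i δ) ρ

/-- Start of batch `0`, with dual score zero. -/
def initMemory (I : AlgInput S A) : Memory S A where
  batch := 0
  elapsed := 0
  Y := 0
  ρ := I.ρ0
  R := 0
  unvisited := fun _ => Finset.univ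

/-- The gradient estimators after one time step in which the joint state and action are `x`: once
`d` steps of the batch have passed, player `i` uses the first visit to each of its states. -/
noncomputable def sampleR (G : StochGame n S A) (I : AlgInput S A) (m : Memory S A)
    (x : (∀ i, S i) × (∀ i, A i)) : Profile S A := fun i =>
  if I.d ≤ m.elapsed ∧ x.1 i ∈ m.unvisited i then
    m.R i + EuclideanSpace.single (x.1 i, x.2 i)
      (G.r i x.1 x.2 / policyOf (m.ρ i) (x.1 i) (x.2 i))
  else m.R i

/-- The states that remain to be sampled after one time step. -/
def nextUnvisited (I : AlgInput S A) (m : Memory S A) (x : (∀ i, S i) × (∀ i, A i)) :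
    ∀ i, Finset (S i) := fun i =>
  if I.d ≤ m.elapsed then (m.unvisited i).erase (x.1 i) else m.unvisited i

/-- The dual scores at the end of a batch. There is no step-size with index `0`: the scores stay
at zero in batch `0`. -/
noncomputable def nextY (I : AlgInput S A) (m : Memory S A) (R : Profile S A) : Profile S A :=
  fun i => m.Y i + (if m.batch = 0 then 0 else I.η m.batch) • R i

/-- One time step of all players. The batch ends as soon as every player has sampled each of its
states; then the dual scores and the occupation measures are updated. -/
noncomputable def step (G : StochGame n S A) (I : AlgInput S A) (m : Memory S A)
    (x : (∀ i, S i) × (∀ i, A i)) : Memory S A :=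
  if ∀ i, nextUnvisited I m x i = ∅ then
    { batch := m.batch + 1
      elapsed := 0
      Y := nextY I m (G.sampleR I m x)
      ρ := fun i => G.argmax i (I.δ i) (I.h i) (nextY I m (G.sampleR I m x) i)
      R := 0
      unvisited := fun _ => Finset.univ }
  else
    { m with
      elapsed := m.elapsed + 1
      R := G.sampleR I m x
      unvisited := nextUnvisited I m x }

/-- The memory just before time `t` along a trajectory `x`; it depends only on `x 0, …, x (t-1)`. -/
noncomputable def memory (G : StochGame n S A) (I : AlgInput S A)
    (x : ℕ → (∀ i, S i) × (∀ i, A i)) : ℕ → Memory S A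
  | 0 => initMemory I
  | t + 1 => G.step I (memory G I x t) (x t)

/-- The probability that the players, with memory `m`, choose the joint action `a` in the joint
state `s`. -/
noncomputable def actionProb (m : Memory S A) (s : ∀ i, S i) (a : ∀ i, A i) : ℝ :=
  ∏ i, policyOf (m.ρ i) (s i) (a i)

/-- `X t` is the joint state and action at time `t` when the game starts at the joint state `s0`
and all players follow the algorithm: given the past, the players' states move independently
according to their own kernels, and then the players draw their actions independently from their
current policies. -/
structure IsRun (G : StochGame n S A) (I : AlgInput S A) (s0 : ∀ i, S i) {Ω : Type*}
    [MeasurableSpace Ω] (μ : MeasureTheory.Measure Ω)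
    (X : ℕ → Ω → (∀ i, S i) × (∀ i, A i)) : Prop where
  measurable : ∀ t x, MeasurableSet {ω | X t ω = x}
  init : ∀ x, μ.real {ω | X 0 ω = x} =
    if x.1 = s0 then actionProb (initMemory I) x.1 x.2 else 0
  next : ∀ (t : ℕ) (x : ℕ → (∀ i, S i) × (∀ i, A i)),
    μ.real {ω | ∀ u ≤ t + 1, X u ω = x u} =
      μ.real {ω | ∀ u ≤ t, X u ω = x u} *
        ((∏ i, G.P i ((x t).1 i) ((x t).2 i) ((x (t + 1)).1 i)) *
          actionProb (G.memory I x (t + 1)) (x (t + 1)).1 (x (t + 1)).2)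

/-- The iterate `ρ^k`: the occupation measures in use from the first time of batch `k` on. -/
noncomputable def iter (G : StochGame n S A) (I : AlgInput S A)
    (x : ℕ → (∀ i, S i) × (∀ i, A i)) (k : ℕ) : Profile S A :=
  (G.memory I x (sInf {t | (G.memory I x t).batch = k})).ρ

/-- `w^k = η^1 + ⋯ + η^k`. -/
noncomputable def weight (η : ℕ → ℝ) (k : ℕ) : ℝ := ∑ l ∈ Finset.Icc 1 k, η l

/-- The averaged Nikaido–Isoda gap `d(k)` at `ρs` along a trajectory. -/
noncomputable def avgGap (G : StochGame n S A) (I : AlgInput S A) (ρs : Profile S A)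
    (x : ℕ → (∀ i, S i) × (∀ i, A i)) (k : ℕ) : ℝ :=
  ∑ l ∈ Finset.Icc 1 k, I.η l / weight I.η k * G.nikaidoIsoda ρs (G.iter I x l)

end StochGame

/-!
The averaged gap is controlled by the regret of dual averaging, up to the bias and the noise of the
gradient estimators.

*Regret.* The conjugate of a `K`-strongly convex regularizer is `1 / K`-smooth (`conjugate_add_le`).
Hence, along every trajectory, `∑ η^l ⟨R^l, σ - ρ^l⟩` is at most
`h σ - h ρ^1 + ∑ (η^l)² ‖R^l‖² / (2 K)` (`dualAveraging_regret`). Since the payoffs are multilinear,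
`Ψ(ρ*, ρ) = ⟨v(ρ), ρ* - ρ⟩` (`nikaidoIsoda_eq_dot`), and replacing `ρ*` by a nearby point `σ` of
the shrunk polytope costs at most `ε / 2`.

*Bias.* Given the history up to the beginning of a batch, the policies are fixed during the batch,
so the chains of the players run independently: the law of the run is a product over the players,
even on the event that one of them keeps missing a state (`IsRun.measureReal_avoidEvent_inter`). The
time of the first visit of player `i` to a state therefore says nothing about the other players,
whose laws are `2 exp(-d / τ)`-close to stationarity from step `d` on; the importance weight cancels
the probability of the own action. Summing over the time of the first visit, which is almost surely
finite by primitivity, shows that the estimator has conditional mean within `2 n exp(-d / τ)` of the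
payoff gradient and conditional second moment at most `1 / δ i` in each entry
(`IsRun.setIntegral_estimator`). The choice of `d` makes the total bias at most `ε / 3`.

*Noise.* The remaining fluctuations form a martingale for the sigma-algebras of the beginnings of
the batches. Kolmogorov's maximal inequality (`measure_exists_le_centered_sum`) bounds its running
maximum, and Markov's inequality bounds the quadratic term. As
`∑ η^l Ψ(ρ*, ρ^l) ≤ (5 ε / 6) w^k + const + quadratic term + martingale`
(`IsFeasible.ae_gapSum_le`), almost sure boundedness of the last two terms gives the asymptotic
claims, and their explicit tails give the finite-time bound, with room `ε w^k / 6` to spare.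
-/

set_option linter.unusedSectionVars false

open MeasureTheory Filter Topology

/-! ### Dual averaging over a compact convex set -/

section DualAveraging

variable {E : Type*} [NormedAddCommGroup E] [InnerProductSpace ℝ E]

theorem exists_isMaxOn_inner_sub {C : Set E} (hC : IsCompact C) (hne : C.Nonempty)
    {h : E → ℝ} (hcont : ContinuousOn h C) (Y : E) :
    ∃ p, p ∈ C ∧ IsMaxOn (fun q => inner ℝ q Y - h q) C p :=
  hC.exists_isMaxOn hne
    ((Continuous.inner continuous_id continuous_const).continuousOn.sub hcont)

/-- At a maximizer `q` of `⟨·, Y⟩ - h`, strong convexity of `h` makes the objective drop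
quadratically. -/
theorem inner_sub_le_of_isMaxOn {C : Set E} {h : E → ℝ} {K : ℝ} (hconv : StrongConvexOn C K h)
    {Y p q : E} (hp : p ∈ C) (hq : q ∈ C) (hmax : IsMaxOn (fun q => inner ℝ q Y - h q) C q) :
    inner ℝ p Y - h p ≤ inner ℝ q Y - h q - K / 2 * ‖p - q‖ ^ 2 := by
  have key : ∀ t : ℝ, 0 < t → t ≤ 1 →
      inner ℝ p Y - h p + (1 - t) * (K / 2 * ‖p - q‖ ^ 2) ≤ inner ℝ q Y - h q := by
    intro t ht ht1
    have hz := hconv.2 hp hq ht.le (sub_nonneg.2 ht1) (by ring)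
    have hm := hmax (hconv.1 hp hq ht.le (sub_nonneg.2 ht1) (by ring))
    simp only [Set.mem_ofPred_eq, inner_add_left, inner_smul_left, smul_eq_mul,
      RCLike.conj_to_real] at hz hm
    have : 0 ≤ t * ((inner ℝ q Y - h q) -
        (inner ℝ p Y - h p + (1 - t) * (K / 2 * ‖p - q‖ ^ 2))) := by
      nlinarith
    exact sub_nonneg.1 (nonneg_of_mul_nonneg_right this ht)
  have hlim : Tendsto (fun t : ℝ => inner ℝ p Y - h p + (1 - t) * (K / 2 * ‖p - q‖ ^ 2)) (𝓝[>] 0)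
      (𝓝 (inner ℝ p Y - h p + (1 - 0) * (K / 2 * ‖p - q‖ ^ 2))) :=
    (Continuous.tendsto (by fun_prop) 0).mono_left nhdsWithin_le_nhds
  have := le_of_tendsto hlim (by
    filter_upwards [Ioc_mem_nhdsGT (show (0 : ℝ) < 1 by norm_num)] with t ht using key t ht.1 ht.2)
  linarith

/-- The convex conjugate of a `K`-strongly convex function is `1 / K`-smooth. -/
theorem conjugate_add_le {C : Set E} {h : E → ℝ} {K : ℝ} (hK : 0 < K)
    (hconv : StrongConvexOn C K h) {Y Z p q : E} (hp : p ∈ C) (hq : q ∈ C)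
    (hmax : IsMaxOn (fun q => inner ℝ q Y - h q) C q) :
    inner ℝ p (Y + Z) - h p ≤ inner ℝ q Y - h q + inner ℝ q Z + ‖Z‖ ^ 2 / (2 * K) := by
  have h1 := inner_sub_le_of_isMaxOn hconv hp hq hmax
  have h2 : inner ℝ (p - q) Z ≤ ‖p - q‖ * ‖Z‖ := real_inner_le_norm _ _
  have h3 : ‖p - q‖ * ‖Z‖ ≤ K / 2 * ‖p - q‖ ^ 2 + ‖Z‖ ^ 2 / (2 * K) := by
    have : K / 2 * ‖p - q‖ ^ 2 + ‖Z‖ ^ 2 / (2 * K) - ‖p - q‖ * ‖Z‖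
        = (K * ‖p - q‖ - ‖Z‖) ^ 2 / (2 * K) := by field_simp; ring
    nlinarith [div_nonneg (sq_nonneg (K * ‖p - q‖ - ‖Z‖)) (by positivity : 0 ≤ 2 * K)]
  rw [inner_add_right]
  rw [inner_sub_left] at h2
  linarith

/-- The regret bound of dual averaging: the iterates `p l` maximize `⟨·, Y l⟩ - h`, and the scores
move by `Z l`. -/
theorem dualAveraging_regret {C : Set E} {h : E → ℝ} {K : ℝ} (hK : 0 < K)
    (hconv : StrongConvexOn C K h) (Y Z p : ℕ → E) (hY0 : Y 0 = 0)
    (hY : ∀ l, Y (l + 1) = Y l + Z l) (hp : ∀ l, p l ∈ C)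
    (hmax : ∀ l, IsMaxOn (fun q => inner ℝ q (Y l) - h q) C (p l)) {σ : E} (hσ : σ ∈ C) (k : ℕ) :
    ∑ l ∈ Finset.range k, inner ℝ (σ - p l) (Z l)
      ≤ h σ - h (p 0) + ∑ l ∈ Finset.range k, ‖Z l‖ ^ 2 / (2 * K) := by
  have key : inner ℝ (p k) (Y k) - h (p k) ≤ - h (p 0) +
      ∑ l ∈ Finset.range k, (inner ℝ (p l) (Z l) + ‖Z l‖ ^ 2 / (2 * K)) := by
    induction k with
    | zero => simp [hY0]
    | succ k ih =>
      have := conjugate_add_le hK hconv (Z := Z k) (hp (k + 1)) (hp k) (hmax k)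
      rw [← hY] at this
      rw [Finset.sum_range_succ]
      linarith
  have hσY : inner ℝ σ (Y k) = ∑ l ∈ Finset.range k, inner ℝ σ (Z l) := by
    have hsum : ∀ k, Y k = ∑ l ∈ Finset.range k, Z l := by
      intro k
      induction k with
      | zero => simp [hY0]
      | succ k ih => rw [Finset.sum_range_succ, hY, ih]
    rw [hsum, inner_sum]
  have h1 : inner ℝ σ (Y k) - h σ ≤ inner ℝ (p k) (Y k) - h (p k) := hmax k hσ
  simp only [inner_sub_left, Finset.sum_sub_distrib]
  rw [Finset.sum_add_distrib] at key
  linarith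

end DualAveraging

/-! ### Maximal inequalities and conditional expectations -/

section Maximal

variable {Ω : Type*} {m0 : MeasurableSpace Ω} {μ : Measure Ω} [IsProbabilityMeasure μ]

theorem memLp_sub_condExp {m : MeasurableSpace Ω} {Z : Ω → ℝ} (hZ : MemLp Z 2 μ) :
    MemLp (fun ω => Z ω - (μ[Z | m]) ω) 2 μ :=
  hZ.sub (hZ.condExp one_le_two)

theorem integral_sq_sub_condExp_le {m : MeasurableSpace Ω} (hm : m ≤ m0) {Z : Ω → ℝ}
    (hZ : MemLp Z 2 μ) : ∫ ω, (Z ω - (μ[Z | m]) ω) ^ 2 ∂μ ≤ ∫ ω, Z ω ^ 2 ∂μ := by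
  have h1 := ProbabilityTheory.condVar_ae_le_condExp_sq hm hZ
  have h2 := integral_mono_ae ProbabilityTheory.integrable_condVar integrable_condExp h1
  rw [integral_condExp hm, ProbabilityTheory.condVar, integral_condExp hm] at h2
  simpa using h2

/-- A function measurable with respect to `m` is orthogonal to `Z - μ[Z | m]`. -/
theorem setIntegral_mul_sub_condExp {m : MeasurableSpace Ω} (hm : m ≤ m0) {Z W : Ω → ℝ}
    (hZ : MemLp Z 2 μ) (hW : MemLp W 2 μ) (hWm : StronglyMeasurable[m] W) {s : Set Ω}
    (hs : MeasurableSet[m] s) :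
    ∫ ω in s, W ω * (Z ω - (μ[Z | m]) ω) ∂μ = 0 := by
  have hWZ : Integrable (W * Z) μ := hZ.integrable_mul hW |>.congr (by
    filter_upwards with ω using mul_comm _ _)
  have hWc : Integrable (W * μ[Z | m]) μ :=
    (hZ.condExp one_le_two).integrable_mul hW |>.congr (by
      filter_upwards with ω using mul_comm _ _)
  have h1 : μ[W * Z | m] =ᵐ[μ] W * μ[Z | m] :=
    condExp_mul_of_stronglyMeasurable_left hWm hWZ (hZ.integrable one_le_two)
  have h2 : ∫ ω in s, (W * Z) ω ∂μ = ∫ ω in s, (W * μ[Z | m]) ω ∂μ := by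
    rw [← setIntegral_condExp hm hWZ hs]
    exact setIntegral_congr_ae (hm _ hs) (by filter_upwards [h1] with ω hω _ using hω)
  have : (fun ω => W ω * (Z ω - (μ[Z | m]) ω)) = fun ω => (W * Z) ω - (W * μ[Z | m]) ω := by
    ext ω; simp [mul_sub]
  rw [this, integral_sub hWZ.integrableOn hWc.integrableOn, h2, sub_self]

/-- Kolmogorov's maximal inequality for the sums of the centred increments `Z l - μ[Z l | ℱ l]`. -/
theorem measure_exists_le_centered_sum (ℱ : Filtration ℕ m0) (Z : ℕ → Ω → ℝ)
    (hZm : ∀ l, StronglyMeasurable[ℱ (l + 1)] (Z l)) (hZ : ∀ l, MemLp (Z l) 2 μ) {V : ℝ}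
    (hV : ∀ j, ∑ l ∈ Finset.range j, ∫ ω, Z l ω ^ 2 ∂μ ≤ V) {r : ℝ} (hr : 0 < r) :
    μ.real {ω | ∃ j, r ≤ ∑ l ∈ Finset.range j, (Z l ω - (μ[Z l | ℱ l]) ω)} ≤ V / r ^ 2 := by
  set N : ℕ → Ω → ℝ := fun j ω => ∑ l ∈ Finset.range j, (Z l ω - (μ[Z l | ℱ l]) ω) with hN
  have hNsucc : ∀ j ω, N (j + 1) ω = N j ω + (Z j ω - (μ[Z j | ℱ j]) ω) := by
    intro j ω; simp only [hN, Finset.sum_range_succ]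
  have hNm : ∀ j, StronglyMeasurable[ℱ j] (N j) := by
    intro j
    refine Finset.stronglyMeasurable_fun_sum _ fun l hl => ?_
    have hlj : l + 1 ≤ j := Finset.mem_range.1 hl
    exact ((hZm l).mono (ℱ.mono hlj)).sub
      (stronglyMeasurable_condExp.mono (ℱ.mono (by omega)))
  have hNL : ∀ j, MemLp (N j) 2 μ := fun j =>
    memLp_finsetSum _ fun l _ => memLp_sub_condExp (hZ l)
  have hexp : ∀ j (s : Set Ω), MeasurableSet[ℱ j] s → ∫ ω in s, N (j + 1) ω ^ 2 ∂μ =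
      ∫ ω in s, N j ω ^ 2 ∂μ + ∫ ω in s, (Z j ω - (μ[Z j | ℱ j]) ω) ^ 2 ∂μ := by
    intro j s hs
    have h0 := setIntegral_mul_sub_condExp (ℱ.le j) (hZ j) (hNL j) (hNm j) hs
    have hi1 : Integrable (fun ω => N j ω ^ 2) μ := (hNL j).integrable_sq
    have hi2 : Integrable (fun ω => (Z j ω - (μ[Z j | ℱ j]) ω) ^ 2) μ :=
      (memLp_sub_condExp (hZ j)).integrable_sq
    have hi3 : Integrable (fun ω => N j ω * (Z j ω - (μ[Z j | ℱ j]) ω)) μ :=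
      (hNL j).integrable_mul (memLp_sub_condExp (hZ j))
    have : (fun ω => N (j + 1) ω ^ 2) = fun ω => (N j ω ^ 2 + (Z j ω - (μ[Z j | ℱ j]) ω) ^ 2) +
        2 * (N j ω * (Z j ω - (μ[Z j | ℱ j]) ω)) := by
      ext ω; rw [hNsucc]; ring
    have hi12 : Integrable (fun ω => N j ω ^ 2 + (Z j ω - (μ[Z j | ℱ j]) ω) ^ 2) μ := hi1.add hi2
    rw [this, integral_add hi12.integrableOn (hi3.const_mul 2).integrableOn,
      integral_add hi1.integrableOn hi2.integrableOn, integral_const_mul, h0]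
    ring
  have hsub : Submartingale (fun j ω => N j ω ^ 2) ℱ μ := by
    refine submartingale_of_setIntegral_le_succ (fun j => (hNm j).pow 2)
      (fun j => (hNL j).integrable_sq) fun j s hs => ?_
    rw [hexp j s hs]
    exact le_add_of_nonneg_right (integral_nonneg fun ω => sq_nonneg _)
  have hsecond : ∀ j, ∫ ω, N j ω ^ 2 ∂μ ≤ V := by
    intro j
    refine le_trans ?_ (hV j)
    induction j with
    | zero => simp [hN]
    | succ j ih =>
      have := hexp j Set.univ MeasurableSet.univ
      simp only [Measure.restrict_univ] at this
      rw [this, Finset.sum_range_succ]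
      exact add_le_add ih (integral_sq_sub_condExp_le (ℱ.le j) (hZ j))
  have hV0 : 0 ≤ V := by simpa using hV 0
  have hfin : ∀ j, μ.real {ω | ∃ i ≤ j, r ≤ N i ω} ≤ V / r ^ 2 := by
    intro j
    have hmax := maximal_ineq hsub (fun j ω => sq_nonneg (N j ω)) (ε := ⟨r ^ 2, by positivity⟩) j
    set A : Set Ω := {ω | ((⟨r ^ 2, by positivity⟩ : NNReal) : ℝ) ≤
      (Finset.range (j + 1)).sup' Finset.nonempty_range_add_one fun k => N k ω ^ 2} with hA
    have hsubset : {ω | ∃ i ≤ j, r ≤ N i ω} ⊆ A := by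
      rintro ω ⟨i, hij, hi⟩
      refine le_trans ?_ (Finset.le_sup' (fun k => N k ω ^ 2)
        (Finset.mem_range.2 (Nat.lt_succ_of_le hij)))
      exact pow_le_pow_left₀ hr.le hi 2
    have hint : ∫ ω in A, N j ω ^ 2 ∂μ ≤ V :=
      (setIntegral_le_integral (hNL j).integrable_sq
        (by filter_upwards with ω using sq_nonneg _)).trans (hsecond j)
    have h2 := ENNReal.toReal_mono ENNReal.ofReal_ne_top
      (hmax.trans (ENNReal.ofReal_le_ofReal hint))
    rw [ENNReal.toReal_mul, ENNReal.toReal_ofReal hV0] at h2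
    rw [le_div_iff₀ (by positivity)]
    have h3 : μ.real {ω | ∃ i ≤ j, r ≤ N i ω} ≤ μ.real A := measureReal_mono hsubset
    have h4 : r ^ 2 * μ.real A ≤ V := h2
    nlinarith [sq_nonneg r]
  have hunion : {ω | ∃ j, r ≤ N j ω} = ⋃ j, {ω | ∃ i ≤ j, r ≤ N i ω} := by
    ext ω
    simp only [Set.mem_ofPred_eq, Set.mem_iUnion]
    exact ⟨fun ⟨j, hj⟩ => ⟨j, j, le_rfl, hj⟩, fun ⟨_, i, _, hi⟩ => ⟨i, hi⟩⟩
  have hmono : Monotone fun j => {ω | ∃ i ≤ j, r ≤ N i ω} := by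
    rintro a b hab ω ⟨i, hi, h⟩
    exact ⟨i, hi.trans hab, h⟩
  have hlim := (ENNReal.tendsto_toReal (measure_ne_top μ _)).comp
    (tendsto_measure_iUnion_atTop (μ := μ) hmono)
  rw [hunion]
  exact le_of_tendsto' hlim hfin

theorem condExp_nonneg_of_setIntegral_nonneg {m : MeasurableSpace Ω} (hm : m ≤ m0)
    {f : Ω → ℝ} (hf : Integrable f μ)
    (h : ∀ B, MeasurableSet[m] B → 0 ≤ ∫ ω in B, f ω ∂μ) : ∀ᵐ ω ∂μ, 0 ≤ (μ[f | m]) ω := by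
  refine ae_of_ae_trim hm ?_
  refine ae_nonneg_of_forall_setIntegral_nonneg (integrable_condExp.trim hm
    stronglyMeasurable_condExp) fun B hB _ => ?_
  rw [← setIntegral_trim hm stronglyMeasurable_condExp hB, setIntegral_condExp hm hf hB]
  exact h B hB

/-- Markov's inequality for the partial sums of nonnegative functions, uniformly in the number of
summands. -/
theorem measure_exists_le_sum_le {f : ℕ → Ω → ℝ} (hf : ∀ l, Integrable (f l) μ)
    (hf0 : ∀ l ω, 0 ≤ f l ω) {V : ℝ} (hV : ∀ j, ∑ l ∈ Finset.range j, ∫ ω, f l ω ∂μ ≤ V) {r : ℝ}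
    (hr : 0 < r) : μ.real {ω | ∃ j, r ≤ ∑ l ∈ Finset.range j, f l ω} ≤ V / r := by
  have hmono : Monotone fun j => {ω | r ≤ ∑ l ∈ Finset.range j, f l ω} := by
    intro a b hab ω hω
    exact le_trans hω (Finset.sum_le_sum_of_subset_of_nonneg (Finset.range_mono hab)
      fun l _ _ => hf0 l ω)
  have hunion : {ω | ∃ j, r ≤ ∑ l ∈ Finset.range j, f l ω} =
      ⋃ j, {ω | r ≤ ∑ l ∈ Finset.range j, f l ω} := by ext; simp
  have hlim := (ENNReal.tendsto_toReal (measure_ne_top μ _)).comp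
    (tendsto_measure_iUnion_atTop (μ := μ) hmono)
  rw [hunion]
  refine le_of_tendsto' hlim fun j => ?_
  have h1 := mul_meas_ge_le_integral_of_nonneg (μ := μ)
    (f := fun ω => ∑ l ∈ Finset.range j, f l ω)
    (Eventually.of_forall fun ω => Finset.sum_nonneg fun l _ => hf0 l ω)
    (integrable_finsetSum _ fun l _ => hf l) r
  rw [integral_finsetSum _ fun l _ => hf l] at h1
  rw [le_div_iff₀ hr, mul_comm]
  exact h1.trans (hV j)

end Maximal

/-! ### Hitting times of a finite chain -/

section Chain

variable {T : Type*} [Fintype T] [DecidableEq T]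

/-- The law at time `u` of a chain with transition matrix `Q` and initial law `ν`, restricted to
the trajectories that avoid `F` at each of the times `d, …, u - 1`. -/
noncomputable def tabooLaw (Q : Matrix T T ℝ) (F : Finset T) (d : ℕ) (ν : T → ℝ) : ℕ → T → ℝ
  | 0 => ν
  | u + 1 => Matrix.vecMul (fun s => if d ≤ u ∧ s ∈ F then 0 else tabooLaw Q F d ν u s) Q

variable {Q : Matrix T T ℝ} {F : Finset T} {d : ℕ} {ν : T → ℝ}

theorem vecMul_nonneg_of_stochastic (hQ : ∀ s, Q s ∈ stdSimplex ℝ T) {v : T → ℝ}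
    (hv : ∀ s, 0 ≤ v s) (s : T) : 0 ≤ Matrix.vecMul v Q s :=
  Finset.sum_nonneg fun x _ => mul_nonneg (hv x) ((hQ x).1 s)

theorem sum_vecMul_of_stochastic (hQ : ∀ s, Q s ∈ stdSimplex ℝ T) (v : T → ℝ) :
    ∑ s, Matrix.vecMul v Q s = ∑ s, v s := by
  simp only [Matrix.vecMul, dotProduct]
  rw [Finset.sum_comm]
  refine Finset.sum_congr rfl fun x _ => ?_
  rw [← Finset.mul_sum, (hQ x).2, mul_one]

theorem tabooLaw_nonneg (hQ : ∀ s, Q s ∈ stdSimplex ℝ T) (hν : ν ∈ stdSimplex ℝ T) (u : ℕ)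
    (s : T) : 0 ≤ tabooLaw Q F d ν u s := by
  induction u generalizing s with
  | zero => exact hν.1 s
  | succ u ih =>
    refine vecMul_nonneg_of_stochastic hQ (fun x => ?_) s
    split_ifs
    exacts [le_rfl, ih x]

theorem tabooLaw_empty_mem_stdSimplex (hQ : ∀ s, Q s ∈ stdSimplex ℝ T)
    (hν : ν ∈ stdSimplex ℝ T) (u : ℕ) : tabooLaw Q ∅ d ν u ∈ stdSimplex ℝ T := by
  refine ⟨tabooLaw_nonneg hQ hν u, ?_⟩
  induction u with
  | zero => exact hν.2
  | succ u ih => rw [tabooLaw, sum_vecMul_of_stochastic hQ]; simpa using ih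

theorem sum_tabooLaw_singleton_succ (hQ : ∀ s, Q s ∈ stdSimplex ℝ T) (z : T) (u : ℕ) :
    ∑ s, tabooLaw Q {z} d ν (u + 1) s
      = ∑ s, tabooLaw Q {z} d ν u s - if d ≤ u then tabooLaw Q {z} d ν u z else 0 := by
  rw [tabooLaw, sum_vecMul_of_stochastic hQ]
  by_cases hd : d ≤ u
  · simp only [hd, true_and, Finset.mem_singleton, if_true]
    rw [← Finset.add_sum_erase _ (fun s => tabooLaw Q {z} d ν u s) (Finset.mem_univ z),
      ← Finset.add_sum_erase _ _ (Finset.mem_univ z), if_pos rfl, zero_add, add_sub_cancel_left]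
    exact Finset.sum_congr rfl fun s hs => if_neg (Finset.mem_erase.1 hs).1
  · simp [hd]

/-- A primitive chain visits every state: the mass of the trajectories that avoid `z` vanishes. -/
theorem tendsto_sum_tabooLaw_singleton (hQ : ∀ s, Q s ∈ stdSimplex ℝ T) (hprim : Q.IsPrimitive)
    (hν : ν ∈ stdSimplex ℝ T) (z : T) :
    Tendsto (fun u => ∑ s, tabooLaw Q {z} d ν u s) atTop (𝓝 0) := by
  set t := tabooLaw Q {z} d ν with ht
  have ht0 : ∀ u s, 0 ≤ t u s := tabooLaw_nonneg hQ hν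
  set M : ℕ → ℝ := fun u => ∑ s, t u s with hM
  have hMsucc : ∀ u, M (u + 1) = M u - if d ≤ u then t u z else 0 :=
    sum_tabooLaw_singleton_succ hQ z
  have hM0 : ∀ u, 0 ≤ M u := fun u => Finset.sum_nonneg fun s _ => ht0 u s
  have hanti : Antitone M := by
    refine antitone_nat_of_succ_le fun u => ?_
    rw [hMsucc]
    split_ifs
    · linarith [ht0 u z]
    · simp
  obtain ⟨g, hg⟩ : ∃ g, Tendsto M atTop (𝓝 g) :=
    ⟨_, tendsto_atTop_ciInf hanti ⟨0, by rintro _ ⟨u, rfl⟩; exact hM0 u⟩⟩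
  obtain ⟨N, -, hN⟩ := hprim.2
  obtain ⟨c, hc, hcN⟩ : ∃ c, 0 < c ∧ ∀ s, c ≤ (Q ^ N) s z := by
    have : Nonempty T := ⟨z⟩
    obtain ⟨s, hs⟩ := Finite.exists_min fun s => (Q ^ N) s z
    exact ⟨_, hN s z, hs⟩
  -- the free chain started from the taboo law dominates the taboo law, and what it has in excess
  -- is the mass that has been killed
  have hexc : ∀ u, d ≤ u → ∀ v, (∀ s, t (u + v) s ≤ Matrix.vecMul (t u) (Q ^ v) s) ∧
      ∑ s, Matrix.vecMul (t u) (Q ^ v) s = M u := by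
    intro u hu v
    induction v with
    | zero => simp [hM]
    | succ v ih =>
      have hstep : Matrix.vecMul (t u) (Q ^ (v + 1))
          = Matrix.vecMul (Matrix.vecMul (t u) (Q ^ v)) Q := by
        rw [Matrix.vecMul_vecMul, pow_succ]
      rw [hstep, sum_vecMul_of_stochastic hQ]
      refine ⟨fun s => ?_, ih.2⟩
      rw [← add_assoc, ht, tabooLaw]
      refine Finset.sum_le_sum fun x _ => mul_le_mul_of_nonneg_right ?_ ((hQ x).1 s)
      dsimp only
      split_ifs
      · exact (ht0 _ _).trans (ih.1 x)
      · exact ih.1 x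
  have hineq : ∀ u, d ≤ u → c * M u ≤ M u - M (u + N + 1) := by
    intro u hu
    obtain ⟨h1, h2⟩ := hexc u hu N
    have h3 : c * M u ≤ Matrix.vecMul (t u) (Q ^ N) z := by
      rw [hM, Finset.mul_sum]
      refine Finset.sum_le_sum fun x _ => ?_
      rw [mul_comm]
      exact mul_le_mul_of_nonneg_left (hcN x) (ht0 u x)
    have h4 : Matrix.vecMul (t u) (Q ^ N) z - t (u + N) z
        ≤ ∑ s, (Matrix.vecMul (t u) (Q ^ N) s - t (u + N) s) :=
      Finset.single_le_sum (f := fun s => Matrix.vecMul (t u) (Q ^ N) s - t (u + N) s)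
        (fun s _ => sub_nonneg.2 (h1 s)) (Finset.mem_univ z)
    rw [Finset.sum_sub_distrib, h2] at h4
    have h5 := hMsucc (u + N)
    rw [if_pos (by omega)] at h5
    have h6 : M (u + N) = ∑ s, t (u + N) s := rfl
    linarith
  have hlim : c * g ≤ g - g := by
    refine le_of_tendsto_of_tendsto (hg.const_mul c)
      (hg.sub (hg.comp (tendsto_add_atTop_nat (N + 1)))) ?_
    filter_upwards [eventually_ge_atTop d] with u hu
    exact hineq u hu
  have hg0 : 0 ≤ g := ge_of_tendsto' hg hM0
  have : g = 0 := by nlinarith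
  rwa [this] at hg

theorem hasSum_tabooLaw_singleton (hQ : ∀ s, Q s ∈ stdSimplex ℝ T) (hprim : Q.IsPrimitive)
    (hν : ν ∈ stdSimplex ℝ T) (z : T) :
    HasSum (fun u => if d ≤ u then tabooLaw Q {z} d ν u z else 0) 1 := by
  rw [hasSum_iff_tendsto_nat_of_nonneg]
  · have h : ∀ U, ∑ u ∈ Finset.range U, (if d ≤ u then tabooLaw Q {z} d ν u z else 0)
        = 1 - ∑ s, tabooLaw Q {z} d ν U s := by
      intro U
      induction U with
      | zero => simp [tabooLaw, hν.2]
      | succ U ih =>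
        rw [Finset.sum_range_succ, ih, sum_tabooLaw_singleton_succ hQ]
        ring
    simp_rw [h]
    simpa using (tendsto_sum_tabooLaw_singleton (d := d) hQ hprim hν z).const_sub 1
  · intro u
    split_ifs
    exacts [tabooLaw_nonneg hQ hν u z, le_rfl]

end Chain

namespace StochGame

variable {n : ℕ} {S A : Fin n → Type*} [∀ i, Fintype (S i)] [∀ i, Fintype (A i)]
  [∀ i, DecidableEq (S i)] [∀ i, DecidableEq (A i)]

/-! ### Expectations under product weights -/

theorem sum_sum_prod_eq_prod_sum (f : ∀ j, S j × A j → ℝ) :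
    ∑ s : ∀ j, S j, ∑ a : ∀ j, A j, ∏ j, f j (s j, a j) = ∏ j, ∑ x, f j x := by
  have h : ∀ j, ∑ x, f j x = ∑ s, ∑ a, f j (s, a) := fun j => Fintype.sum_prod_type _
  simp_rw [h, Finset.prod_univ_sum, Fintype.piFinset_univ]

/-- The joint reward of player `i`, summed against the product of the weights `f j`. -/
noncomputable def productValue (G : StochGame n S A) (i : Fin n) (f : ∀ j, S j × A j → ℝ) : ℝ :=
  ∑ s : ∀ j, S j, ∑ a : ∀ j, A j, (∏ j, f j (s j, a j)) * G.r i s a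

theorem productValue_nonneg (G : StochGame n S A) (i : Fin n) {f : ∀ j, S j × A j → ℝ}
    (hf : ∀ j x, 0 ≤ f j x) : 0 ≤ G.productValue i f :=
  Finset.sum_nonneg fun _ _ => Finset.sum_nonneg fun _ _ =>
    mul_nonneg (Finset.prod_nonneg fun _ _ => hf _ _) (G.r_mem _ _ _).1

theorem productValue_le_one (G : StochGame n S A) (i : Fin n) {f : ∀ j, S j × A j → ℝ}
    (hf : ∀ j x, 0 ≤ f j x) (hf1 : ∀ j, ∑ x, f j x = 1) : G.productValue i f ≤ 1 := by
  calc G.productValue i f ≤ ∑ s : ∀ j, S j, ∑ a : ∀ j, A j, ∏ j, f j (s j, a j) := by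
        refine Finset.sum_le_sum fun s _ => Finset.sum_le_sum fun a _ => ?_
        exact mul_le_of_le_one_right (Finset.prod_nonneg fun _ _ => hf _ _) (G.r_mem _ _ _).2
    _ = 1 := by rw [sum_sum_prod_eq_prod_sum]; simp [hf1]

/-- The `ℓ¹` distance of two product weights is at most the sum of the `ℓ¹` distances of their
factors. -/
theorem sum_abs_prod_sub_prod_le {f g : ∀ j, S j × A j → ℝ} (hf : ∀ j, ∑ x, |f j x| ≤ 1)
    (hg : ∀ j, ∑ x, |g j x| ≤ 1) :
    ∑ s : ∀ j, S j, ∑ a : ∀ j, A j, |∏ j, f j (s j, a j) - ∏ j, g j (s j, a j)|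
      ≤ ∑ j, ∑ x, |f j x - g j x| := by
  classical
  let hyb : Finset (Fin n) → ∀ j, S j × A j → ℝ := fun t j => if j ∈ t then g j else f j
  have key : ∀ t : Finset (Fin n),
      ∑ s : ∀ j, S j, ∑ a : ∀ j, A j, |∏ j, f j (s j, a j) - ∏ j, hyb t j (s j, a j)|
        ≤ ∑ j ∈ t, ∑ x, |f j x - g j x| := by
    intro t
    induction t using Finset.induction_on with
    | empty => simp [hyb]
    | insert k t hk ih =>
      let D : ∀ j, S j × A j → ℝ := Function.update (hyb t) k (fun x => f k x - g k x)
      have hD : ∀ (s : ∀ j, S j) (a : ∀ j, A j),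
          ∏ j, hyb t j (s j, a j) - ∏ j, hyb (insert k t) j (s j, a j)
          = ∏ j, D j (s j, a j) := by
        intro s a
        rw [← Finset.mul_prod_erase _ _ (Finset.mem_univ k),
          ← Finset.mul_prod_erase _ (fun j => hyb (insert k t) j (s j, a j)) (Finset.mem_univ k),
          ← Finset.mul_prod_erase _ (fun j => D j (s j, a j)) (Finset.mem_univ k)]
        have h1 : ∏ j ∈ Finset.univ.erase k, hyb (insert k t) j (s j, a j)
            = ∏ j ∈ Finset.univ.erase k, hyb t j (s j, a j) := by
          refine Finset.prod_congr rfl fun j hj => ?_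
          simp [hyb, (Finset.mem_erase.1 hj).1]
        have h2 : ∏ j ∈ Finset.univ.erase k, D j (s j, a j)
            = ∏ j ∈ Finset.univ.erase k, hyb t j (s j, a j) := by
          refine Finset.prod_congr rfl fun j hj => ?_
          simp [D, (Finset.mem_erase.1 hj).1]
        rw [h1, h2]
        simp [D, hyb, hk]
        ring
      have hDsum : ∑ s : ∀ j, S j, ∑ a : ∀ j, A j, |∏ j, D j (s j, a j)|
          ≤ ∑ x, |f k x - g k x| := by
        simp_rw [Finset.abs_prod]
        rw [sum_sum_prod_eq_prod_sum fun j x => |D j x|,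
          ← Finset.mul_prod_erase _ _ (Finset.mem_univ k)]
        simp only [D, Function.update_self]
        refine mul_le_of_le_one_right (Finset.sum_nonneg fun _ _ => abs_nonneg _) ?_
        refine Finset.prod_le_one (fun _ _ => Finset.sum_nonneg fun _ _ => abs_nonneg _) ?_
        intro j hj
        simp only [Function.update_of_ne (Finset.mem_erase.1 hj).1, hyb]
        split_ifs
        exacts [hg j, hf j]
      rw [Finset.sum_insert hk]
      calc _ ≤ ∑ s : ∀ j, S j, ∑ a : ∀ j, A j,
            (|∏ j, f j (s j, a j) - ∏ j, hyb t j (s j, a j)| + |∏ j, D j (s j, a j)|) := by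
            refine Finset.sum_le_sum fun s _ => Finset.sum_le_sum fun a _ => ?_
            rw [← hD]
            exact abs_sub_le _ _ _
        _ ≤ _ := by
            simp only [Finset.sum_add_distrib]
            linarith
  have := key Finset.univ
  simpa [hyb] using this

theorem abs_productValue_sub_le (G : StochGame n S A) (i : Fin n) {f g : ∀ j, S j × A j → ℝ}
    (hf : ∀ j, ∑ x, |f j x| ≤ 1) (hg : ∀ j, ∑ x, |g j x| ≤ 1) :
    |G.productValue i f - G.productValue i g| ≤ ∑ j, ∑ x, |f j x - g j x| := by
  refine le_trans ?_ (sum_abs_prod_sub_prod_le hf hg)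
  unfold productValue
  simp only [← Finset.sum_sub_distrib]
  refine (Finset.abs_sum_le_sum_abs _ _).trans (Finset.sum_le_sum fun s _ => ?_)
  refine (Finset.abs_sum_le_sum_abs _ _).trans (Finset.sum_le_sum fun a _ => ?_)
  rw [← sub_mul, abs_mul, abs_of_nonneg (G.r_mem i s a).1]
  exact mul_le_of_le_one_right (abs_nonneg _) (G.r_mem i s a).2

/-! ### The payoff gradient -/

theorem grad_apply_eq_productValue (G : StochGame n S A) (ρ : Profile S A) (i : Fin n)
    (x : S i × A i) :
    G.grad ρ i x =
      G.productValue i (Function.update (fun j => (ρ j : S j × A j → ℝ)) i (Pi.single x 1)) := by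
  simp only [grad, productValue]
  refine Finset.sum_congr rfl fun s _ => Finset.sum_congr rfl fun a _ => ?_
  rw [← Finset.mul_prod_erase _ _ (Finset.mem_univ i)]
  have h : ∏ j ∈ Finset.univ.erase i,
      (Function.update (fun j => (ρ j : S j × A j → ℝ)) i (Pi.single x 1)) j (s j, a j)
        = ∏ j ∈ Finset.univ.erase i, ρ j (s j, a j) :=
    Finset.prod_congr rfl fun j hj => by simp [(Finset.mem_erase.1 hj).1]
  rw [h, Function.update_self, Pi.single_apply]
  by_cases hx : s i = x.1 ∧ a i = x.2
  · rw [if_pos hx, if_pos (Prod.ext hx.1 hx.2), one_mul]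
  · rw [if_neg hx, if_neg (fun h => hx ⟨congrArg Prod.fst h, congrArg Prod.snd h⟩)]
    simp

theorem payoff_update_eq_inner (G : StochGame n S A) (ρ : Profile S A) (i : Fin n)
    (θ : EuclideanSpace ℝ (S i × A i)) :
    G.payoff i (Function.update ρ i θ) = inner ℝ (G.grad ρ i) θ := by
  have h1 : inner ℝ (G.grad ρ i) θ = ∑ x, θ x * G.grad ρ i x := by
    simp [PiLp.inner_apply]
  rw [h1]
  simp only [grad, payoff, Finset.mul_sum]
  rw [Finset.sum_comm (s := (Finset.univ : Finset (S i × A i)))]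
  refine Finset.sum_congr rfl fun s _ => ?_
  rw [Finset.sum_comm (s := (Finset.univ : Finset (S i × A i)))]
  refine Finset.sum_congr rfl fun a _ => ?_
  rw [Finset.sum_eq_single (s i, a i)]
  · rw [if_pos ⟨rfl, rfl⟩, ← mul_assoc, ← Finset.mul_prod_erase _ _ (Finset.mem_univ i)]
    congr 2
    · simp
    · exact Finset.prod_congr rfl fun j hj => by simp [(Finset.mem_erase.1 hj).1]
  · intro x _ hx
    rw [if_neg (fun h => hx (Prod.ext h.1.symm h.2.symm)), mul_zero]
  · simp

theorem nikaidoIsoda_eq_dot (G : StochGame n S A) (θ ρ : Profile S A) :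
    G.nikaidoIsoda θ ρ = dot (G.grad ρ) (θ - ρ) := by
  refine Finset.sum_congr rfl fun i _ => ?_
  have h : G.payoff i ρ = inner ℝ (G.grad ρ i) (ρ i) := by
    rw [← payoff_update_eq_inner, Function.update_eq_self]
  rw [payoff_update_eq_inner, h, Pi.sub_apply, inner_sub_right]

theorem sum_eq_one_of_mem_polytope {G : StochGame n S A} {i : Fin n}
    {ρ : EuclideanSpace ℝ (S i × A i)} (h : ρ ∈ G.polytope i) : ∑ x, ρ x = 1 := by
  rw [Fintype.sum_prod_type]; exact h.2.2

theorem sum_abs_eq_one_of_mem_polytope {G : StochGame n S A} {i : Fin n}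
    {ρ : EuclideanSpace ℝ (S i × A i)} (h : ρ ∈ G.polytope i) : ∑ x, |ρ x| = 1 := by
  simp_rw [abs_of_nonneg (h.1 _)]
  exact sum_eq_one_of_mem_polytope h

theorem le_one_of_mem_polytope {G : StochGame n S A} {i : Fin n}
    {ρ : EuclideanSpace ℝ (S i × A i)} (h : ρ ∈ G.polytope i) (x : S i × A i) : ρ x ≤ 1 := by
  rw [← sum_eq_one_of_mem_polytope h]
  exact Finset.single_le_sum (f := fun x => ρ x) (fun y _ => h.1 y) (Finset.mem_univ x)

theorem grad_mem_Icc (G : StochGame n S A) {ρ : Profile S A} (hρ : ∀ i, ρ i ∈ G.polytope i)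
    (i : Fin n) (x : S i × A i) : G.grad ρ i x ∈ Set.Icc (0 : ℝ) 1 := by
  have h0 : ∀ j y, 0 ≤ (Function.update (fun j => (ρ j : S j × A j → ℝ)) i (Pi.single x 1)) j y := by
    intro j y
    by_cases hj : j = i
    · subst hj
      rw [Function.update_self, Pi.single_apply]
      split_ifs <;> norm_num
    · rw [Function.update_of_ne hj]; exact (hρ j).1 y
  have h1 : ∀ j, ∑ y, (Function.update (fun j => (ρ j : S j × A j → ℝ)) i (Pi.single x 1)) j y
      = 1 := by
    intro j
    by_cases hj : j = i
    · subst hj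
      simp
    · rw [Function.update_of_ne hj]; exact sum_eq_one_of_mem_polytope (hρ j)
  rw [grad_apply_eq_productValue]
  exact ⟨G.productValue_nonneg i h0, G.productValue_le_one i h0 h1⟩

theorem norm_grad_le (G : StochGame n S A) {ρ : Profile S A} (hρ : ∀ i, ρ i ∈ G.polytope i)
    (i : Fin n) : ‖G.grad ρ i‖ ≤ √((Fintype.card (S i) : ℝ) * Fintype.card (A i)) := by
  rw [EuclideanSpace.norm_eq]
  refine Real.sqrt_le_sqrt ?_
  calc ∑ x, ‖G.grad ρ i x‖ ^ 2 ≤ ∑ _x : S i × A i, (1 : ℝ) := by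
        refine Finset.sum_le_sum fun x _ => ?_
        have := G.grad_mem_Icc hρ i x
        rw [Real.norm_of_nonneg this.1]
        exact pow_le_one₀ this.1 this.2
    _ = _ := by simp [Fintype.card_prod]

/-- The Euclidean diameter of the occupation polytope is at most `√2`. -/
theorem norm_sub_sq_le_two {G : StochGame n S A} {i : Fin n} {ρ σ : EuclideanSpace ℝ (S i × A i)}
    (hρ : ρ ∈ G.polytope i) (hσ : σ ∈ G.polytope i) : ‖σ - ρ‖ ^ 2 ≤ 2 := by
  rw [EuclideanSpace.norm_sq_eq]
  calc ∑ x, ‖(σ - ρ) x‖ ^ 2 ≤ ∑ x, (σ x + ρ x) := by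
        refine Finset.sum_le_sum fun x _ => ?_
        have h1 := hρ.1 x; have h2 := hσ.1 x
        have h3 := le_one_of_mem_polytope hρ x; have h4 := le_one_of_mem_polytope hσ x
        simp only [PiLp.sub_apply, Real.norm_eq_abs, sq_abs]
        nlinarith
    _ = 2 := by
        rw [Finset.sum_add_distrib, sum_eq_one_of_mem_polytope hρ, sum_eq_one_of_mem_polytope hσ]
        norm_num

section Occupation

/-! ### Occupation measures and their policies -/

theorem inducedChain_mem_stdSimplex (G : StochGame n S A) {i : Fin n} {π : S i → A i → ℝ}
    (hπ : IsPolicy π) (s : S i) : G.inducedChain i π s ∈ stdSimplex ℝ (S i) := by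
  refine ⟨fun s' => Finset.sum_nonneg fun a _ =>
    mul_nonneg ((G.P_mem i s a).1 s') ((hπ s).1 a), ?_⟩
  simp only [inducedChain, Matrix.of_apply]
  rw [Finset.sum_comm]
  simp_rw [← Finset.sum_mul, (G.P_mem i s _).2, one_mul]
  exact (hπ s).2

variable {G : StochGame n S A} {i : Fin n} {δ : ℝ} {ρ : EuclideanSpace ℝ (S i × A i)}

theorem nonempty_of_mem_polytope (h : ρ ∈ G.polytope i) : Nonempty (S i) ∧ Nonempty (A i) := by
  by_contra hne
  have h1 := sum_eq_one_of_mem_polytope h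
  have : IsEmpty (S i × A i) := by
    rw [← not_nonempty_iff, nonempty_prod]; exact hne
  simp at h1

theorem marginal_pos (hδ : 0 < δ) (h : ρ ∈ G.shrunk i δ) (s : S i) : 0 < ∑ a, ρ (s, a) := by
  have := (nonempty_of_mem_polytope h.1).2
  exact Finset.sum_pos (fun a _ => hδ.trans_le (h.2 _)) Finset.univ_nonempty

theorem isPolicy_policyOf (hδ : 0 < δ) (h : ρ ∈ G.shrunk i δ) : IsPolicy (policyOf ρ) := by
  intro s
  refine ⟨fun a => div_nonneg (h.1.1 _) (marginal_pos hδ h s).le, ?_⟩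
  simp only [policyOf]
  rw [← Finset.sum_div, div_self (marginal_pos hδ h s).ne']

theorem marginal_mul_policyOf (hδ : 0 < δ) (h : ρ ∈ G.shrunk i δ) (s : S i) (a : A i) :
    (∑ a, ρ (s, a)) * policyOf ρ s a = ρ (s, a) :=
  mul_div_cancel₀ _ (marginal_pos hδ h s).ne'

theorem le_policyOf (hδ : 0 < δ) (h : ρ ∈ G.shrunk i δ) (s : S i) (a : A i) :
    δ ≤ policyOf ρ s a := by
  rw [policyOf, le_div_iff₀ (marginal_pos hδ h s)]
  have h1 : ∑ a, ρ (s, a) ≤ 1 := by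
    rw [← sum_eq_one_of_mem_polytope h.1, Fintype.sum_prod_type]
    exact Finset.single_le_sum (f := fun s => ∑ a, ρ (s, a))
      (fun s _ => Finset.sum_nonneg fun a _ => h.1.1 _) (Finset.mem_univ s)
  nlinarith [h.2 (s, a), marginal_pos hδ h s]

theorem marginal_mem_stdSimplex (h : ρ ∈ G.polytope i) :
    (fun s => ∑ a, ρ (s, a)) ∈ stdSimplex ℝ (S i) :=
  ⟨fun _ => Finset.sum_nonneg fun _ _ => h.1 _, h.2.2⟩

/-- The state marginal of an occupation measure is stationary for its policy. -/
theorem vecMul_marginal (hδ : 0 < δ) (h : ρ ∈ G.shrunk i δ) :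
    Matrix.vecMul (fun s => ∑ a, ρ (s, a)) (G.inducedChain i (policyOf ρ))
      = fun s => ∑ a, ρ (s, a) := by
  ext s'
  have h1 := h.1.2.1 s'
  simp only [sub_mul, Finset.sum_sub_distrib, ite_mul, one_mul, zero_mul] at h1
  have h2 : ∑ s, ∑ a, (if s = s' then ρ (s, a) else 0) = ∑ a, ρ (s', a) := by
    rw [Finset.sum_comm]
    exact Finset.sum_congr rfl fun a _ => by simp
  rw [h2, sub_eq_zero] at h1
  rw [← h1]
  simp only [Matrix.vecMul, dotProduct, inducedChain, Matrix.of_apply]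
  refine Finset.sum_congr rfl fun s _ => ?_
  rw [Finset.mul_sum]
  refine Finset.sum_congr rfl fun a _ => ?_
  rw [← marginal_mul_policyOf hδ h s a]
  ring

/-- Convergence of the chain of a policy to its stationary law, at the mixing rate. -/
theorem sum_abs_law_sub_marginal_le {τ : ℝ} (hG : G.UniformlyErgodic τ) (hδ : 0 < δ)
    (h : ρ ∈ G.shrunk i δ) {ν : S i → ℝ} (hν : ν ∈ stdSimplex ℝ (S i)) (d u : ℕ) :
    ∑ s, |tabooLaw (G.inducedChain i (policyOf ρ)) ∅ d ν u s - ∑ a, ρ (s, a)|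
      ≤ 2 * Real.exp (-1 / τ) ^ u := by
  have hπ := isPolicy_policyOf hδ h
  have hQ := G.inducedChain_mem_stdSimplex hπ
  have hm := marginal_mem_stdSimplex h.1
  induction u with
  | zero =>
    rw [pow_zero, mul_one]
    calc _ ≤ ∑ s, (ν s + ∑ a, ρ (s, a)) := by
          refine Finset.sum_le_sum fun s _ => ?_
          rw [abs_le]
          have h1 := hν.1 s; have h2 := hm.1 s
          simp only [tabooLaw] at h1 h2 ⊢
          constructor <;> linarith
      _ = 2 := by rw [Finset.sum_add_distrib, hν.2, hm.2]; norm_num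
  | succ u ih =>
    have hstep := (hG i _ hπ).2 _ (tabooLaw_empty_mem_stdSimplex (d := d) hQ hν u) _ hm
    rw [Matrix.sub_vecMul, vecMul_marginal hδ h] at hstep
    have heq : tabooLaw (G.inducedChain i (policyOf ρ)) ∅ d ν (u + 1) =
        Matrix.vecMul (tabooLaw (G.inducedChain i (policyOf ρ)) ∅ d ν u)
          (G.inducedChain i (policyOf ρ)) := by
      rw [tabooLaw]; simp
    rw [heq]
    calc _ ≤ _ := hstep
      _ ≤ Real.exp (-1 / τ) * (2 * Real.exp (-1 / τ) ^ u) :=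
          mul_le_mul_of_nonneg_left ih (Real.exp_pos _).le
      _ = _ := by ring

theorem sum_abs_law_mul_policyOf_sub_le {τ : ℝ} (hτ : 0 < τ) (hG : G.UniformlyErgodic τ)
    (hδ : 0 < δ) (h : ρ ∈ G.shrunk i δ) {ν : S i → ℝ} (hν : ν ∈ stdSimplex ℝ (S i)) {d u : ℕ}
    (hu : d ≤ u) :
    ∑ x : S i × A i, |tabooLaw (G.inducedChain i (policyOf ρ)) ∅ d ν u x.1 * policyOf ρ x.1 x.2
        - ρ x| ≤ 2 * Real.exp (-1 / τ) ^ d := by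
  have hπ := isPolicy_policyOf hδ h
  calc _ = ∑ s, |tabooLaw (G.inducedChain i (policyOf ρ)) ∅ d ν u s - ∑ a, ρ (s, a)| := by
        rw [Fintype.sum_prod_type]
        refine Finset.sum_congr rfl fun s _ => ?_
        have h1 : ∀ a, |tabooLaw (G.inducedChain i (policyOf ρ)) ∅ d ν u s * policyOf ρ s a
            - ρ (s, a)| = |tabooLaw (G.inducedChain i (policyOf ρ)) ∅ d ν u s - ∑ a, ρ (s, a)|
              * policyOf ρ s a := by
          intro a
          rw [← marginal_mul_policyOf hδ h s a, ← sub_mul, abs_mul, abs_of_nonneg ((hπ s).1 a)]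
        simp_rw [h1]
        rw [← Finset.mul_sum, (hπ s).2, mul_one]
    _ ≤ 2 * Real.exp (-1 / τ) ^ u := sum_abs_law_sub_marginal_le hG hδ h hν d u
    _ ≤ _ := by
        have h1 : Real.exp (-1 / τ) ≤ 1 := by
          rw [Real.exp_le_one_iff]
          exact div_nonpos_of_nonpos_of_nonneg (by norm_num) hτ.le
        have := pow_le_pow_of_le_one (Real.exp_pos _).le h1 hu
        linarith

end Occupation

section Trajectory

/-! ### Batches along a trajectory -/

variable (G : StochGame n S A) (I : AlgInput S A)

theorem memory_congr {x y : ℕ → (∀ i, S i) × (∀ i, A i)} {t : ℕ} (h : ∀ u < t, x u = y u) :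
    G.memory I x t = G.memory I y t := by
  induction t with
  | zero => rfl
  | succ t ih => rw [memory, memory, ih fun u hu => h u (by omega), h t (by omega)]

/-- Batch `k` begins at time `t`. -/
def StartsBatch (k t : ℕ) (x : ℕ → (∀ i, S i) × (∀ i, A i)) : Prop :=
  (G.memory I x t).batch = k ∧ (G.memory I x t).elapsed = 0

variable {G I} {x y : ℕ → (∀ i, S i) × (∀ i, A i)} {k t t' u : ℕ}

theorem StartsBatch.congr (h : G.StartsBatch I k t x) (hxy : ∀ u < t, x u = y u) :
    G.StartsBatch I k t y := by
  rw [StartsBatch, ← memory_congr G I hxy]; exact h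

theorem startsBatch_zero : G.StartsBatch I 0 0 x := ⟨rfl, rfl⟩

/-- A time step either stays in the batch or begins the next one. -/
theorem memory_succ_cases (G : StochGame n S A) (I : AlgInput S A)
    (x : ℕ → (∀ i, S i) × (∀ i, A i)) (t : ℕ) :
    ((∀ i, nextUnvisited I (G.memory I x t) (x t) i = ∅) ∧
        G.StartsBatch I ((G.memory I x t).batch + 1) (t + 1) x) ∨
      ((¬ ∀ i, nextUnvisited I (G.memory I x t) (x t) i = ∅) ∧
        (G.memory I x (t + 1)).batch = (G.memory I x t).batch ∧
        (G.memory I x (t + 1)).elapsed = (G.memory I x t).elapsed + 1) := by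
  by_cases h : ∀ i, nextUnvisited I (G.memory I x t) (x t) i = ∅
  · exact Or.inl ⟨h, by simp [memory, step, h], by simp [memory, step, h]⟩
  · exact Or.inr ⟨h, by simp [memory, step, h], by simp [memory, step, h]⟩

theorem batch_succ (G : StochGame n S A) (I : AlgInput S A) (x : ℕ → (∀ i, S i) × (∀ i, A i))
    (t : ℕ) :
    (G.memory I x (t + 1)).batch = (G.memory I x t).batch ∨
      (G.memory I x (t + 1)).batch = (G.memory I x t).batch + 1 := by
  rcases memory_succ_cases G I x t with h | h
  exacts [Or.inr h.2.1, Or.inl h.2.1]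

theorem batch_monotone (G : StochGame n S A) (I : AlgInput S A)
    (x : ℕ → (∀ i, S i) × (∀ i, A i)) : Monotone fun t => (G.memory I x t).batch :=
  monotone_nat_of_le_succ fun t => by rcases batch_succ G I x t with h | h <;> omega

theorem StartsBatch.batch_pred (h : G.StartsBatch I k (t + 1) x) :
    (G.memory I x t).batch + 1 = k ∧ ∀ i, nextUnvisited I (G.memory I x t) (x t) i = ∅ := by
  rcases memory_succ_cases G I x t with h1 | h1
  · exact ⟨h1.2.1.symm.trans h.1, h1.1⟩
  · have := h.2
    omega

theorem StartsBatch.batch_lt (h : G.StartsBatch I k t x) (hu : u < t) :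
    (G.memory I x u).batch < k := by
  obtain ⟨t, rfl⟩ : ∃ r, t = r + 1 := ⟨t - 1, by omega⟩
  have h1 := h.batch_pred.1
  have h2 : (G.memory I x u).batch ≤ (G.memory I x t).batch :=
    batch_monotone G I x (by omega : u ≤ t)
  omega

theorem StartsBatch.unique (h : G.StartsBatch I k t x) (h' : G.StartsBatch I k t' x) : t = t' := by
  rcases lt_trichotomy t t' with hlt | heq | hlt
  · exact absurd h.1 (h'.batch_lt hlt).ne
  · exact heq
  · exact absurd h'.1 (h.batch_lt hlt).ne

variable (G I) in
/-- The first time of batch `k`; it is `0` if there is no such time. -/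
noncomputable def batchStart (x : ℕ → (∀ i, S i) × (∀ i, A i)) (k : ℕ) : ℕ :=
  sInf {t | (G.memory I x t).batch = k}

theorem StartsBatch.batchStart_eq (h : G.StartsBatch I k t x) : G.batchStart I x k = t := by
  refine le_antisymm (Nat.sInf_le h.1) ?_
  by_contra hlt
  push Not at hlt
  have h1 : (G.memory I x (G.batchStart I x k)).batch = k :=
    Nat.sInf_mem (s := {t | (G.memory I x t).batch = k}) ⟨t, h.1⟩
  exact absurd h1 (h.batch_lt hlt).ne

/-- Unless the batch goes on forever, the next one begins. -/
theorem StartsBatch.batch_eq_or_exists_succ (h : G.StartsBatch I k t x) (u : ℕ) :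
    (G.memory I x (t + u)).batch = k ∨ ∃ v, v < u ∧ G.StartsBatch I (k + 1) (t + v + 1) x := by
  induction u with
  | zero => exact Or.inl h.1
  | succ u ih =>
    rcases ih with ih | ⟨v, hv, hs⟩
    · rcases memory_succ_cases G I x (t + u) with h1 | h1
      · rw [ih] at h1
        exact Or.inr ⟨u, by omega, h1.2⟩
      · exact Or.inl (h1.2.1.trans ih)
    · exact Or.inr ⟨v, by omega, hs⟩

/-- The beginning of a batch is preceded by the beginning of the previous one. -/
theorem StartsBatch.exists_pred (h : G.StartsBatch I (k + 1) t' x) :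
    ∃ t u, G.StartsBatch I k t x ∧ t' = t + u + 1 := by
  have key : ∀ m, ∃ t ≤ m, G.StartsBatch I (G.memory I x m).batch t x := by
    intro m
    induction m with
    | zero => exact ⟨0, le_rfl, startsBatch_zero⟩
    | succ m ih =>
      rcases memory_succ_cases G I x m with h1 | h1
      · exact ⟨m + 1, le_rfl, by rw [h1.2.1]; exact h1.2⟩
      · obtain ⟨t, ht, hs⟩ := ih
        exact ⟨t, by omega, by rw [h1.2.1]; exact hs⟩
  have ht' : t' ≠ 0 := by
    rintro rfl
    exact absurd h.1 (by simp [memory, initMemory])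
  obtain ⟨m, rfl⟩ : ∃ m, t' = m + 1 := ⟨t' - 1, by omega⟩
  obtain ⟨t, ht, hs⟩ := key m
  have := h.batch_pred.1
  have hk : (G.memory I x m).batch = k := by omega
  rw [hk] at hs
  exact ⟨t, m - t, hs, by omega⟩

theorem elapsed_eq_zero_imp (G : StochGame n S A) (I : AlgInput S A)
    (x : ℕ → (∀ i, S i) × (∀ i, A i)) (t : ℕ) (h : (G.memory I x t).elapsed = 0) :
    (G.memory I x t).R = 0 ∧ (G.memory I x t).unvisited = fun _ => Finset.univ := by
  cases t with
  | zero => exact ⟨rfl, rfl⟩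
  | succ t =>
    rcases memory_succ_cases G I x t with h1 | h1
    · simp [memory, step, h1.1]
    · omega

/-- The contribution of the `v`-th step of the batch begun at time `t` to the entry `(s, a)` of the
estimator of player `i`: it is nonzero only at the first visit to `s` from step `d` on. -/
noncomputable def visitTerm (G : StochGame n S A) (d : ℕ) (ρ : Profile S A) (i : Fin n) (s : S i)
    (a : A i) (x : ℕ → (∀ i, S i) × (∀ i, A i)) (t v : ℕ) : ℝ :=
  open Classical in
  if d ≤ v ∧ (∀ w < v, d ≤ w → (x (t + w)).1 i ≠ s) ∧ (x (t + v)).1 i = s ∧ (x (t + v)).2 i = a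
  then G.r i (x (t + v)).1 (x (t + v)).2 / policyOf (ρ i) s a else 0

theorem sampleR_apply {m : Memory S A} {ρ : Profile S A} (h1 : m.elapsed = u) (h2 : m.ρ = ρ)
    (h3 : ∀ i s, s ∈ m.unvisited i ↔ ∀ v < u, I.d ≤ v → (x (t + v)).1 i ≠ s) (i : Fin n) (s : S i)
    (a : A i) :
    G.sampleR I m (x (t + u)) i (s, a) = m.R i (s, a) + visitTerm G I.d ρ i s a x t u := by
  rw [sampleR, h1, h2]
  unfold visitTerm
  by_cases hc : I.d ≤ u ∧ (x (t + u)).1 i ∈ m.unvisited i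
  · rw [if_pos hc]
    by_cases hs : (x (t + u)).1 i = s ∧ (x (t + u)).2 i = a
    · obtain ⟨rfl, rfl⟩ := hs
      rw [if_pos ⟨hc.1, (h3 _ _).1 hc.2, rfl, rfl⟩]
      simp
    · rw [if_neg (fun hh => hs hh.2.2)]
      have : ((s, a) : S i × A i) ≠ ((x (t + u)).1 i, (x (t + u)).2 i) := by
        intro hh
        rw [Prod.mk.injEq] at hh
        exact hs ⟨hh.1.symm, hh.2.symm⟩
      simp [this]
  · rw [if_neg hc, if_neg, add_zero]
    rintro ⟨ha, hb, rfl, -⟩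
    exact hc ⟨ha, (h3 _ _).2 hb⟩

theorem mem_nextUnvisited_iff {m : Memory S A} (h1 : m.elapsed = u)
    (h3 : ∀ i s, s ∈ m.unvisited i ↔ ∀ v < u, I.d ≤ v → (x (t + v)).1 i ≠ s) (i : Fin n) (s : S i) :
    s ∈ nextUnvisited I m (x (t + u)) i ↔ ∀ v < u + 1, I.d ≤ v → (x (t + v)).1 i ≠ s := by
  have hsplit : (∀ v < u + 1, I.d ≤ v → (x (t + v)).1 i ≠ s) ↔
      (∀ v < u, I.d ≤ v → (x (t + v)).1 i ≠ s) ∧ (I.d ≤ u → (x (t + u)).1 i ≠ s) := by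
    constructor
    · intro hh
      exact ⟨fun v hv => hh v (by omega), hh u (by omega)⟩
    · rintro ⟨ha, hb⟩ v hv
      rcases Nat.lt_succ_iff_lt_or_eq.1 hv with hv | rfl
      exacts [ha v hv, hb]
  rw [hsplit, ← h3]
  simp only [nextUnvisited, h1]
  split_ifs with hd
  · simp only [Finset.mem_erase, hd, true_imp_iff]
    rw [and_comm, ne_comm]
  · simp [hd]

/-- The memory after `u` steps of a batch, as long as the batch lasts. -/
theorem StartsBatch.memory_add (h : G.StartsBatch I k t x) (u : ℕ)
    (hu : (G.memory I x (t + u)).batch = k) :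
    (G.memory I x (t + u)).elapsed = u ∧
    (G.memory I x (t + u)).ρ = (G.memory I x t).ρ ∧
    (G.memory I x (t + u)).Y = (G.memory I x t).Y ∧
    (∀ i s, s ∈ (G.memory I x (t + u)).unvisited i ↔
      ∀ v < u, I.d ≤ v → (x (t + v)).1 i ≠ s) ∧
    (∀ i s a, (G.memory I x (t + u)).R i (s, a) =
      ∑ v ∈ Finset.range u, visitTerm G I.d (G.memory I x t).ρ i s a x t v) := by
  induction u with
  | zero =>
    obtain ⟨hR, hU⟩ := elapsed_eq_zero_imp G I x t h.2
    refine ⟨h.2, rfl, rfl, fun i s => ?_, fun i s a => ?_⟩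
    · simp [hU]
    · simp [hR]
  | succ u ih =>
    have hbu : (G.memory I x (t + u)).batch = k := by
      have h1 : (G.memory I x t).batch ≤ (G.memory I x (t + u)).batch :=
        batch_monotone G I x (by omega : t ≤ t + u)
      have h2 : (G.memory I x (t + u)).batch ≤ (G.memory I x (t + (u + 1))).batch :=
        batch_monotone G I x (by omega : t + u ≤ t + (u + 1))
      have := h.1
      omega
    obtain ⟨h1, h2, h3, h4, h5⟩ := ih hbu
    have hne : ¬ ∀ i, nextUnvisited I (G.memory I x (t + u)) (x (t + u)) i = ∅ := by
      rcases memory_succ_cases G I x (t + u) with hc | hc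
      · have := hc.2.1
        rw [hbu] at this
        rw [← add_assoc] at hu
        omega
      · exact hc.1
    have hmem : G.memory I x (t + (u + 1)) =
        { G.memory I x (t + u) with
          elapsed := (G.memory I x (t + u)).elapsed + 1
          R := G.sampleR I (G.memory I x (t + u)) (x (t + u))
          unvisited := nextUnvisited I (G.memory I x (t + u)) (x (t + u)) } := by
      rw [← add_assoc, memory, step, if_neg hne]
    rw [hmem]
    refine ⟨by simp [h1], h2, h3, mem_nextUnvisited_iff h1 h4, fun i s a => ?_⟩
    rw [Finset.sum_range_succ, ← h5]
    exact sampleR_apply h1 h2 h4 i s a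

/-- The batch lasts as long as some player misses some state. -/
theorem StartsBatch.batch_add_of_avoid (h : G.StartsBatch I k t x) {i : Fin n} {s : S i} (u : ℕ)
    (hs : ∀ v < u, I.d ≤ v → (x (t + v)).1 i ≠ s) : (G.memory I x (t + u)).batch = k := by
  induction u with
  | zero => exact h.1
  | succ u ih =>
    have hbu := ih fun v hv => hs v (by omega)
    obtain ⟨h1, -, -, h4, -⟩ := h.memory_add u hbu
    rcases memory_succ_cases G I x (t + u) with hc | hc
    · have := (mem_nextUnvisited_iff h1 h4 i s).2 hs
      rw [hc.1 i] at this
      simp at this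
    · exact hc.2.1.trans hbu

theorem StartsBatch.exists_succ_of_visits (h : G.StartsBatch I k t x)
    (hvis : ∀ i (s : S i), ∃ v, I.d ≤ v ∧ (x (t + v)).1 i = s) :
    ∃ t', G.StartsBatch I (k + 1) t' x := by
  by_contra hno
  have hb : ∀ u, (G.memory I x (t + u)).batch = k := fun u =>
    (h.batch_eq_or_exists_succ u).resolve_right fun ⟨v, _, hv⟩ => hno ⟨_, hv⟩
  choose f hf using hvis
  let U := ∑ i, ∑ s, f i s
  have hU : ∀ i s, f i s ≤ U := fun i s =>
    (Finset.single_le_sum (f := fun s => f i s) (fun _ _ => Nat.zero_le _) (Finset.mem_univ s)).trans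
      (Finset.single_le_sum (f := fun i => ∑ s, f i s) (fun _ _ => Nat.zero_le _)
        (Finset.mem_univ i))
  obtain ⟨h1, -, -, h4, -⟩ := h.memory_add U (hb U)
  have hempty : ∀ i, nextUnvisited I (G.memory I x (t + U)) (x (t + U)) i = ∅ := by
    intro i
    refine Finset.eq_empty_of_forall_notMem fun s hs => ?_
    rw [mem_nextUnvisited_iff h1 h4] at hs
    exact hs (f i s) (Nat.lt_succ_of_le (hU i s)) (hf i s).1 (hf i s).2
  rcases memory_succ_cases G I x (t + U) with hc | hc
  · rw [hb U] at hc
    exact hno ⟨_, hc.2⟩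
  · exact hc.1 hempty

variable (G I) in
/-- The gradient estimator `R^k` at the end of batch `k`. -/
noncomputable def estimator (x : ℕ → (∀ i, S i) × (∀ i, A i)) (k : ℕ) : Profile S A :=
  G.sampleR I (G.memory I x (G.batchStart I x (k + 1) - 1)) (x (G.batchStart I x (k + 1) - 1))

variable (G I) in
/-- The dual score `Y^k` in use during batch `k`. -/
noncomputable def score (x : ℕ → (∀ i, S i) × (∀ i, A i)) (k : ℕ) : Profile S A :=
  (G.memory I x (G.batchStart I x k)).Y

theorem StartsBatch.iter_eq (h : G.StartsBatch I k t x) : G.iter I x k = (G.memory I x t).ρ := by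
  rw [iter]
  exact congrArg (fun t => (G.memory I x t).ρ) h.batchStart_eq

theorem StartsBatch.score_eq (h : G.StartsBatch I k t x) : G.score I x k = (G.memory I x t).Y := by
  rw [score, h.batchStart_eq]

theorem score_zero : G.score I x 0 = 0 := by
  rw [startsBatch_zero.score_eq]; rfl

theorem StartsBatch.score_succ (h : G.StartsBatch I (k + 1) t' x) (i : Fin n) :
    G.score I x (k + 1) i = G.score I x k i + (if k = 0 then 0 else I.η k) • G.estimator I x k i ∧
    G.iter I x (k + 1) i = G.argmax i (I.δ i) (I.h i) (G.score I x (k + 1) i) := by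
  obtain ⟨t, u, hs, rfl⟩ := h.exists_pred
  have hb : (G.memory I x (t + u)).batch = k := by have := h.batch_pred.1; omega
  obtain ⟨-, -, hY, -, -⟩ := hs.memory_add u hb
  rw [h.score_eq, h.iter_eq, hs.score_eq, estimator, h.batchStart_eq, memory, step,
    if_pos h.batch_pred.2, Nat.add_sub_cancel, ← hY]
  simp [nextY, hb]

/-- The entries of the estimator collect the contributions of all steps of the batch; the steps
after the end of the batch contribute nothing, as all states have then been visited. -/
theorem StartsBatch.hasSum_visitTerm (h : G.StartsBatch I k t x) (h' : G.StartsBatch I (k + 1) t' x)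
    (i : Fin n) (s : S i) (a : A i) :
    HasSum (visitTerm G I.d (G.memory I x t).ρ i s a x t) (G.estimator I x k i (s, a)) := by
  obtain ⟨t₁, u, hs, rfl⟩ := h'.exists_pred
  obtain rfl := hs.unique h
  have hb : (G.memory I x (t₁ + u)).batch = k := by have := h'.batch_pred.1; omega
  obtain ⟨h1, h2, -, h4, h5⟩ := h.memory_add u hb
  have heq : G.estimator I x k i (s, a)
      = ∑ v ∈ Finset.range (u + 1), visitTerm G I.d (G.memory I x t₁).ρ i s a x t₁ v := by
    rw [estimator, h'.batchStart_eq, Nat.add_sub_cancel, Finset.sum_range_succ, ← h5]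
    exact sampleR_apply h1 h2 h4 i s a
  rw [heq]
  refine hasSum_sum_of_ne_finset_zero fun v hv => ?_
  unfold visitTerm
  refine if_neg ?_
  rintro ⟨-, hav, -, -⟩
  have hmem : s ∈ nextUnvisited I (G.memory I x (t₁ + u)) (x (t₁ + u)) i := by
    rw [mem_nextUnvisited_iff h1 h4]
    exact fun w hw => hav w (by simp at hv; omega)
  rw [h'.batch_pred.2 i] at hmem
  simp at hmem

/-! ### Feasibility of the iterates and boundedness of the estimators -/

theorem isCompact_shrunk (G : StochGame n S A) (i : Fin n) (δ : ℝ) :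
    IsCompact (G.shrunk i δ) := by
  refine Metric.isCompact_of_isClosed_isBounded ?_ ?_
  · have : G.shrunk i δ = (⋂ x, {ρ | 0 ≤ ρ x}) ∩
        (⋂ s', {ρ | ∑ s, ∑ a, (G.P i s a s' - if s = s' then 1 else 0) * ρ (s, a) = 0}) ∩
        {ρ | ∑ s, ∑ a, ρ (s, a) = 1} ∩ ⋂ x, {ρ | δ ≤ ρ x} := by
      ext ρ
      simp [shrunk, polytope, and_assoc]
    rw [this]
    refine ((IsClosed.inter (isClosed_iInter fun x => ?_) (isClosed_iInter fun s' => ?_)).inter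
      ?_).inter (isClosed_iInter fun x => ?_)
    · exact isClosed_le continuous_const (by fun_prop)
    · exact isClosed_eq (by fun_prop) continuous_const
    · exact isClosed_eq (by fun_prop) continuous_const
    · exact isClosed_le continuous_const (by fun_prop)
  · rw [Metric.isBounded_iff_subset_closedBall 0]
    refine ⟨√(Fintype.card (S i × A i)), fun ρ hρ => ?_⟩
    rw [mem_closedBall_zero_iff, EuclideanSpace.norm_eq]
    refine Real.sqrt_le_sqrt ?_
    calc ∑ x, ‖ρ x‖ ^ 2 ≤ ∑ _x : S i × A i, (1 : ℝ) := by
          refine Finset.sum_le_sum fun x _ => ?_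
          rw [Real.norm_of_nonneg (hρ.1.1 x)]
          exact pow_le_one₀ (hρ.1.1 x) (le_one_of_mem_polytope hρ.1 x)
      _ = _ := by simp

theorem argmax_spec {i : Fin n} {δ : ℝ} {h : EuclideanSpace ℝ (S i × A i) → ℝ}
    (hne : (G.shrunk i δ).Nonempty) (hcont : ContinuousOn h (G.shrunk i δ))
    (Y : EuclideanSpace ℝ (S i × A i)) :
    G.argmax i δ h Y ∈ G.shrunk i δ ∧
      IsMaxOn (fun ρ' => inner ℝ ρ' Y - h ρ') (G.shrunk i δ) (G.argmax i δ h Y) :=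
  Classical.epsilon_spec (p := fun ρ => ρ ∈ G.shrunk i δ ∧
    IsMaxOn (fun ρ' => inner ℝ ρ' Y - h ρ') (G.shrunk i δ) ρ)
    (exists_isMaxOn_inner_sub (G.isCompact_shrunk i δ) hne hcont Y)

/-- The iterates are feasible, and the entries of the estimators under construction lie in
`[0, 1 / δ i]`, those of the states that remain to be sampled being zero. -/
theorem memory_invariant (hδ : ∀ i, 0 < I.δ i) (hρ0 : ∀ i, I.ρ0 i ∈ G.shrunk i (I.δ i))
    (hh_cont : ∀ i, ContinuousOn (I.h i) (G.shrunk i (I.δ i)))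
    (x : ℕ → (∀ i, S i) × (∀ i, A i)) (t : ℕ) :
    (∀ i, (G.memory I x t).ρ i ∈ G.shrunk i (I.δ i)) ∧
    (∀ i z, (G.memory I x t).R i z ∈ Set.Icc 0 (I.δ i)⁻¹ ∧
      (z.1 ∈ (G.memory I x t).unvisited i → (G.memory I x t).R i z = 0)) ∧
    ∀ i z, G.sampleR I (G.memory I x t) (x t) i z ∈ Set.Icc 0 (I.δ i)⁻¹ ∧
      (z.1 ∈ nextUnvisited I (G.memory I x t) (x t) i →
        G.sampleR I (G.memory I x t) (x t) i z = 0) := by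
  have hstep : ∀ (m : Memory S A) (y : (∀ i, S i) × (∀ i, A i)),
      (∀ i, m.ρ i ∈ G.shrunk i (I.δ i)) →
      (∀ i z, m.R i z ∈ Set.Icc 0 (I.δ i)⁻¹ ∧ (z.1 ∈ m.unvisited i → m.R i z = 0)) →
      ∀ i z, G.sampleR I m y i z ∈ Set.Icc 0 (I.δ i)⁻¹ ∧
        (z.1 ∈ nextUnvisited I m y i → G.sampleR I m y i z = 0) := by
    intro m y hρ hR i z
    simp only [sampleR, nextUnvisited]
    by_cases hd : I.d ≤ m.elapsed
    · simp only [hd, true_and, if_true]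
      by_cases hy : y.1 i ∈ m.unvisited i
      · rw [if_pos hy]
        by_cases hz : z = (y.1 i, y.2 i)
        · subst hz
          rw [PiLp.add_apply, (hR i (y.1 i, y.2 i)).2 hy]
          have h1 := G.r_mem i y.1 y.2
          have h2 := le_policyOf (hδ i) (hρ i) (y.1 i) (y.2 i)
          have h3 : 0 < policyOf (m.ρ i) (y.1 i) (y.2 i) := (hδ i).trans_le h2
          refine ⟨?_, by simp⟩
          simp only [PiLp.single_apply, if_true, zero_add]
          refine ⟨div_nonneg h1.1 h3.le, ?_⟩
          rw [inv_eq_one_div]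
          exact div_le_div₀ zero_le_one h1.2 (hδ i) h2
        · have : (m.R i + EuclideanSpace.single (y.1 i, y.2 i)
              (G.r i y.1 y.2 / policyOf (m.ρ i) (y.1 i) (y.2 i))) z = m.R i z := by
            simp [hz]
          rw [this]
          exact ⟨(hR i z).1, fun h => (hR i z).2 (Finset.mem_of_mem_erase h)⟩
      · rw [if_neg hy]
        exact ⟨(hR i z).1, fun h => (hR i z).2 (Finset.mem_of_mem_erase h)⟩
    · simp only [hd, false_and, if_false]
      exact hR i z
  induction t with
  | zero =>
    have h0 : ∀ i z, (initMemory I).R i z ∈ Set.Icc 0 (I.δ i)⁻¹ ∧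
        (z.1 ∈ (initMemory I).unvisited i → (initMemory I).R i z = 0) := by
      intro i z
      simp [initMemory, (hδ i).le]
    exact ⟨hρ0, h0, hstep _ _ hρ0 h0⟩
  | succ t ih =>
    obtain ⟨h1, h2, h3⟩ := ih
    have hA : ∀ i, (G.memory I x (t + 1)).ρ i ∈ G.shrunk i (I.δ i) := by
      intro i
      rw [memory, step]
      split_ifs
      · exact (argmax_spec ⟨_, hρ0 i⟩ (hh_cont i) _).1
      · exact h1 i
    have hB : ∀ i z, (G.memory I x (t + 1)).R i z ∈ Set.Icc 0 (I.δ i)⁻¹ ∧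
        (z.1 ∈ (G.memory I x (t + 1)).unvisited i → (G.memory I x (t + 1)).R i z = 0) := by
      intro i z
      rw [memory, step]
      split_ifs
      · simp [(hδ i).le]
      · exact h3 i z
    exact ⟨hA, hB, hstep _ _ hA hB⟩

theorem iter_mem_shrunk (hδ : ∀ i, 0 < I.δ i) (hρ0 : ∀ i, I.ρ0 i ∈ G.shrunk i (I.δ i))
    (hh_cont : ∀ i, ContinuousOn (I.h i) (G.shrunk i (I.δ i)))
    (x : ℕ → (∀ i, S i) × (∀ i, A i)) (k : ℕ) (i : Fin n) :
    G.iter I x k i ∈ G.shrunk i (I.δ i) :=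
  (memory_invariant hδ hρ0 hh_cont x _).1 i

theorem estimator_mem_Icc (hδ : ∀ i, 0 < I.δ i) (hρ0 : ∀ i, I.ρ0 i ∈ G.shrunk i (I.δ i))
    (hh_cont : ∀ i, ContinuousOn (I.h i) (G.shrunk i (I.δ i)))
    (x : ℕ → (∀ i, S i) × (∀ i, A i)) (k : ℕ) (i : Fin n) (z : S i × A i) :
    G.estimator I x k i z ∈ Set.Icc 0 (I.δ i)⁻¹ :=
  ((memory_invariant hδ hρ0 hh_cont x _).2.2 i z).1

end Trajectory

section Run

variable {G : StochGame n S A} {I : AlgInput S A} {s0 : ∀ i, S i}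
  {Ω : Type*} [MeasurableSpace Ω] {μ : Measure Ω} [IsProbabilityMeasure μ]
  {X : ℕ → Ω → (∀ i, S i) × (∀ i, A i)}

/-! ### Cylinder events of a run -/

/-- The event that the run agrees with the trajectory `x` before time `t`. -/
def cylinder (X : ℕ → Ω → (∀ i, S i) × (∀ i, A i)) (t : ℕ)
    (x : ℕ → (∀ i, S i) × (∀ i, A i)) : Set Ω :=
  {ω | ∀ u < t, X u ω = x u}

/-- The event `B` is determined by the run before time `t`. -/
def PrefixDetermined (X : ℕ → Ω → (∀ i, S i) × (∀ i, A i)) (t : ℕ) (B : Set Ω) : Prop :=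
  ∀ ω ω', (∀ u < t, X u ω = X u ω') → ω ∈ B → ω' ∈ B

theorem IsRun.measurable_of_prefix (hX : G.IsRun I s0 μ X) {β : Type*} [MeasurableSpace β] (t : ℕ)
    {f : Ω → β} (hf : ∀ ω ω', (∀ u < t, X u ω = X u ω') → f ω = f ω') : Measurable f := by
  intro V _
  have h : f ⁻¹' V = ⋃ (q : Fin t → (∀ i, S i) × (∀ i, A i))
      (_ : ∃ ω ∈ f ⁻¹' V, ∀ u : Fin t, X u ω = q u), ⋂ u : Fin t, {ω | X u ω = q u} := by
    ext ω
    simp only [Set.mem_iUnion, Set.mem_iInter, Set.mem_ofPred_eq, exists_prop]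
    constructor
    · exact fun hω => ⟨fun u => X u ω, ⟨ω, hω, fun _ => rfl⟩, fun _ => rfl⟩
    · rintro ⟨q, ⟨ω', hω', hq'⟩, hq⟩
      rw [Set.mem_preimage, hf ω ω' fun u hu => (hq ⟨u, hu⟩).trans (hq' ⟨u, hu⟩).symm]
      exact hω'
  rw [h]
  exact MeasurableSet.iUnion fun q => MeasurableSet.iUnion fun _ =>
    MeasurableSet.iInter fun u => hX.measurable u (q u)

theorem IsRun.measurableSet_of_prefixDetermined (hX : G.IsRun I s0 μ X) {t : ℕ} {B : Set Ω}
    (hB : PrefixDetermined X t B) : MeasurableSet B := by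
  have : Measurable fun ω => ω ∈ B := hX.measurable_of_prefix t fun ω ω' h =>
    propext ⟨hB ω ω' h, hB ω' ω fun u hu => (h u hu).symm⟩
  exact measurableSet_setOfPred.2 this

theorem prefixDetermined_cylinder (t : ℕ) (x : ℕ → (∀ i, S i) × (∀ i, A i)) :
    PrefixDetermined X t (cylinder X t x) :=
  fun _ _ h hω u hu => (h u hu).symm.trans (hω u hu)

variable (G s0) in
/-- The law of the state of player `j` at time `t`, given the trajectory `x` before time `t`. -/
noncomputable def entryLaw (x : ℕ → (∀ i, S i) × (∀ i, A i)) : ℕ → ∀ j, S j → ℝ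
  | 0 => fun j => Pi.single (s0 j) 1
  | t + 1 => fun j => G.P j ((x t).1 j) ((x t).2 j)

theorem entryLaw_congr {x y : ℕ → (∀ i, S i) × (∀ i, A i)} {t : ℕ} (h : ∀ u < t, x u = y u) :
    entryLaw G s0 x t = entryLaw G s0 y t := by
  cases t with
  | zero => rfl
  | succ t => rw [entryLaw, entryLaw, h t (by omega)]

theorem entryLaw_mem_stdSimplex (x : ℕ → (∀ i, S i) × (∀ i, A i)) (t : ℕ) (j : Fin n) :
    entryLaw G s0 x t j ∈ stdSimplex ℝ (S j) := by
  cases t with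
  | zero => exact single_mem_stdSimplex ℝ (s0 j)
  | succ t => exact G.P_mem _ _ _

variable (G I s0) in
/-- The probability that the joint state and action at time `t` are `y`, given the trajectory `x`
before time `t`. -/
noncomputable def transProb (x : ℕ → (∀ i, S i) × (∀ i, A i)) (t : ℕ)
    (y : (∀ i, S i) × (∀ i, A i)) : ℝ :=
  ∏ j, entryLaw G s0 x t j (y.1 j) * policyOf ((G.memory I x t).ρ j) (y.1 j) (y.2 j)

theorem transProb_congr {x x' : ℕ → (∀ i, S i) × (∀ i, A i)} {t : ℕ} (h : ∀ u < t, x u = x' u)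
    (y : (∀ i, S i) × (∀ i, A i)) : transProb G I s0 x t y = transProb G I s0 x' t y := by
  rw [transProb, transProb, entryLaw_congr h, memory_congr G I h]

theorem IsRun.measureReal_cylinder_succ (hX : G.IsRun I s0 μ X) (t : ℕ)
    (x : ℕ → (∀ i, S i) × (∀ i, A i)) :
    μ.real (cylinder X (t + 1) x) = μ.real (cylinder X t x) * transProb G I s0 x t (x t) := by
  rw [transProb, Finset.prod_mul_distrib]
  cases t with
  | zero =>
    have h0 : cylinder X 0 x = Set.univ := by ext; simp [cylinder]
    have h1 : cylinder X (0 + 1) x = {ω | X 0 ω = x 0} := by ext; simp [cylinder]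
    rw [h0, h1, hX.init, probReal_univ, one_mul]
    have h2 : ∏ j, entryLaw G s0 x 0 j ((x 0).1 j) = if (x 0).1 = s0 then 1 else 0 := by
      split_ifs with h
      · exact Finset.prod_eq_one fun j _ => by simp [entryLaw, h]
      · obtain ⟨j, hj⟩ := Function.ne_iff.1 h
        exact Finset.prod_eq_zero (Finset.mem_univ j) (by simp [entryLaw, hj])
    rw [h2]
    split_ifs <;> simp [actionProb, memory]
  | succ t =>
    have h1 : ∀ t, cylinder X (t + 1) x = {ω | ∀ u ≤ t, X u ω = x u} := by
      intro t; ext; simp [cylinder]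
    rw [h1, h1, hX.next]
    rfl

/-- The Markov property: if the transition probability to `y` is the constant `c` on an event in
the past of time `t`, then the run moves to `y` with probability `c` given this event. -/
theorem IsRun.measureReal_inter_eq (hX : G.IsRun I s0 μ X) {t : ℕ} {B : Set Ω}
    (hB : PrefixDetermined X t B) {y : (∀ i, S i) × (∀ i, A i)} {c : ℝ}
    (hc : ∀ ω ∈ B, transProb G I s0 (fun u => X u ω) t y = c) :
    μ.real (B ∩ {ω | X t ω = y}) = μ.real B * c := by
  let p : (Fin t → (∀ i, S i) × (∀ i, A i)) → Set Ω := fun q => ⋂ u : Fin t, {ω | X u ω = q u}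
  have hpm : ∀ q, MeasurableSet (p q) := fun q => MeasurableSet.iInter fun u => hX.measurable u _
  have hpart : ∀ D : Set Ω, MeasurableSet D → μ.real D = ∑ q, μ.real (D ∩ p q) := by
    intro D hD
    have hU : D = ⋃ q ∈ (Finset.univ : Finset (Fin t → (∀ i, S i) × (∀ i, A i))), D ∩ p q := by
      ext ω
      simp only [Finset.mem_univ, Set.iUnion_true, Set.mem_iUnion, Set.mem_inter_iff, p,
        Set.mem_iInter, Set.mem_ofPred_eq]
      exact ⟨fun h => ⟨fun u => X u ω, h, fun _ => rfl⟩, fun ⟨_, h, _⟩ => h⟩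
    conv_lhs => rw [hU]
    refine measureReal_biUnion_finset ?_ fun q _ => hD.inter (hpm q)
    intro q _ q' _ hqq'
    refine Set.disjoint_left.2 fun ω hω hω' => hqq' (funext fun u => ?_)
    exact (Set.mem_iInter.1 hω.2 u).symm.trans (Set.mem_iInter.1 hω'.2 u)
  have hBm := hX.measurableSet_of_prefixDetermined hB
  rw [hpart _ (hBm.inter (hX.measurable t y)), hpart B hBm, Finset.sum_mul]
  refine Finset.sum_congr rfl fun q _ => ?_
  rcases (B ∩ p q).eq_empty_or_nonempty with he | ⟨ω₀, hω₀, hq₀⟩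
  · rw [Set.inter_right_comm, he]
    simp
  · let x : ℕ → (∀ i, S i) × (∀ i, A i) := Function.update (fun u => X u ω₀) t y
    have hx : ∀ u < t, X u ω₀ = x u := fun u hu => by simp [x, hu.ne]
    have h1 : B ∩ p q = cylinder X t x := by
      ext ω
      constructor
      · rintro ⟨-, hq⟩ u hu
        rw [← hx u hu]
        exact (Set.mem_iInter.1 hq ⟨u, hu⟩).trans (Set.mem_iInter.1 hq₀ ⟨u, hu⟩).symm
      · intro hω
        refine ⟨hB ω₀ ω (fun u hu => (hx u hu).trans (hω u hu).symm) hω₀, ?_⟩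
        refine Set.mem_iInter.2 fun u => ?_
        exact ((hω u u.2).trans (hx u u.2).symm).trans (Set.mem_iInter.1 hq₀ u)
    have h2 : cylinder X t x ∩ {ω | X t ω = y} = cylinder X (t + 1) x := by
      ext ω
      have hxt : x t = y := by simp [x]
      constructor
      · rintro ⟨h, hy⟩ u hu
        rcases Nat.lt_succ_iff_lt_or_eq.1 hu with hu | rfl
        exacts [h u hu, hxt ▸ hy]
      · exact fun h => ⟨fun u hu => h u (by omega), hxt ▸ h t (by omega)⟩
    rw [Set.inter_right_comm, h1, h2, hX.measureReal_cylinder_succ]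
    congr 1
    rw [← hc ω₀ hω₀, transProb_congr hx, show x t = y by simp [x]]

/-! ### The law of the run within a batch -/

/-- The event that the run follows `x` before time `t` and that, at the steps `d, …, u - 1` after
time `t`, no player `j` is in a state of `F j`. -/
def avoidEvent (X : ℕ → Ω → (∀ i, S i) × (∀ i, A i)) (d t : ℕ)
    (x : ℕ → (∀ i, S i) × (∀ i, A i)) (F : ∀ j, Finset (S j)) (u : ℕ) : Set Ω :=
  {ω | ω ∈ cylinder X t x ∧ ∀ v < u, d ≤ v → ∀ j, (X (t + v) ω).1 j ∉ F j}

theorem prefixDetermined_avoidEvent (d t : ℕ) (x : ℕ → (∀ i, S i) × (∀ i, A i))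
    (F : ∀ j, Finset (S j)) (u : ℕ) : PrefixDetermined X (t + u) (avoidEvent X d t x F u) := by
  rintro ω ω' h ⟨h1, h2⟩
  refine ⟨fun v hv => (h v (by omega)).symm.trans (h1 v hv), fun v hv hd j => ?_⟩
  rw [← h (t + v) (by omega)]
  exact h2 v hv hd j

/-- The probability of a run that starts a batch at time `t` after `x`, avoids `F`, and reaches `y`
at step `u` of the batch, is a product over the players: their chains are independent as long as
their policies stay the same. The batch must not end meanwhile, whence the assumption that some
`F j` is nonempty. -/
theorem IsRun.measureReal_avoidEvent_inter (hX : G.IsRun I s0 μ X)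
    {x : ℕ → (∀ i, S i) × (∀ i, A i)} {k t : ℕ} (hs : G.StartsBatch I k t x)
    (F : ∀ j, Finset (S j)) (hF : ∃ j, (F j).Nonempty) (u : ℕ) (y : (∀ i, S i) × (∀ i, A i)) :
    μ.real (avoidEvent X I.d t x F u ∩ {ω | X (t + u) ω = y}) = μ.real (cylinder X t x) *
      ∏ j, tabooLaw (G.inducedChain j (policyOf ((G.memory I x t).ρ j))) (F j) I.d
        (entryLaw G s0 x t j) u (y.1 j) * policyOf ((G.memory I x t).ρ j) (y.1 j) (y.2 j) := by
  set ρ := (G.memory I x t).ρ with hρ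
  set T : ∀ j, ℕ → S j → ℝ := fun j => tabooLaw (G.inducedChain j (policyOf (ρ j))) (F j) I.d
    (entryLaw G s0 x t j) with hT
  induction u generalizing y with
  | zero =>
    have h0 : avoidEvent X I.d t x F 0 = cylinder X t x := by ext; simp [avoidEvent]
    rw [h0, add_zero]
    refine hX.measureReal_inter_eq (prefixDetermined_cylinder t x) fun ω hω => ?_
    rw [transProb_congr (x' := x) hω]
    rfl
  | succ u ih =>
    have hBm : ∀ z, MeasurableSet (avoidEvent X I.d t x F u ∩ {ω | X (t + u) ω = z}) := fun z =>
      (hX.measurableSet_of_prefixDetermined (prefixDetermined_avoidEvent _ _ _ _ _)).inter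
        (hX.measurable _ _)
    -- split according to the joint state and action at step `u`
    have hsplit : μ.real (avoidEvent X I.d t x F (u + 1) ∩ {ω | X (t + (u + 1)) ω = y}) =
        ∑ z, if I.d ≤ u ∧ ∃ j, z.1 j ∈ F j then 0 else
          μ.real ((avoidEvent X I.d t x F u ∩ {ω | X (t + u) ω = z}) ∩
            {ω | X (t + u + 1) ω = y}) := by
      have hU : avoidEvent X I.d t x F (u + 1) ∩ {ω | X (t + (u + 1)) ω = y} =
          ⋃ z ∈ (Finset.univ : Finset ((∀ i, S i) × (∀ i, A i))),
            if I.d ≤ u ∧ ∃ j, z.1 j ∈ F j then ∅ else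
            ((avoidEvent X I.d t x F u ∩ {ω | X (t + u) ω = z}) ∩ {ω | X (t + u + 1) ω = y}) := by
        ext ω
        simp only [Finset.mem_univ, Set.iUnion_true, Set.mem_iUnion]
        constructor
        · rintro ⟨⟨h1, h2⟩, h3⟩
          refine ⟨X (t + u) ω, ?_⟩
          rw [if_neg]
          · exact ⟨⟨⟨h1, fun v hv => h2 v (by omega)⟩, rfl⟩, h3⟩
          · rintro ⟨hd, j, hj⟩
            exact h2 u (by omega) hd j hj
        · rintro ⟨z, hz⟩
          split_ifs at hz with hc
          · exact hz.elim
          · obtain ⟨⟨⟨h1, h2⟩, rfl⟩, h3⟩ := hz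
            refine ⟨⟨h1, fun v hv hd j hj => ?_⟩, h3⟩
            rcases Nat.lt_succ_iff_lt_or_eq.1 hv with hv | rfl
            · exact h2 v hv hd j hj
            · exact hc ⟨hd, j, hj⟩
      rw [hU, measureReal_biUnion_finset]
      · refine Finset.sum_congr rfl fun z _ => ?_
        split_ifs <;> simp
      · intro z _ z' _ hzz'
        refine Set.disjoint_left.2 fun ω hω hω' => hzz' ?_
        dsimp only at hω hω'
        split_ifs at hω hω'
        · exact hω.elim
        · exact hω.elim
        · exact hω'.elim
        · exact hω.1.2.symm.trans hω'.1.2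
      · intro z _
        split_ifs
        · exact MeasurableSet.empty
        · exact (hBm z).inter (hX.measurable _ _)
    have hterm : ∀ z : (∀ i, S i) × (∀ i, A i),
        (if I.d ≤ u ∧ ∃ j, z.1 j ∈ F j then 0 else
          μ.real ((avoidEvent X I.d t x F u ∩ {ω | X (t + u) ω = z}) ∩
            {ω | X (t + u + 1) ω = y})) =
        μ.real (cylinder X t x) * (∏ j, policyOf (ρ j) (y.1 j) (y.2 j)) *
          ∏ j, (if I.d ≤ u ∧ z.1 j ∈ F j then 0 else T j u (z.1 j)) *
            (policyOf (ρ j) (z.1 j) (z.2 j) * G.P j (z.1 j) (z.2 j) (y.1 j)) := by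
      intro z
      split_ifs with hc
      · obtain ⟨hd, j, hj⟩ := hc
        refine (mul_eq_zero_of_right _ (Finset.prod_eq_zero (Finset.mem_univ j) ?_)).symm
        rw [if_pos ⟨hd, hj⟩, zero_mul]
      · have hpd : PrefixDetermined X (t + u + 1)
            (avoidEvent X I.d t x F u ∩ {ω | X (t + u) ω = z}) := by
          rintro ω ω' h ⟨h1, h2⟩
          exact ⟨prefixDetermined_avoidEvent _ _ _ _ _ ω ω' (fun v hv => h v (by omega)) h1,
            (h (t + u) (by omega)).symm.trans h2⟩
        rw [hX.measureReal_inter_eq hpd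
          (c := ∏ j, G.P j (z.1 j) (z.2 j) (y.1 j) * policyOf (ρ j) (y.1 j) (y.2 j)), ih z]
        · have hif : ∀ j, (if I.d ≤ u ∧ z.1 j ∈ F j then 0 else T j u (z.1 j)) = T j u (z.1 j) :=
            fun j => if_neg fun h => hc ⟨h.1, j, h.2⟩
          simp only [hif, Finset.prod_mul_distrib]
          ring
        · rintro ω ⟨⟨h1, h2⟩, rfl⟩
          have hs' : G.StartsBatch I k t (fun u => X u ω) := hs.congr fun v hv => (h1 v hv).symm
          obtain ⟨j, s, hjs⟩ := hF
          have hb := hs'.batch_add_of_avoid (i := j) (s := s) (u + 1) (by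
            rintro v hv hd rfl
            rcases Nat.lt_succ_iff_lt_or_eq.1 hv with hv | rfl
            · exact h2 v hv hd j hjs
            · exact hc ⟨hd, j, hjs⟩)
          have hρ' : (G.memory I (fun u => X u ω) (t + u + 1)).ρ = ρ := by
            rw [add_assoc, (hs'.memory_add (u + 1) hb).2.1, hρ]
            exact congrArg Memory.ρ (memory_congr G I h1)
          rw [transProb, hρ']
          rfl
    rw [hsplit, Finset.sum_congr rfl fun z _ => hterm z, ← Finset.mul_sum, Fintype.sum_prod_type,
      sum_sum_prod_eq_prod_sum fun j (z : S j × A j) =>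
        (if I.d ≤ u ∧ z.1 ∈ F j then 0 else T j u z.1) *
          (policyOf (ρ j) z.1 z.2 * G.P j z.1 z.2 (y.1 j)), mul_assoc, ← Finset.prod_mul_distrib]
    congr 1
    refine Finset.prod_congr rfl fun j _ => ?_
    rw [mul_comm]
    congr 1
    rw [Fintype.sum_prod_type, hT]
    simp only [tabooLaw, Matrix.vecMul, dotProduct, inducedChain, Matrix.of_apply]
    refine Finset.sum_congr rfl fun s _ => ?_
    rw [Finset.mul_sum]
    exact Finset.sum_congr rfl fun a _ => by rw [mul_comm (policyOf _ _ _)]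

/-! ### Termination of the batches -/

/-- The sets to avoid when player `i` misses the state `s`. -/
def avoidState (i : Fin n) (s : S i) : ∀ j, Finset (S j) := Function.update (fun _ => ∅) i {s}

theorem avoidState_self (i : Fin n) (s : S i) : avoidState i s i = {s} := by simp [avoidState]

theorem avoidState_of_ne {i j : Fin n} (s : S i) (h : j ≠ i) : avoidState i s j = ∅ := by
  simp [avoidState, h]

theorem forall_notMem_avoidState {i : Fin n} {s : S i} {z : ∀ j, S j} :
    (∀ j, z j ∉ avoidState i s j) ↔ z i ≠ s := by
  constructor
  · intro h; simpa [avoidState_self] using h i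
  · intro h j
    by_cases hj : j = i
    · subst hj; simpa [avoidState_self] using h
    · simp [avoidState_of_ne s hj]

/-- Player `i` almost surely visits the state `s` after step `d` of the batch: the probability of
missing it is the taboo mass of its own chain, as the factors of the other players are one. -/
theorem IsRun.ae_visit (hX : G.IsRun I s0 μ X) {τ : ℝ} (hG : G.UniformlyErgodic τ)
    (hδ : ∀ i, 0 < I.δ i) {x : ℕ → (∀ i, S i) × (∀ i, A i)} {k t : ℕ}
    (hs : G.StartsBatch I k t x) (hρ : ∀ i, (G.memory I x t).ρ i ∈ G.shrunk i (I.δ i))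
    (i : Fin n) (s : S i) :
    ∀ᵐ ω ∂μ, ω ∈ cylinder X t x → ∃ v, I.d ≤ v ∧ (X (t + v) ω).1 i = s := by
  set ρ := (G.memory I x t).ρ with hρd
  have hπ : ∀ j, IsPolicy (policyOf (ρ j)) := fun j => isPolicy_policyOf (hδ j) (hρ j)
  have hQ : ∀ j, ∀ s, G.inducedChain j (policyOf (ρ j)) s ∈ stdSimplex ℝ (S j) := fun j =>
    G.inducedChain_mem_stdSimplex (hπ j)
  have hmass : ∀ u, μ.real (avoidEvent X I.d t x (avoidState i s) u) ≤
      ∑ z, tabooLaw (G.inducedChain i (policyOf (ρ i))) {s} I.d (entryLaw G s0 x t i) u z := by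
    intro u
    have hU : avoidEvent X I.d t x (avoidState i s) u =
        ⋃ y ∈ (Finset.univ : Finset ((∀ i, S i) × (∀ i, A i))),
          avoidEvent X I.d t x (avoidState i s) u ∩ {ω | X (t + u) ω = y} := by
      ext ω; simp
    have hm := hX.measurableSet_of_prefixDetermined
      (prefixDetermined_avoidEvent I.d t x (avoidState i s) u)
    rw [hU, measureReal_biUnion_finset]
    · rw [Finset.sum_congr rfl fun y _ => hX.measureReal_avoidEvent_inter hs (avoidState i s)
        ⟨i, by simp [avoidState_self]⟩ u y, ← Finset.mul_sum, Fintype.sum_prod_type,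
        sum_sum_prod_eq_prod_sum fun j (z : S j × A j) =>
          tabooLaw (G.inducedChain j (policyOf (ρ j))) (avoidState i s j) I.d
            (entryLaw G s0 x t j) u z.1 * policyOf (ρ j) z.1 z.2]
      have hj : ∀ j, ∑ z : S j × A j, tabooLaw (G.inducedChain j (policyOf (ρ j)))
          (avoidState i s j) I.d (entryLaw G s0 x t j) u z.1 * policyOf (ρ j) z.1 z.2 =
          ∑ z, tabooLaw (G.inducedChain j (policyOf (ρ j)))
            (avoidState i s j) I.d (entryLaw G s0 x t j) u z := by
        intro j
        rw [Fintype.sum_prod_type]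
        exact Finset.sum_congr rfl fun z _ => by
          dsimp only
          rw [← Finset.mul_sum, (hπ j z).2, mul_one]
      simp_rw [hj]
      rw [← Finset.mul_prod_erase _ _ (Finset.mem_univ i),
        Finset.prod_eq_one (s := Finset.erase _ _),
        mul_one, avoidState_self]
      · exact mul_le_of_le_one_left (Finset.sum_nonneg fun z _ =>
          tabooLaw_nonneg (hQ i) (entryLaw_mem_stdSimplex x t i) u z) measureReal_le_one
      · intro j hj
        rw [avoidState_of_ne s (Finset.mem_erase.1 hj).1]
        exact (tabooLaw_empty_mem_stdSimplex (hQ j) (entryLaw_mem_stdSimplex x t j) u).2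
    · intro y _ y' _ hyy'
      exact Set.disjoint_left.2 fun ω hω hω' => hyy' (hω.2.symm.trans hω'.2)
    · exact fun y _ => hm.inter (hX.measurable _ _)
  have hlim := tendsto_sum_tabooLaw_singleton (d := I.d) (hQ i) (hG i _ (hπ i)).1
    (entryLaw_mem_stdSimplex (G := G) (s0 := s0) x t i) s
  have hzero : μ.real {ω | ω ∈ cylinder X t x ∧ ∀ v, I.d ≤ v → (X (t + v) ω).1 i ≠ s} ≤ 0 := by
    refine ge_of_tendsto' hlim fun u => (measureReal_mono ?_).trans (hmass u)
    rintro ω ⟨h1, h2⟩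
    exact ⟨h1, fun v _ hd => forall_notMem_avoidState.2 (h2 v hd)⟩
  rw [ae_iff]
  have h0 := (measureReal_eq_zero_iff).1 (le_antisymm hzero measureReal_nonneg)
  convert h0 using 2
  ext ω
  simp [not_exists]

/-- A statement holds almost surely at the beginning of batch `k` if it does so given any history
that ends there. -/
theorem ae_of_cylinder {k : ℕ} {p : ℕ → Ω → Prop}
    (h : ∀ ω₀ t, G.StartsBatch I k t (fun u => X u ω₀) →
      ∀ᵐ ω ∂μ, ω ∈ cylinder X t (fun u => X u ω₀) → p t ω) :
    ∀ᵐ ω ∂μ, ∀ t, G.StartsBatch I k t (fun u => X u ω) → p t ω := by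
  refine ae_all_iff.2 fun t => ?_
  have hq : ∀ q : Fin t → (∀ i, S i) × (∀ i, A i), ∀ᵐ ω ∂μ, (∀ u : Fin t, X u ω = q u) →
      G.StartsBatch I k t (fun u => X u ω) → p t ω := by
    intro q
    by_cases hex : ∃ ω₀, (∀ u : Fin t, X u ω₀ = q u) ∧ G.StartsBatch I k t (fun u => X u ω₀)
    · obtain ⟨ω₀, h1, h2⟩ := hex
      filter_upwards [h ω₀ t h2] with ω hω hωq _
      exact hω fun u hu => (hωq ⟨u, hu⟩).trans (h1 ⟨u, hu⟩).symm
    · exact Eventually.of_forall fun ω h1 h2 => (hex ⟨ω, h1, h2⟩).elim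
  filter_upwards [ae_all_iff.2 hq] with ω hω hs
  exact hω (fun u => X u ω) (fun _ => rfl) hs

/-- Almost surely, all batches end. -/
theorem IsRun.ae_exists_startsBatch (hX : G.IsRun I s0 μ X) {τ : ℝ} (hG : G.UniformlyErgodic τ)
    (hδ : ∀ i, 0 < I.δ i) (hρ0 : ∀ i, I.ρ0 i ∈ G.shrunk i (I.δ i))
    (hh_cont : ∀ i, ContinuousOn (I.h i) (G.shrunk i (I.δ i))) :
    ∀ᵐ ω ∂μ, ∀ k, ∃ t, G.StartsBatch I k t (fun u => X u ω) := by
  refine ae_all_iff.2 fun k => ?_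
  induction k with
  | zero => exact Eventually.of_forall fun ω => ⟨0, startsBatch_zero⟩
  | succ k ih =>
    have hvis : ∀ᵐ ω ∂μ, ∀ t, G.StartsBatch I k t (fun u => X u ω) →
        ∀ i (s : S i), ∃ v, I.d ≤ v ∧ (X (t + v) ω).1 i = s := by
      refine ae_of_cylinder fun ω₀ t hs => ?_
      have : ∀ i (s : S i), ∀ᵐ ω ∂μ, ω ∈ cylinder X t (fun u => X u ω₀) →
          ∃ v, I.d ≤ v ∧ (X (t + v) ω).1 i = s :=
        fun i s => hX.ae_visit hG hδ hs (memory_invariant hδ hρ0 hh_cont _ t).1 i s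
      filter_upwards [ae_all_iff.2 fun i => ae_all_iff.2 (this i)] with ω hω hc i s
      exact hω i s hc
    filter_upwards [ih, hvis] with ω ⟨t, ht⟩ hω
    exact ht.exists_succ_of_visits (hω t ht)

/-! ### The conditional expectation of the estimators -/

/-- Fixing the state and action of player `i` in a product sum splits off the weight of that
player. -/
theorem sum_ite_prod_mul_eq (G : StochGame n S A) (i : Fin n) (f : ∀ j, S j × A j → ℝ)
    (z : S i × A i) :
    ∑ s : ∀ j, S j, ∑ a : ∀ j, A j, (if s i = z.1 ∧ a i = z.2 then
      (∏ j, f j (s j, a j)) * G.r i s a else 0) =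
    f i z * G.productValue i (Function.update f i (Pi.single z 1)) := by
  rw [productValue, Finset.mul_sum]
  refine Finset.sum_congr rfl fun s _ => ?_
  rw [Finset.mul_sum]
  refine Finset.sum_congr rfl fun a _ => ?_
  rw [← Finset.mul_prod_erase _ (fun j => f j (s j, a j)) (Finset.mem_univ i),
    ← Finset.mul_prod_erase _ (fun j => Function.update f i (Pi.single z 1) j (s j, a j))
      (Finset.mem_univ i)]
  have h : ∏ j ∈ Finset.univ.erase i, (Function.update f i (Pi.single z 1)) j (s j, a j)
        = ∏ j ∈ Finset.univ.erase i, f j (s j, a j) :=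
    Finset.prod_congr rfl fun j hj => by simp [(Finset.mem_erase.1 hj).1]
  rw [h, Function.update_self, Pi.single_apply]
  by_cases hz : s i = z.1 ∧ a i = z.2
  · rw [if_pos hz, if_pos (Prod.ext hz.1 hz.2), show (s i, a i) = z from Prod.ext hz.1 hz.2]
    ring
  · rw [if_neg hz, if_neg (fun h => hz ⟨congrArg Prod.fst h, congrArg Prod.snd h⟩)]
    simp

/-- The occupation law of player `j` at step `u` of a batch begun at time `t` after `x`. -/
noncomputable def stepLaw (G : StochGame n S A) (I : AlgInput S A) (s0 : ∀ i, S i)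
    (x : ℕ → (∀ i, S i) × (∀ i, A i)) (t u : ℕ) (j : Fin n) (z : S j × A j) : ℝ :=
  tabooLaw (G.inducedChain j (policyOf ((G.memory I x t).ρ j))) ∅ I.d (entryLaw G s0 x t j) u z.1 *
    policyOf ((G.memory I x t).ρ j) z.1 z.2

/-- The contribution of step `v` to an entry of the estimator, averaged over the runs that begin a
batch after `x`: the probability of a first visit at this step times the expected reward against
the current laws of the other players. The importance weight cancels the probability of the
action. -/
theorem IsRun.setIntegral_visitTerm (hX : G.IsRun I s0 μ X) (hδ : ∀ i, 0 < I.δ i)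
    {x : ℕ → (∀ i, S i) × (∀ i, A i)} {k t : ℕ} (hs : G.StartsBatch I k t x)
    (hρ : ∀ i, (G.memory I x t).ρ i ∈ G.shrunk i (I.δ i)) (i : Fin n) (s : S i) (a : A i) (v : ℕ) :
    Integrable (fun ω => visitTerm G I.d (G.memory I x t).ρ i s a (fun u => X u ω) t v) μ ∧
    (∀ ω, 0 ≤ visitTerm G I.d (G.memory I x t).ρ i s a (fun u => X u ω) t v) ∧
    ∫ ω in cylinder X t x, visitTerm G I.d (G.memory I x t).ρ i s a (fun u => X u ω) t v ∂μ =
      μ.real (cylinder X t x) * ((if I.d ≤ v then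
        tabooLaw (G.inducedChain i (policyOf ((G.memory I x t).ρ i))) {s} I.d
          (entryLaw G s0 x t i) v s else 0) *
        G.productValue i (Function.update (stepLaw G I s0 x t v) i (Pi.single (s, a) 1))) := by
  set ρ := (G.memory I x t).ρ with hρd
  have hπpos : 0 < policyOf (ρ i) s a := (hδ i).trans_le (le_policyOf (hδ i) (hρ i) s a)
  have hmeas : Measurable fun ω => visitTerm G I.d ρ i s a (fun u => X u ω) t v := by
    refine hX.measurable_of_prefix (t + v + 1) fun ω ω' h => ?_
    unfold visitTerm
    have h1 : (∀ w < v, I.d ≤ w → (X (t + w) ω).1 i ≠ s) ↔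
        (∀ w < v, I.d ≤ w → (X (t + w) ω').1 i ≠ s) :=
      forall_congr' fun w => forall_congr' fun hw => by rw [h (t + w) (by omega)]
    simp only [h1, h (t + v) (by omega)]
  have hnn : ∀ ω, 0 ≤ visitTerm G I.d ρ i s a (fun u => X u ω) t v := by
    intro ω
    unfold visitTerm
    split_ifs
    exacts [div_nonneg (G.r_mem _ _ _).1 hπpos.le, le_rfl]
  have hle : ∀ ω, visitTerm G I.d ρ i s a (fun u => X u ω) t v ≤ 1 / policyOf (ρ i) s a := by
    intro ω
    unfold visitTerm
    split_ifs
    exacts [div_le_div_of_nonneg_right (G.r_mem _ _ _).2 hπpos.le, by positivity]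
  refine ⟨?_, hnn, ?_⟩
  · refine Integrable.of_bound hmeas.aestronglyMeasurable (1 / policyOf (ρ i) s a)
      (Eventually.of_forall fun ω => ?_)
    rw [Real.norm_of_nonneg (hnn ω)]
    exact hle ω
  · by_cases hd : I.d ≤ v
    · let D : (∀ i, S i) × (∀ i, A i) → Set Ω := fun y =>
        avoidEvent X I.d t x (avoidState i s) v ∩ {ω | X (t + v) ω = y}
      have hDm : ∀ y, MeasurableSet (D y) := fun y =>
        (hX.measurableSet_of_prefixDetermined (prefixDetermined_avoidEvent _ _ _ _ _)).inter
          (hX.measurable _ _)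
      have hCm := hX.measurableSet_of_prefixDetermined (prefixDetermined_cylinder t x)
      have hfun : (cylinder X t x).indicator
          (fun ω => visitTerm G I.d ρ i s a (fun u => X u ω) t v) = fun ω =>
          ∑ y, (D y).indicator (fun _ => if y.1 i = s ∧ y.2 i = a then
            G.r i y.1 y.2 / policyOf (ρ i) s a else 0) ω := by
        ext ω
        by_cases hω : ω ∈ avoidEvent X I.d t x (avoidState i s) v
        · rw [Finset.sum_eq_single (X (t + v) ω), Set.indicator_of_mem hω.1,
            Set.indicator_of_mem (show ω ∈ D (X (t + v) ω) from ⟨hω, rfl⟩)]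
          · unfold visitTerm
            have h2 : ∀ w < v, I.d ≤ w → (X (t + w) ω).1 i ≠ s := fun w hw hdw =>
              forall_notMem_avoidState.1 (hω.2 w hw hdw)
            by_cases hy : (X (t + v) ω).1 i = s ∧ (X (t + v) ω).2 i = a
            · rw [if_pos hy, if_pos ⟨hd, h2, hy⟩]
            · rw [if_neg hy, if_neg fun h => hy h.2.2]
          · intro y _ hy
            exact Set.indicator_of_notMem (fun h => hy h.2.symm) _
          · simp
        · rw [Finset.sum_eq_zero fun y _ => Set.indicator_of_notMem (fun h => hω h.1) _]
          by_cases hc : ω ∈ cylinder X t x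
          · rw [Set.indicator_of_mem hc]
            refine if_neg fun h => hω ⟨hc, fun w hw hdw => ?_⟩
            exact forall_notMem_avoidState.2 (h.2.1 w hw hdw)
          · exact Set.indicator_of_notMem hc _
      rw [← integral_indicator hCm, hfun, integral_finsetSum]
      · simp_rw [integral_indicator_const _ (hDm _), D]
        rw [Finset.sum_congr rfl fun y _ => by
          rw [hX.measureReal_avoidEvent_inter hs (avoidState i s)
            ⟨i, by simp [avoidState_self]⟩ v y]]
        let f : ∀ j, S j × A j → ℝ := fun j z =>
          tabooLaw (G.inducedChain j (policyOf (ρ j))) (avoidState i s j) I.d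
            (entryLaw G s0 x t j) v z.1 * policyOf (ρ j) z.1 z.2
        have hterm : ∀ y : (∀ i, S i) × (∀ i, A i), (μ.real (cylinder X t x) *
            ∏ j, f j (y.1 j, y.2 j)) •
              (if y.1 i = s ∧ y.2 i = a then G.r i y.1 y.2 / policyOf (ρ i) s a else 0) =
            μ.real (cylinder X t x) / policyOf (ρ i) s a *
              (if y.1 i = s ∧ y.2 i = a then (∏ j, f j (y.1 j, y.2 j)) * G.r i y.1 y.2 else 0) := by
          intro y
          split_ifs
          · rw [smul_eq_mul]; ring
          · simp
        refine (Finset.sum_congr rfl fun y _ => hterm y).trans ?_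
        rw [← Finset.mul_sum, Fintype.sum_prod_type, G.sum_ite_prod_mul_eq i f (s, a)]
        have hupd : Function.update f i (Pi.single (s, a) 1) =
            Function.update (stepLaw G I s0 x t v) i (Pi.single (s, a) 1) := by
          ext j z
          by_cases hj : j = i
          · subst hj; simp
          · simp [hj, f, stepLaw, avoidState_of_ne s hj, hρd]
        rw [hupd, if_pos hd]
        simp only [f, avoidState_self]
        field_simp
      · exact fun y _ => (integrable_const _).indicator (hDm y)
    · rw [if_neg hd, zero_mul, mul_zero]
      have h0 : ∀ ω, visitTerm G I.d ρ i s a (fun u => X u ω) t v = 0 := fun ω =>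
        if_neg fun h => hd h.1
      simp [h0]

theorem stepLaw_nonneg (hδ : ∀ i, 0 < I.δ i) {x : ℕ → (∀ i, S i) × (∀ i, A i)} {t : ℕ}
    (hρ : ∀ i, (G.memory I x t).ρ i ∈ G.shrunk i (I.δ i)) (u : ℕ) (j : Fin n) (z : S j × A j) :
    0 ≤ stepLaw G I s0 x t u j z := by
  have hπ := isPolicy_policyOf (hδ j) (hρ j)
  exact mul_nonneg (tabooLaw_nonneg (G.inducedChain_mem_stdSimplex hπ)
    (entryLaw_mem_stdSimplex x t j) u _) ((hπ _).1 _)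

theorem sum_stepLaw (hδ : ∀ i, 0 < I.δ i) {x : ℕ → (∀ i, S i) × (∀ i, A i)} {t : ℕ}
    (hρ : ∀ i, (G.memory I x t).ρ i ∈ G.shrunk i (I.δ i)) (u : ℕ) (j : Fin n) :
    ∑ z, stepLaw G I s0 x t u j z = 1 := by
  have hπ := isPolicy_policyOf (hδ j) (hρ j)
  rw [Fintype.sum_prod_type, ← (tabooLaw_empty_mem_stdSimplex (d := I.d)
    (G.inducedChain_mem_stdSimplex hπ) (entryLaw_mem_stdSimplex (G := G) (s0 := s0) x t j) u).2]
  refine Finset.sum_congr rfl fun s _ => ?_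
  simp only [stepLaw]
  rw [← Finset.mul_sum, (hπ s).2, mul_one]

/-- The conditional expectation of an entry of the estimator, given a history `x` that ends at the
beginning of a batch, is at most `1` and differs from the entry of the payoff gradient by at most
`2 n exp(-d / τ)`. -/
theorem IsRun.setIntegral_estimator (hX : G.IsRun I s0 μ X) {τ : ℝ} (hτ : 0 < τ)
    (hG : G.UniformlyErgodic τ) (hδ : ∀ i, 0 < I.δ i)
    (hρ0 : ∀ i, I.ρ0 i ∈ G.shrunk i (I.δ i))
    (hh_cont : ∀ i, ContinuousOn (I.h i) (G.shrunk i (I.δ i)))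
    {x : ℕ → (∀ i, S i) × (∀ i, A i)} {k t : ℕ} (hs : G.StartsBatch I k t x) (i : Fin n)
    (z : S i × A i) :
    |∫ ω in cylinder X t x, G.estimator I (fun u => X u ω) k i z ∂μ -
        μ.real (cylinder X t x) * G.grad (G.memory I x t).ρ i z|
      ≤ μ.real (cylinder X t x) * (n * (2 * Real.exp (-1 / τ) ^ I.d)) ∧
    ∫ ω in cylinder X t x, G.estimator I (fun u => X u ω) k i z ∂μ ≤ μ.real (cylinder X t x) := by
  have hρ := (memory_invariant hδ hρ0 hh_cont x t).1
  set ρ := (G.memory I x t).ρ with hρd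
  set C := cylinder X t x with hC
  obtain ⟨s, a⟩ := z
  set β : ℝ := n * (2 * Real.exp (-1 / τ) ^ I.d) with hβ
  set c : ℕ → ℝ := fun v => if I.d ≤ v then
    tabooLaw (G.inducedChain i (policyOf (ρ i))) {s} I.d (entryLaw G s0 x t i) v s else 0 with hc
  set p : ℕ → ℝ := fun v =>
    G.productValue i (Function.update (stepLaw G I s0 x t v) i (Pi.single (s, a) 1)) with hp
  have hπ := isPolicy_policyOf (hδ i) (hρ i)
  have hQ := G.inducedChain_mem_stdSimplex hπ
  have hcsum : HasSum c 1 :=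
    hasSum_tabooLaw_singleton hQ (hG i _ hπ).1 (entryLaw_mem_stdSimplex x t i) s
  have hc0 : ∀ v, 0 ≤ c v := by
    intro v
    simp only [hc]
    split_ifs
    exacts [tabooLaw_nonneg hQ (entryLaw_mem_stdSimplex x t i) v s, le_rfl]
  have hF0 : ∀ v j y, 0 ≤ Function.update (stepLaw G I s0 x t v) i (Pi.single (s, a) 1) j y := by
    intro v j y
    by_cases hj : j = i
    · subst hj
      rw [Function.update_self, Pi.single_apply]
      split_ifs <;> norm_num
    · rw [Function.update_of_ne hj]; exact stepLaw_nonneg hδ hρ v j y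
  have hF1 : ∀ v j, ∑ y, Function.update (stepLaw G I s0 x t v) i (Pi.single (s, a) 1) j y = 1 := by
    intro v j
    by_cases hj : j = i
    · subst hj; simp
    · rw [Function.update_of_ne hj]; exact sum_stepLaw hδ hρ v j
  have hp0 : ∀ v, 0 ≤ p v := fun v => G.productValue_nonneg i (hF0 v)
  have hp1 : ∀ v, p v ≤ 1 := fun v => G.productValue_le_one i (hF0 v) (hF1 v)
  -- from step `d` on, the other players are close to their stationary laws
  have hpg : ∀ v, I.d ≤ v → |p v - G.grad ρ i (s, a)| ≤ β := by
    intro v hv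
    rw [grad_apply_eq_productValue]
    refine (G.abs_productValue_sub_le i (fun j => ?_) fun j => ?_).trans ?_
    · simp_rw [abs_of_nonneg (hF0 v j _)]
      exact (hF1 v j).le
    · by_cases hj : j = i
      · subst hj
        rw [Function.update_self]
        simp [Pi.single_apply, apply_ite abs]
      · rw [Function.update_of_ne hj]
        exact (sum_abs_eq_one_of_mem_polytope (hρ j).1).le
    · calc _ ≤ ∑ _j : Fin n, 2 * Real.exp (-1 / τ) ^ I.d := by
            refine Finset.sum_le_sum fun j _ => ?_
            by_cases hj : j = i
            · subst hj
              simp only [Function.update_self, sub_self, abs_zero, Finset.sum_const_zero]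
              positivity
            · simp only [Function.update_of_ne hj]
              exact sum_abs_law_mul_policyOf_sub_le hτ hG (hδ j) (hρ j)
                (entryLaw_mem_stdSimplex x t j) hv
        _ = β := by simp [hβ]
  have hterm := fun v => hX.setIntegral_visitTerm hδ hs hρ i s a v
  have hsum : HasSum (fun v => μ.real C * (c v * p v))
      (∫ ω in C, G.estimator I (fun u => X u ω) k i (s, a) ∂μ) := by
    have hcp : Summable fun v => c v * p v :=
      Summable.of_nonneg_of_le (fun v => mul_nonneg (hc0 v) (hp0 v))
        (fun v => mul_le_of_le_one_right (hc0 v) (hp1 v)) hcsum.summable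
    have h1 := hasSum_integral_of_summable_integral_norm (μ := μ.restrict C)
      (F := fun v ω => visitTerm G I.d ρ i s a (fun u => X u ω) t v)
      (fun v => (hterm v).1.integrableOn) (by
        refine (hcp.mul_left (μ.real C)).congr fun v => ?_
        exact (hterm v).2.2.symm.trans (integral_congr_ae (Eventually.of_forall fun ω =>
          (Real.norm_of_nonneg ((hterm v).2.1 ω)).symm)))
    have h2 : ∫ ω in C, ∑' v, visitTerm G I.d ρ i s a (fun u => X u ω) t v ∂μ =
        ∫ ω in C, G.estimator I (fun u => X u ω) k i (s, a) ∂μ := by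
      refine setIntegral_congr_ae (hX.measurableSet_of_prefixDetermined
        (prefixDetermined_cylinder t x)) ?_
      filter_upwards [hX.ae_exists_startsBatch hG hδ hρ0 hh_cont] with ω hω hωC
      obtain ⟨t', ht'⟩ := hω (k + 1)
      have hs' : G.StartsBatch I k t (fun u => X u ω) := hs.congr fun v hv => (hωC v hv).symm
      have := (hs'.hasSum_visitTerm ht' i s a).tsum_eq
      rwa [memory_congr G I (y := x) hωC] at this
    rw [h2] at h1
    exact h1.congr_fun fun v => ((hterm v).2.2).symm
  have hμ : 0 ≤ μ.real C := measureReal_nonneg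
  have hub : ∫ ω in C, G.estimator I (fun u => X u ω) k i (s, a) ∂μ
      ≤ μ.real C * (1 * (G.grad ρ i (s, a) + β)) := by
    refine hasSum_le (fun v => ?_) hsum
      ((hcsum.mul_right (G.grad ρ i (s, a) + β)).mul_left (μ.real C))
    by_cases hv : I.d ≤ v
    · have := (abs_le.1 (hpg v hv)).2
      exact mul_le_mul_of_nonneg_left
        (mul_le_mul_of_nonneg_left (by linarith) (hc0 v)) hμ
    · simp [hc, hv]
  have hlb : μ.real C * (1 * (G.grad ρ i (s, a) - β))
      ≤ ∫ ω in C, G.estimator I (fun u => X u ω) k i (s, a) ∂μ := by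
    refine hasSum_le (fun v => ?_) ((hcsum.mul_right (G.grad ρ i (s, a) - β)).mul_left (μ.real C))
      hsum
    by_cases hv : I.d ≤ v
    · have := (abs_le.1 (hpg v hv)).1
      exact mul_le_mul_of_nonneg_left
        (mul_le_mul_of_nonneg_left (by linarith) (hc0 v)) hμ
    · simp [hc, hv]
  refine ⟨abs_le.2 ⟨by linarith, by linarith⟩, ?_⟩
  have := hasSum_le (fun v => mul_le_mul_of_nonneg_left
    (mul_le_of_le_one_right (hc0 v) (hp1 v)) hμ) hsum (hcsum.mul_left (μ.real C))
  simpa using this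

/-! ### The filtration of batch beginnings -/

/-- The beginning of batch `k` is a random variable, with the value `0` where batch `k` never
begins. -/
theorem IsRun.measurable_batchStart (hX : G.IsRun I s0 μ X) (k : ℕ) :
    Measurable fun ω => G.batchStart I (fun u => X u ω) k := by
  have hA : ∀ t, MeasurableSet {ω | (G.memory I (fun u => X u ω) t).batch = k} := by
    intro t
    refine hX.measurableSet_of_prefixDetermined (t := t) fun ω ω' h hω => ?_
    rw [Set.mem_ofPred_eq, ← memory_congr G I (x := fun u => X u ω) h]
    exact hω
  refine measurable_to_countable' fun t => ?_
  have h : (fun ω => G.batchStart I (fun u => X u ω) k) ⁻¹' {t} =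
      ({ω | (G.memory I (fun u => X u ω) t).batch = k} ∩
        ⋂ (v : ℕ) (_ : v < t), {ω | (G.memory I (fun u => X u ω) v).batch = k}ᶜ) ∪
      (if t = 0 then ⋂ v : ℕ, {ω | (G.memory I (fun u => X u ω) v).batch = k}ᶜ else ∅) := by
    ext ω
    simp only [Set.mem_preimage, Set.mem_singleton_iff, Set.mem_union, Set.mem_inter_iff,
      Set.mem_ofPred_eq, Set.mem_iInter, Set.mem_compl_iff]
    set T := {t | (G.memory I (fun u => X u ω) t).batch = k} with hT
    constructor
    · rintro rfl
      rcases T.eq_empty_or_nonempty with he | hne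
      · right
        have h0 : G.batchStart I (fun u => X u ω) k = 0 := by
          change sInf T = 0
          rw [he, Nat.sInf_empty]
        rw [if_pos h0]
        refine Set.mem_iInter.2 fun v hv => ?_
        have : v ∈ T := hv
        rw [he] at this
        exact this
      · exact Or.inl ⟨Nat.sInf_mem hne, fun v hv => Nat.notMem_of_lt_sInf (s := T) hv⟩
    · rintro (⟨h1, h2⟩ | h2)
      · refine le_antisymm (Nat.sInf_le h1) (not_lt.1 fun hlt => ?_)
        exact h2 _ hlt (Nat.sInf_mem (s := T) ⟨t, h1⟩)
      · split_ifs at h2 with h0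
        · have he : T = ∅ := Set.eq_empty_of_forall_notMem fun v hv => Set.mem_iInter.1 h2 v hv
          change sInf T = t
          rw [he, Nat.sInf_empty, h0]
        · exact h2.elim
  rw [h]
  refine ((hA t).inter (MeasurableSet.iInter fun v => MeasurableSet.iInter fun _ =>
    (hA v).compl)).union ?_
  split_ifs
  exacts [MeasurableSet.iInter fun v => (hA v).compl, MeasurableSet.empty]

variable (G I) in
/-- The events that are determined by the run before the beginning of batch `k`; there is no
restriction on the runs along which batch `k` does not begin. -/
def batchFiltration (X : ℕ → Ω → (∀ i, S i) × (∀ i, A i)) :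
    Filtration ℕ (inferInstance : MeasurableSpace Ω) where
  seq k :=
    { MeasurableSet' := fun B => MeasurableSet B ∧ ∀ t ω ω',
        G.StartsBatch I k t (fun u => X u ω) → (∀ u < t, X u ω = X u ω') → ω ∈ B → ω' ∈ B
      measurableSet_empty := ⟨MeasurableSet.empty, fun _ _ _ _ _ h => h⟩
      measurableSet_compl := fun B hB => ⟨hB.1.compl, fun t ω ω' hs h hω hω' =>
        hω (hB.2 t ω' ω (hs.congr h) (fun u hu => (h u hu).symm) hω')⟩
      measurableSet_iUnion := fun B hB => ⟨MeasurableSet.iUnion fun j => (hB j).1, by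
        intro t ω ω' hs h hω
        obtain ⟨j, hj⟩ := Set.mem_iUnion.1 hω
        exact Set.mem_iUnion.2 ⟨j, (hB j).2 t ω ω' hs h hj⟩⟩ }
  mono' := by
    refine monotone_nat_of_le_succ fun k B hB => ⟨hB.1, fun t ω ω' hs h hω => ?_⟩
    obtain ⟨t', u, hs', rfl⟩ := hs.exists_pred
    exact hB.2 t' ω ω' hs' (fun v hv => h v (by omega)) hω
  le' := fun _ _ hB => hB.1

theorem measurable_batchFiltration {k : ℕ} {β : Type*} [MeasurableSpace β] {f : Ω → β}
    (hf : Measurable f) (hdet : ∀ t ω ω', G.StartsBatch I k t (fun u => X u ω) →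
      (∀ u < t, X u ω = X u ω') → f ω = f ω') :
    Measurable[batchFiltration G I X k] f := by
  intro V hV
  refine ⟨hf hV, fun t ω ω' hs h hω => ?_⟩
  rw [Set.mem_preimage, ← hdet t ω ω' hs h]
  exact hω

/-- An integral over an event of `batchFiltration` at `k` is nonnegative if it is so given each
history that ends at the beginning of batch `k`. -/
theorem IsRun.setIntegral_nonneg_of_cylinder (hX : G.IsRun I s0 μ X) {k : ℕ}
    (hstart : ∀ᵐ ω ∂μ, ∃ t, G.StartsBatch I k t (fun u => X u ω)) {f : Ω → ℝ} (hf : Integrable f μ)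
    (h : ∀ ω₀ t, G.StartsBatch I k t (fun u => X u ω₀) →
      0 ≤ ∫ ω in cylinder X t (fun u => X u ω₀), f ω ∂μ) {B : Set Ω}
    (hB : MeasurableSet[batchFiltration G I X k] B) : 0 ≤ ∫ ω in B, f ω ∂μ := by
  let D : (Σ t : ℕ, (Fin t → (∀ i, S i) × (∀ i, A i))) → Set Ω := fun c =>
    {ω | ω ∈ B ∧ G.StartsBatch I k c.1 (fun u => X u ω) ∧ ∀ u : Fin c.1, X u ω = c.2 u}
  have hcases : ∀ c, D c = ∅ ∨ ∃ ω₀, G.StartsBatch I k c.1 (fun u => X u ω₀) ∧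
      D c = cylinder X c.1 (fun u => X u ω₀) := by
    intro c
    rcases (D c).eq_empty_or_nonempty with he | ⟨ω₀, h1, h2, h3⟩
    · exact Or.inl he
    · refine Or.inr ⟨ω₀, h2, ?_⟩
      ext ω
      constructor
      · rintro ⟨-, -, h3'⟩ u hu
        exact (h3' ⟨u, hu⟩).trans (h3 ⟨u, hu⟩).symm
      · intro hω
        have hω' : ∀ u < c.1, X u ω₀ = X u ω := fun u hu => (hω u hu).symm
        exact ⟨hB.2 _ ω₀ ω h2 hω' h1, h2.congr hω', fun u => (hω u u.2).trans (h3 u)⟩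
  have hm : ∀ c, MeasurableSet (D c) := by
    intro c
    rcases hcases c with he | ⟨ω₀, -, he⟩
    · rw [he]; exact MeasurableSet.empty
    · rw [he]
      exact hX.measurableSet_of_prefixDetermined (prefixDetermined_cylinder _ _)
  have hd : Pairwise (Function.onFun Disjoint D) := by
    rintro ⟨t, q⟩ ⟨t', q'⟩ hne
    refine Set.disjoint_left.2 fun ω hω hω' => hne ?_
    obtain rfl : t = t' := hω.2.1.unique hω'.2.1
    have : q = q' := funext fun u => (hω.2.2 u).symm.trans (hω'.2.2 u)
    rw [this]
  have hU : B =ᵐ[μ] ⋃ c, D c := by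
    filter_upwards [hstart] with ω ⟨t, ht⟩
    refine propext ⟨fun hω => ?_, fun hω => ?_⟩
    · exact Set.mem_iUnion.2 ⟨⟨t, fun u => X u ω⟩, hω, ht, fun _ => rfl⟩
    · obtain ⟨c, hc⟩ := Set.mem_iUnion.1 hω
      exact hc.1
  rw [setIntegral_congr_set hU, integral_iUnion hm hd hf.integrableOn]
  refine tsum_nonneg fun c => ?_
  rcases hcases c with he | ⟨ω₀, hs, he⟩
  · rw [he]; simp
  · rw [he]; exact h ω₀ c.1 hs

/-! ### The iterates and the estimators as random variables -/

theorem measurable_comp_nat {T : Ω → ℕ} (hT : Measurable T) {F : ℕ → Ω → ℝ}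
    (hF : ∀ t, Measurable (F t)) : Measurable fun ω => F (T ω) ω :=
  (measurable_from_prod_countable_right (f := fun p : ℕ × Ω => F p.1 p.2) hF).comp
    (hT.prodMk measurable_id)

theorem IsRun.measurable_iter (hX : G.IsRun I s0 μ X) (k : ℕ) (i : Fin n) (z : S i × A i) :
    Measurable[batchFiltration G I X k] fun ω => G.iter I (fun u => X u ω) k i z := by
  refine measurable_batchFiltration ?_ fun t ω ω' hs h => ?_
  · exact measurable_comp_nat (hX.measurable_batchStart k)
      (F := fun t ω => (G.memory I (fun u => X u ω) t).ρ i z) fun t =>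
        hX.measurable_of_prefix t fun ω ω' h => by
          rw [memory_congr G I (x := fun u => X u ω) h]
  · rw [hs.iter_eq, (hs.congr h).iter_eq, memory_congr G I (x := fun u => X u ω) h]

theorem IsRun.measurable_estimator (hX : G.IsRun I s0 μ X) (k : ℕ) (i : Fin n) (z : S i × A i) :
    Measurable[batchFiltration G I X (k + 1)] fun ω =>
      G.estimator I (fun u => X u ω) k i z := by
  refine measurable_batchFiltration ?_ fun t ω ω' hs h => ?_
  · refine measurable_comp_nat (T := fun ω => G.batchStart I (fun u => X u ω) (k + 1) - 1)
      (F := fun t ω => G.sampleR I (G.memory I (fun u => X u ω) t) (X t ω) i z) ?_ fun t => ?_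
    · exact (measurable_from_nat (f := fun a => a - 1)).comp (hX.measurable_batchStart (k + 1))
    · refine hX.measurable_of_prefix (t + 1) fun ω ω' h => ?_
      rw [memory_congr G I (x := fun u => X u ω) (y := fun u => X u ω') (fun u hu => h u (by omega)),
        h t (by omega)]
  · obtain ⟨t', u, -, rfl⟩ := hs.exists_pred
    rw [estimator, estimator, hs.batchStart_eq, (hs.congr h).batchStart_eq, Nat.add_sub_cancel,
      memory_congr G I (x := fun u => X u ω) (y := fun u => X u ω') (fun u hu => h u (by omega)),
      h (t' + u) (by omega)]

theorem inner_eq_sum {i : Fin n} (p q : EuclideanSpace ℝ (S i × A i)) :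
    inner ℝ p q = ∑ z, p z * q z := by
  simp [PiLp.inner_apply, mul_comm]

theorem abs_sub_le_one_of_mem_polytope {i : Fin n} {ρ σ : EuclideanSpace ℝ (S i × A i)}
    (hρ : ρ ∈ G.polytope i) (hσ : σ ∈ G.polytope i) (z : S i × A i) : |(σ - ρ) z| ≤ 1 := by
  have h1 := hρ.1 z; have h2 := hσ.1 z
  have h3 := le_one_of_mem_polytope hρ z; have h4 := le_one_of_mem_polytope hσ z
  rw [PiLp.sub_apply, abs_le]
  constructor <;> linarith

/-- Positive thresholds, a feasible initial point and continuous regularizers: under these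
conditions all iterates are well defined and feasible. -/
structure IsFeasible (G : StochGame n S A) (I : AlgInput S A) : Prop where
  δ_pos : ∀ i, 0 < I.δ i
  ρ0_mem : ∀ i, I.ρ0 i ∈ G.shrunk i (I.δ i)
  continuousOn_h : ∀ i, ContinuousOn (I.h i) (G.shrunk i (I.δ i))

section Moments

variable (hF : IsFeasible G I)
include hF

theorem IsFeasible.iter_mem (x : ℕ → (∀ i, S i) × (∀ i, A i)) (k : ℕ) (i : Fin n) :
    G.iter I x k i ∈ G.shrunk i (I.δ i) :=
  iter_mem_shrunk hF.δ_pos hF.ρ0_mem hF.continuousOn_h x k i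

theorem IsFeasible.estimator_mem (x : ℕ → (∀ i, S i) × (∀ i, A i)) (k : ℕ) (i : Fin n)
    (z : S i × A i) : G.estimator I x k i z ∈ Set.Icc 0 (I.δ i)⁻¹ :=
  estimator_mem_Icc hF.δ_pos hF.ρ0_mem hF.continuousOn_h x k i z

theorem IsFeasible.integrable_estimator (hX : G.IsRun I s0 μ X) (k : ℕ) (i : Fin n)
    (z : S i × A i) : Integrable (fun ω => G.estimator I (fun u => X u ω) k i z) μ := by
  refine Integrable.of_bound (((hX.measurable_estimator k i z).mono
    ((batchFiltration G I X).le _) le_rfl).aestronglyMeasurable) (I.δ i)⁻¹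
    (Eventually.of_forall fun ω => ?_)
  have := hF.estimator_mem (fun u => X u ω) k i z
  rw [Real.norm_of_nonneg this.1]
  exact this.2

/-- The gain `⟨R^k, σ - ρ^k⟩` is bounded. -/
theorem IsFeasible.abs_dot_estimator_le {σ : Profile S A} (hσ : ∀ i, σ i ∈ G.polytope i)
    (x : ℕ → (∀ i, S i) × (∀ i, A i)) (k : ℕ) :
    |dot (G.estimator I x k) (σ - G.iter I x k)| ≤
      ∑ i, ((Fintype.card (S i) : ℝ) * Fintype.card (A i)) * (I.δ i)⁻¹ := by
  refine (Finset.abs_sum_le_sum_abs _ _).trans (Finset.sum_le_sum fun i _ => ?_)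
  rw [inner_eq_sum]
  refine (Finset.abs_sum_le_sum_abs _ _).trans ?_
  calc _ ≤ ∑ _z : S i × A i, (I.δ i)⁻¹ := by
        refine Finset.sum_le_sum fun z _ => ?_
        have h1 := hF.estimator_mem x k i z
        rw [abs_mul, abs_of_nonneg h1.1]
        exact (mul_le_of_le_one_right h1.1
          (abs_sub_le_one_of_mem_polytope (hF.iter_mem x k i).1 (hσ i) z)).trans h1.2
    _ = _ := by simp [Fintype.card_prod]

theorem IsFeasible.measurable_dot_estimator (hX : G.IsRun I s0 μ X) (σ : Profile S A) (k : ℕ) :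
    Measurable[batchFiltration G I X (k + 1)] fun ω =>
      dot (G.estimator I (fun u => X u ω) k) (σ - G.iter I (fun u => X u ω) k) := by
  simp only [dot, inner_eq_sum]
  refine Finset.measurable_fun_sum _ fun i _ => Finset.measurable_fun_sum _ fun z _ => ?_
  simp only [Pi.sub_apply, PiLp.sub_apply]
  exact (hX.measurable_estimator k i z).mul (measurable_const.sub
    ((hX.measurable_iter k i z).mono ((batchFiltration G I X).mono (Nat.le_succ k)) le_rfl))

theorem IsFeasible.memLp_dot_estimator (hX : G.IsRun I s0 μ X) {σ : Profile S A}
    (hσ : ∀ i, σ i ∈ G.polytope i) (k : ℕ) :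
    MemLp (fun ω => dot (G.estimator I (fun u => X u ω) k) (σ - G.iter I (fun u => X u ω) k))
      2 μ :=
  MemLp.of_bound (((hF.measurable_dot_estimator hX σ k).mono
    ((batchFiltration G I X).le _) le_rfl).aestronglyMeasurable) _
    (Eventually.of_forall fun ω => hF.abs_dot_estimator_le hσ (fun u => X u ω) k)

theorem measurable_dot_grad (hX : G.IsRun I s0 μ X) (σ : Profile S A) (k : ℕ) :
    Measurable[batchFiltration G I X k] fun ω =>
      dot (G.grad (G.iter I (fun u => X u ω) k)) (σ - G.iter I (fun u => X u ω) k) := by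
  simp only [dot, inner_eq_sum]
  refine Finset.measurable_fun_sum _ fun i _ => Finset.measurable_fun_sum _ fun z _ => ?_
  simp only [Pi.sub_apply, PiLp.sub_apply]
  refine Measurable.mul ?_ (measurable_const.sub (hX.measurable_iter k i z))
  simp only [grad]
  refine Finset.measurable_fun_sum _ fun s _ => Finset.measurable_fun_sum _ fun a _ => ?_
  split_ifs
  · exact (Finset.measurable_fun_prod _ fun j _ => hX.measurable_iter k j _).mul_const _
  · exact measurable_const

theorem IsFeasible.abs_dot_grad_le {σ : Profile S A} (hσ : ∀ i, σ i ∈ G.polytope i)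
    (x : ℕ → (∀ i, S i) × (∀ i, A i)) (k : ℕ) :
    |dot (G.grad (G.iter I x k)) (σ - G.iter I x k)| ≤
      ∑ i, (Fintype.card (S i) : ℝ) * Fintype.card (A i) := by
  refine (Finset.abs_sum_le_sum_abs _ _).trans (Finset.sum_le_sum fun i _ => ?_)
  rw [inner_eq_sum]
  refine (Finset.abs_sum_le_sum_abs _ _).trans ?_
  calc _ ≤ ∑ _z : S i × A i, (1 : ℝ) := by
        refine Finset.sum_le_sum fun z _ => ?_
        have h1 := G.grad_mem_Icc (fun i => (hF.iter_mem x k i).1) i z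
        rw [abs_mul, abs_of_nonneg h1.1]
        exact (mul_le_of_le_one_right h1.1
          (abs_sub_le_one_of_mem_polytope (hF.iter_mem x k i).1 (hσ i) z)).trans h1.2
    _ = _ := by simp [Fintype.card_prod]

variable {τ : ℝ} (hτ : 0 < τ) (hG : G.UniformlyErgodic τ)
include hτ hG

/-- Up to the mixing error, the conditional expectation of the estimated gain is the true gain. -/
theorem IsFeasible.dot_grad_sub_le_condExp (hX : G.IsRun I s0 μ X) {σ : Profile S A}
    (hσ : ∀ i, σ i ∈ G.polytope i) (k : ℕ) :
    ∀ᵐ ω ∂μ, dot (G.grad (G.iter I (fun u => X u ω) k)) (σ - G.iter I (fun u => X u ω) k) -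
        n * (2 * Real.exp (-1 / τ) ^ I.d) * ∑ i, (Fintype.card (S i) : ℝ) * Fintype.card (A i) ≤
      (μ[fun ω => dot (G.estimator I (fun u => X u ω) k) (σ - G.iter I (fun u => X u ω) k) |
        batchFiltration G I X k]) ω := by
  set β : ℝ := n * (2 * Real.exp (-1 / τ) ^ I.d) with hβ
  set M : ℝ := ∑ i, (Fintype.card (S i) : ℝ) * Fintype.card (A i) with hM
  have hβ0 : 0 ≤ β := by positivity
  set f : Ω → ℝ := fun ω =>
    dot (G.estimator I (fun u => X u ω) k) (σ - G.iter I (fun u => X u ω) k) with hf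
  set g : Ω → ℝ := fun ω =>
    dot (G.grad (G.iter I (fun u => X u ω) k)) (σ - G.iter I (fun u => X u ω) k) - β * M with hg
  have hfint : Integrable f μ := (hF.memLp_dot_estimator hX hσ k).integrable one_le_two
  have hgm : Measurable[batchFiltration G I X k] g :=
    (measurable_dot_grad hF hX σ k).sub measurable_const
  have hgint : Integrable g μ := by
    refine Integrable.sub ?_ (integrable_const _)
    exact Integrable.of_bound (((measurable_dot_grad hF hX σ k).mono
      ((batchFiltration G I X).le _) le_rfl).aestronglyMeasurable) M
      (Eventually.of_forall fun ω => hF.abs_dot_grad_le hσ (fun u => X u ω) k)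
  have hstart := hX.ae_exists_startsBatch hG hF.δ_pos hF.ρ0_mem hF.continuousOn_h
  have hpos : ∀ B, MeasurableSet[batchFiltration G I X k] B → 0 ≤ ∫ ω in B, (f - g) ω ∂μ := by
    intro B hB
    refine hX.setIntegral_nonneg_of_cylinder (by filter_upwards [hstart] with ω hω using hω k)
      (hfint.sub hgint) (fun ω₀ t hs => ?_) hB
    set C := cylinder X t (fun u => X u ω₀) with hC
    set ρ := (G.memory I (fun u => X u ω₀) t).ρ with hρ
    have hρm : ∀ i, ρ i ∈ G.shrunk i (I.δ i) := fun i => by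
      rw [hρ, ← hs.iter_eq]; exact hF.iter_mem _ k i
    have hCm : MeasurableSet C :=
      hX.measurableSet_of_prefixDetermined (prefixDetermined_cylinder _ _)
    have hiter : ∀ ω ∈ C, G.iter I (fun u => X u ω) k = ρ := by
      intro ω hω
      have hs' : G.StartsBatch I k t (fun u => X u ω) := hs.congr fun v hv => (hω v hv).symm
      rw [hs'.iter_eq, memory_congr G I (y := fun u => X u ω₀) hω]
    have hfg : ∫ ω in C, (f - g) ω ∂μ =
        ∑ i, ∑ z, ((∫ ω in C, G.estimator I (fun u => X u ω) k i z ∂μ) -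
          μ.real C * G.grad ρ i z) * (σ i - ρ i) z + μ.real C * (β * M) := by
      have h1 : ∫ ω in C, (f - g) ω ∂μ = ∫ ω in C, ((∑ i, ∑ z,
          (G.estimator I (fun u => X u ω) k i z - G.grad ρ i z) * (σ i - ρ i) z) + β * M) ∂μ := by
        refine setIntegral_congr_fun hCm fun ω hω => ?_
        simp only [Pi.sub_apply, hf, hg, hiter ω hω, dot, inner_eq_sum, sub_mul,
          Finset.sum_sub_distrib]
        ring
      have hi : ∀ i z, Integrable (fun ω => (G.estimator I (fun u => X u ω) k i z - G.grad ρ i z) *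
          (σ i - ρ i) z) (μ.restrict C) := fun i z =>
        (((hF.integrable_estimator hX k i z).integrableOn (s := C)).sub
          (integrable_const _)).mul_const _
      rw [h1, integral_add (integrable_finsetSum _ fun i _ => integrable_finsetSum _ fun z _ => hi i z)
        (integrable_const _), integral_finsetSum _ fun i _ => integrable_finsetSum _ fun z _ => hi i z]
      congr 1
      · refine Finset.sum_congr rfl fun i _ => ?_
        rw [integral_finsetSum _ fun z _ => hi i z]
        refine Finset.sum_congr rfl fun z _ => ?_
        rw [integral_mul_const, integral_sub (hF.integrable_estimator hX k i z).integrableOn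
          (integrable_const _), setIntegral_const, smul_eq_mul]
      · rw [setIntegral_const, smul_eq_mul]
    have hbound : -(μ.real C * (β * M)) ≤ ∑ i, ∑ z,
        ((∫ ω in C, G.estimator I (fun u => X u ω) k i z ∂μ) - μ.real C * G.grad ρ i z) *
          (σ i - ρ i) z := by
      have : μ.real C * (β * M) = ∑ i, ∑ _z : S i × A i, μ.real C * β := by
        simp only [Finset.sum_const, Finset.card_univ, Fintype.card_prod, nsmul_eq_mul, hM,
          Finset.mul_sum, Nat.cast_mul]
        exact Finset.sum_congr rfl fun i _ => by ring
      rw [this, ← Finset.sum_neg_distrib]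
      refine Finset.sum_le_sum fun i _ => ?_
      rw [← Finset.sum_neg_distrib]
      refine Finset.sum_le_sum fun z _ => ?_
      have h1 := (hX.setIntegral_estimator hτ hG hF.δ_pos hF.ρ0_mem hF.continuousOn_h hs i z).1
      have h2 := abs_sub_le_one_of_mem_polytope (hρm i).1 (hσ i) z
      refine (abs_le.1 ?_).1
      rw [abs_mul]
      exact (mul_le_of_le_one_right (abs_nonneg _) h2).trans h1
    rw [hfg]
    linarith
  have h1 := condExp_nonneg_of_setIntegral_nonneg ((batchFiltration G I X).le k)
    (hfint.sub hgint) hpos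
  have h2 := condExp_sub hfint hgint (batchFiltration G I X k)
  rw [condExp_of_stronglyMeasurable ((batchFiltration G I X).le k) hgm.stronglyMeasurable hgint]
    at h2
  filter_upwards [h1, h2] with ω hω1 hω2
  rw [hω2] at hω1
  exact sub_nonneg.1 hω1

theorem IsFeasible.integral_norm_sq_estimator_le (hX : G.IsRun I s0 μ X) (k : ℕ) :
    Integrable (fun ω => ∑ i, ‖G.estimator I (fun u => X u ω) k i‖ ^ 2) μ ∧
    ∫ ω, ∑ i, ‖G.estimator I (fun u => X u ω) k i‖ ^ 2 ∂μ ≤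
      ∑ i, (Fintype.card (S i) : ℝ) * Fintype.card (A i) / I.δ i := by
  have hstart := hX.ae_exists_startsBatch hG hF.δ_pos hF.ρ0_mem hF.continuousOn_h
  have hmean : ∀ i z, ∫ ω, G.estimator I (fun u => X u ω) k i z ∂μ ≤ 1 := by
    intro i z
    have hint := hF.integrable_estimator hX k i z
    have h := hX.setIntegral_nonneg_of_cylinder (k := k)
      (by filter_upwards [hstart] with ω hω using hω k)
      ((integrable_const (1 : ℝ)).sub hint) (fun ω₀ t hs => by
        have h1 := (hX.setIntegral_estimator hτ hG hF.δ_pos hF.ρ0_mem hF.continuousOn_h hs i z).2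
        simp only [Pi.sub_apply]
        rw [integral_sub (integrable_const _) hint.integrableOn, setIntegral_const, smul_eq_mul,
          mul_one]
        linarith) (B := Set.univ) MeasurableSet.univ
    simp only [Pi.sub_apply] at h
    rw [setIntegral_univ, integral_sub (integrable_const _) hint] at h
    simp at h
    linarith
  have hsq : ∀ i z, Integrable (fun ω => G.estimator I (fun u => X u ω) k i z ^ 2) μ := by
    intro i z
    refine Integrable.of_bound ((((hX.measurable_estimator k i z).mono
      ((batchFiltration G I X).le _) le_rfl).pow_const 2).aestronglyMeasurable) ((I.δ i)⁻¹ ^ 2)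
      (Eventually.of_forall fun ω => ?_)
    have := hF.estimator_mem (fun u => X u ω) k i z
    rw [Real.norm_of_nonneg (sq_nonneg _)]
    exact pow_le_pow_left₀ this.1 this.2 2
  -- an entry is at most `1 / δ i`, so its second moment is at most `1 / δ i` times its mean
  have hsqle : ∀ i z, ∫ ω, G.estimator I (fun u => X u ω) k i z ^ 2 ∂μ ≤ (I.δ i)⁻¹ := by
    intro i z
    calc _ ≤ ∫ ω, (I.δ i)⁻¹ * G.estimator I (fun u => X u ω) k i z ∂μ := by
          refine integral_mono (hsq i z) ((hF.integrable_estimator hX k i z).const_mul _) fun ω => ?_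
          have := hF.estimator_mem (fun u => X u ω) k i z
          dsimp only
          rw [sq]
          exact mul_le_mul_of_nonneg_right this.2 this.1
      _ ≤ (I.δ i)⁻¹ := by
          rw [integral_const_mul]
          exact mul_le_of_le_one_right (inv_nonneg.2 (hF.δ_pos i).le) (hmean i z)
  simp only [EuclideanSpace.norm_sq_eq, Real.norm_eq_abs, sq_abs]
  refine ⟨integrable_finsetSum _ fun i _ => integrable_finsetSum _ fun z _ => hsq i z, ?_⟩
  rw [integral_finsetSum _ fun i _ => integrable_finsetSum _ fun z _ => hsq i z]
  refine Finset.sum_le_sum fun i _ => ?_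
  rw [integral_finsetSum _ fun z _ => hsq i z]
  calc _ ≤ ∑ _z : S i × A i, (I.δ i)⁻¹ := Finset.sum_le_sum fun z _ => hsqle i z
    _ = _ := by simp [Fintype.card_prod, div_eq_mul_inv]

/-- The second moment of the gain, by Cauchy–Schwarz and the diameter of the polytopes. -/
theorem IsFeasible.integral_sq_dot_estimator_le (hX : G.IsRun I s0 μ X) {σ : Profile S A}
    (hσ : ∀ i, σ i ∈ G.polytope i) (k : ℕ) :
    ∫ ω, dot (G.estimator I (fun u => X u ω) k) (σ - G.iter I (fun u => X u ω) k) ^ 2 ∂μ ≤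
      2 * n * ∑ i, (Fintype.card (S i) : ℝ) * Fintype.card (A i) / I.δ i := by
  obtain ⟨h1, h2⟩ := hF.integral_norm_sq_estimator_le hτ hG hX k
  calc _ ≤ ∫ ω, 2 * n * ∑ i, ‖G.estimator I (fun u => X u ω) k i‖ ^ 2 ∂μ := by
        refine integral_mono (hF.memLp_dot_estimator hX hσ k).integrable_sq (h1.const_mul _)
          fun ω => ?_
        set x : ℕ → (∀ i, S i) × (∀ i, A i) := fun u => X u ω
        dsimp only
        have hdot : |dot (G.estimator I x k) (σ - G.iter I x k)| ≤
            ∑ i, ‖G.estimator I x k i‖ * ‖σ i - G.iter I x k i‖ :=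
          (Finset.abs_sum_le_sum_abs _ _).trans
            (Finset.sum_le_sum fun i _ => abs_real_inner_le_norm _ _)
        have hcs := Finset.sum_mul_sq_le_sq_mul_sq Finset.univ
          (fun i => ‖G.estimator I x k i‖) fun i => ‖σ i - G.iter I x k i‖
        have hdiam : ∑ i, ‖σ i - G.iter I x k i‖ ^ 2 ≤ 2 * n := by
          calc _ ≤ ∑ _i : Fin n, (2 : ℝ) := Finset.sum_le_sum fun i _ =>
                norm_sub_sq_le_two (hF.iter_mem x k i).1 (hσ i)
            _ = 2 * n := by simp [mul_comm]
        have hnn : 0 ≤ ∑ i, ‖G.estimator I x k i‖ ^ 2 :=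
          Finset.sum_nonneg fun i _ => sq_nonneg _
        calc _ = |dot (G.estimator I x k) (σ - G.iter I x k)| ^ 2 := (sq_abs _).symm
          _ ≤ (∑ i, ‖G.estimator I x k i‖ * ‖σ i - G.iter I x k i‖) ^ 2 :=
              pow_le_pow_left₀ (abs_nonneg _) hdot 2
          _ ≤ _ := hcs
          _ ≤ (∑ i, ‖G.estimator I x k i‖ ^ 2) * (2 * n) :=
              mul_le_mul_of_nonneg_left hdiam hnn
          _ = _ := mul_comm _ _
    _ ≤ _ := by
        rw [integral_const_mul]
        exact mul_le_mul_of_nonneg_left h2 (by positivity)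

end Moments

/-! ### The weighted gap -/

/-- The regret bound along a trajectory all of whose batches end. -/
theorem IsFeasible.regret_le (hF : IsFeasible G I) {K : ℝ} (hK : 0 < K)
    (hconv : ∀ i, StrongConvexOn (G.shrunk i (I.δ i)) K (I.h i))
    {x : ℕ → (∀ i, S i) × (∀ i, A i)} (hx : ∀ k, ∃ t, G.StartsBatch I k t x) {σ : Profile S A}
    (hσ : ∀ i, σ i ∈ G.shrunk i (I.δ i)) (k : ℕ) :
    ∑ l ∈ Finset.range k,
        I.η (l + 1) * dot (G.estimator I x (l + 1)) (σ - G.iter I x (l + 1)) ≤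
      ∑ i, (I.h i (σ i) - I.h i (G.argmax i (I.δ i) (I.h i) 0)) +
      ∑ l ∈ Finset.range k, I.η (l + 1) ^ 2 / (2 * K) * ∑ i, ‖G.estimator I x (l + 1) i‖ ^ 2 := by
  have hone : ∀ i, G.score I x 1 i = 0 := by
    intro i
    obtain ⟨t, ht⟩ := hx 1
    rw [(ht.score_succ i).1, score_zero]
    simp
  have hmain : ∀ i, ∑ l ∈ Finset.range k, I.η (l + 1) *
        inner ℝ (G.estimator I x (l + 1) i) (σ i - G.iter I x (l + 1) i) ≤
      (I.h i (σ i) - I.h i (G.argmax i (I.δ i) (I.h i) 0)) +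
      ∑ l ∈ Finset.range k, I.η (l + 1) ^ 2 / (2 * K) * ‖G.estimator I x (l + 1) i‖ ^ 2 := by
    intro i
    have hiter : ∀ l, G.iter I x (l + 1) i =
        G.argmax i (I.δ i) (I.h i) (G.score I x (l + 1) i) := fun l =>
      ((hx (l + 1)).choose_spec.score_succ i).2
    have hreg := dualAveraging_regret hK (hconv i) (fun l => G.score I x (l + 1) i)
      (fun l => I.η (l + 1) • G.estimator I x (l + 1) i) (fun l => G.iter I x (l + 1) i)
      (hone i) (fun l => by
        rw [((hx (l + 1 + 1)).choose_spec.score_succ i).1, if_neg (Nat.succ_ne_zero l)])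
      (fun l => hF.iter_mem x (l + 1) i)
      (fun l => by
        rw [hiter l]
        exact (argmax_spec ⟨_, hσ i⟩ (hF.continuousOn_h i) _).2) (hσ i) k
    have h0 : G.iter I x (0 + 1) i = G.argmax i (I.δ i) (I.h i) 0 := by
      rw [hiter 0, zero_add, hone i]
    rw [h0] at hreg
    convert! hreg using 1
    · refine Finset.sum_congr rfl fun l _ => ?_
      rw [inner_smul_right, real_inner_comm]
    · congr 1
      refine Finset.sum_congr rfl fun l _ => ?_
      rw [norm_smul, mul_pow, Real.norm_eq_abs, sq_abs]
      ring
  simp only [dot, Finset.mul_sum]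
  rw [Finset.sum_comm, Finset.sum_comm (s := Finset.range k), ← Finset.sum_add_distrib]
  refine Finset.sum_le_sum fun i _ => ?_
  exact hmain i

theorem nikaidoIsoda_nonneg {ρs : Profile S A} (hρs : G.IsStableNE ρs) {ρ : Profile S A}
    (hρ : ∀ i, ρ i ∈ G.polytope i) : 0 ≤ G.nikaidoIsoda ρs ρ := by
  rw [nikaidoIsoda_eq_dot]
  exact (hρs.2 ρ hρ).1

theorem weight_eq_sum_range (η : ℕ → ℝ) (k : ℕ) :
    weight η k = ∑ l ∈ Finset.range k, η (l + 1) := by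
  rw [weight, Finset.range_eq_Ico, Finset.sum_Ico_add' η 0 k 1]
  rfl

/-- The weighted sum `∑ η^l Ψ(ρ*, ρ^l)`, of which `avgGap` is the normalization. -/
noncomputable def gapSum (G : StochGame n S A) (I : AlgInput S A) (ρs : Profile S A)
    (x : ℕ → (∀ i, S i) × (∀ i, A i)) (k : ℕ) : ℝ :=
  ∑ l ∈ Finset.range k, I.η (l + 1) * G.nikaidoIsoda ρs (G.iter I x (l + 1))

theorem avgGap_eq (G : StochGame n S A) (I : AlgInput S A) (ρs : Profile S A)
    (x : ℕ → (∀ i, S i) × (∀ i, A i)) (k : ℕ) :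
    G.avgGap I ρs x k = G.gapSum I ρs x k / weight I.η k := by
  rw [avgGap, gapSum, Finset.sum_div, Finset.range_eq_Ico,
    Finset.sum_Ico_add' (fun l => I.η l * G.nikaidoIsoda ρs (G.iter I x l) / weight I.η k) 0 k 1]
  exact Finset.sum_congr rfl fun l _ => by ring

/-- The waiting time `d` makes the total bias of the estimators at most `ε / 3`. -/
theorem mixing_error_le {τ ε M : ℝ} {d : ℕ} (hτ : 0 < τ) (hε : 0 < ε) (hM : 0 ≤ M)
    (hd : τ * Real.log (6 * n / ε * M) ≤ d) :
    n * (2 * Real.exp (-1 / τ) ^ d) * M ≤ ε / 3 := by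
  rcases Nat.eq_zero_or_pos n with rfl | hn
  · simp; positivity
  rcases hM.eq_or_lt with rfl | hM
  · simp; positivity
  have hn' : (0 : ℝ) < n := Nat.cast_pos.2 hn
  have hlog : Real.log (6 * n / ε * M) ≤ d / τ := by
    rw [le_div_iff₀ hτ]; linarith
  have hexp : 6 * n / ε * M ≤ Real.exp (d / τ) :=
    (Real.log_le_iff_le_exp (by positivity)).1 hlog
  have h1 : Real.exp (-1 / τ) ^ d = (Real.exp (d / τ))⁻¹ := by
    rw [← Real.exp_nat_mul, ← Real.exp_neg]
    congr 1
    ring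
  have h2 : (Real.exp (d / τ))⁻¹ ≤ (6 * n / ε * M)⁻¹ := inv_anti₀ (by positivity) hexp
  calc n * (2 * Real.exp (-1 / τ) ^ d) * M ≤ n * (2 * (6 * n / ε * M)⁻¹) * M := by
        rw [h1]
        gcongr
    _ = ε / 3 := by field_simp; norm_num

/-- Replacing `ρs` by the point `σ` of the shrunk polytope costs at most `ε / 2`. -/
theorem nikaidoIsoda_le_add_dot_grad {ρs σ ρ : Profile S A} (hρ : ∀ i, ρ i ∈ G.polytope i) {ε : ℝ}
    (hnear : ∑ i, √((Fintype.card (S i) : ℝ) * Fintype.card (A i)) * ‖ρs i - σ i‖ ≤ ε / 2) :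
    G.nikaidoIsoda ρs ρ ≤ ε / 2 + dot (G.grad ρ) (σ - ρ) := by
  have h1 : G.nikaidoIsoda ρs ρ = dot (G.grad ρ) (ρs - σ) + dot (G.grad ρ) (σ - ρ) := by
    rw [nikaidoIsoda_eq_dot]
    simp only [dot, Pi.sub_apply, inner_sub_right, Finset.sum_sub_distrib]
    ring
  have h2 : dot (G.grad ρ) (ρs - σ) ≤ ε / 2 := by
    refine le_trans (Finset.sum_le_sum fun i _ => ?_) hnear
    exact (real_inner_le_norm _ _).trans
      (mul_le_mul_of_nonneg_right (G.norm_grad_le hρ i) (norm_nonneg _))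
  linarith

variable (G I) in
/-- The sigma-algebras of the beginnings of the batches `1, 2, …`. -/
def shiftedFiltration (X : ℕ → Ω → (∀ i, S i) × (∀ i, A i)) :
    Filtration ℕ (inferInstance : MeasurableSpace Ω) where
  seq k := batchFiltration G I X (k + 1)
  mono' := fun _ _ h => (batchFiltration G I X).mono (Nat.succ_le_succ h)
  le' := fun k => (batchFiltration G I X).le (k + 1)

variable (G I) in
/-- The estimated loss `-η ⟨R, σ - ρ⟩` in batch `l + 1`. -/
noncomputable def weightedLoss (σ : Profile S A) (X : ℕ → Ω → (∀ i, S i) × (∀ i, A i)) (l : ℕ)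
    (ω : Ω) : ℝ :=
  -I.η (l + 1) * dot (G.estimator I (fun u => X u ω) (l + 1))
    (σ - G.iter I (fun u => X u ω) (l + 1))

variable (G I) in
/-- The martingale of the fluctuations of the estimated losses. -/
noncomputable def noise (μ : Measure Ω) (σ : Profile S A)
    (X : ℕ → Ω → (∀ i, S i) × (∀ i, A i)) (k : ℕ) (ω : Ω) : ℝ :=
  ∑ l ∈ Finset.range k, (weightedLoss G I σ X l ω -
    (μ[weightedLoss G I σ X l | shiftedFiltration G I X l]) ω)

variable (G I) in
/-- The quadratic term of the regret bound. -/
noncomputable def energy (K : ℝ) (X : ℕ → Ω → (∀ i, S i) × (∀ i, A i)) (k : ℕ) (ω : Ω) : ℝ :=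
  ∑ l ∈ Finset.range k, I.η (l + 1) ^ 2 / (2 * K) *
    ∑ i, ‖G.estimator I (fun u => X u ω) (l + 1) i‖ ^ 2

section Bounds

variable (hF : IsFeasible G I) {τ : ℝ} (hτ : 0 < τ) (hG : G.UniformlyErgodic τ)
include hF hτ hG

/-- The weighted gap is at most `5 ε / 6` times the total weight, up to a constant, the quadratic
term of the regret and a martingale. -/
theorem IsFeasible.ae_gapSum_le (hX : G.IsRun I s0 μ X) {ε : ℝ} (hε : 0 < ε) {K : ℝ} (hK : 0 < K)
    (hconv : ∀ i, StrongConvexOn (G.shrunk i (I.δ i)) K (I.h i))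
    (hη_pos : ∀ k, 1 ≤ k → 0 < I.η k)
    (hd : τ * Real.log (6 * n / ε * ∑ i, (Fintype.card (A i) : ℝ) * Fintype.card (S i)) ≤ I.d)
    {ρs σ : Profile S A} (hσ : ∀ i, σ i ∈ G.shrunk i (I.δ i))
    (hnear : ∑ i, √((Fintype.card (S i) : ℝ) * Fintype.card (A i)) * ‖ρs i - σ i‖ ≤ ε / 2) :
    ∀ᵐ ω ∂μ, ∀ k, G.gapSum I ρs (fun u => X u ω) k ≤ 5 * ε / 6 * weight I.η k +
      ∑ i, (I.h i (σ i) - I.h i (G.argmax i (I.δ i) (I.h i) 0)) +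
      energy G I K X k ω + noise G I μ σ X k ω := by
  have hM : ∑ i, (Fintype.card (A i) : ℝ) * Fintype.card (S i) =
      ∑ i, (Fintype.card (S i) : ℝ) * Fintype.card (A i) :=
    Finset.sum_congr rfl fun i _ => mul_comm _ _
  rw [hM] at hd
  have hmix := mixing_error_le hτ hε (Finset.sum_nonneg fun i _ => by positivity) hd
  have hstart := hX.ae_exists_startsBatch hG hF.δ_pos hF.ρ0_mem hF.continuousOn_h
  have hdrift := ae_all_iff.2 fun l : ℕ =>
    hF.dot_grad_sub_le_condExp hτ hG hX (fun i => (hσ i).1) (l + 1)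
  have hsmul := ae_all_iff.2 fun l : ℕ => condExp_smul (μ := μ) (-I.η (l + 1))
    (fun ω => dot (G.estimator I (fun u => X u ω) (l + 1))
      (σ - G.iter I (fun u => X u ω) (l + 1))) (batchFiltration G I X (l + 1))
  filter_upwards [hstart, hdrift, hsmul] with ω hω hdr hsm k
  have hreg := hF.regret_le hK hconv hω hσ k
  have hle : G.gapSum I ρs (fun u => X u ω) k ≤ 5 * ε / 6 * weight I.η k +
      ∑ l ∈ Finset.range k, I.η (l + 1) *
        dot (G.estimator I (fun u => X u ω) (l + 1)) (σ - G.iter I (fun u => X u ω) (l + 1)) +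
      noise G I μ σ X k ω := by
    rw [weight_eq_sum_range, Finset.mul_sum, noise, gapSum, ← Finset.sum_add_distrib,
      ← Finset.sum_add_distrib]
    refine Finset.sum_le_sum fun l _ => ?_
    have h1 := nikaidoIsoda_le_add_dot_grad (G := G) (ρ := G.iter I (fun u => X u ω) (l + 1))
      (fun i => (hF.iter_mem (fun u => X u ω) (l + 1) i).1) hnear
    have h2 := hdr l
    have h3 : (μ[weightedLoss G I σ X l | shiftedFiltration G I X l]) ω =
        -I.η (l + 1) * (μ[fun ω => dot (G.estimator I (fun u => X u ω) (l + 1))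
          (σ - G.iter I (fun u => X u ω) (l + 1)) | batchFiltration G I X (l + 1)]) ω := hsm l
    rw [h3, weightedLoss]
    have hη := hη_pos (l + 1) (Nat.le_add_left 1 l)
    have h4 : G.nikaidoIsoda ρs (G.iter I (fun u => X u ω) (l + 1)) ≤ 5 * ε / 6 +
        (μ[fun ω => dot (G.estimator I (fun u => X u ω) (l + 1))
          (σ - G.iter I (fun u => X u ω) (l + 1)) | batchFiltration G I X (l + 1)]) ω := by
      linarith
    have h5 := mul_le_mul_of_nonneg_left h4 hη.le
    linarith
  rw [energy]
  linarith

theorem IsFeasible.measureReal_exists_le_noise (hX : G.IsRun I s0 μ X)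
    (hη_sq : Summable fun l : ℕ => I.η (l + 1) ^ 2) {σ : Profile S A}
    (hσ : ∀ i, σ i ∈ G.polytope i) {r : ℝ} (hr : 0 < r) :
    μ.real {ω | ∃ k, r ≤ noise G I μ σ X k ω} ≤
      2 * n * (∑ i, (Fintype.card (S i) : ℝ) * Fintype.card (A i) / I.δ i) *
        (∑' l : ℕ, I.η (l + 1) ^ 2) / r ^ 2 := by
  set D : ℝ := ∑ i, (Fintype.card (S i) : ℝ) * Fintype.card (A i) / I.δ i with hD
  have hD0 : 0 ≤ D := Finset.sum_nonneg fun i _ => div_nonneg (by positivity) (hF.δ_pos i).le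
  refine measure_exists_le_centered_sum (shiftedFiltration G I X) (weightedLoss G I σ X)
    (fun l => ((hF.measurable_dot_estimator hX σ (l + 1)).const_mul _).stronglyMeasurable)
    (fun l => (hF.memLp_dot_estimator hX hσ (l + 1)).const_mul _) (fun j => ?_) hr
  calc _ ≤ ∑ l ∈ Finset.range j, I.η (l + 1) ^ 2 * (2 * n * D) := by
        refine Finset.sum_le_sum fun l _ => ?_
        simp only [weightedLoss, mul_pow, neg_sq]
        rw [integral_const_mul]
        exact mul_le_mul_of_nonneg_left (hF.integral_sq_dot_estimator_le hτ hG hX hσ (l + 1))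
          (sq_nonneg _)
    _ = (2 * n * D) * ∑ l ∈ Finset.range j, I.η (l + 1) ^ 2 := by
        rw [← Finset.sum_mul, mul_comm]
    _ ≤ _ := mul_le_mul_of_nonneg_left (hη_sq.sum_le_tsum _ fun l _ => sq_nonneg _)
        (by positivity)

theorem IsFeasible.measureReal_exists_le_energy (hX : G.IsRun I s0 μ X)
    (hη_sq : Summable fun l : ℕ => I.η (l + 1) ^ 2) {K : ℝ} (hK : 0 < K) {r : ℝ} (hr : 0 < r) :
    μ.real {ω | ∃ k, r ≤ energy G I K X k ω} ≤
      (∑ i, (Fintype.card (S i) : ℝ) * Fintype.card (A i) / I.δ i) *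
        (∑' l : ℕ, I.η (l + 1) ^ 2) / (2 * K) / r := by
  set D : ℝ := ∑ i, (Fintype.card (S i) : ℝ) * Fintype.card (A i) / I.δ i with hD
  have hD0 : 0 ≤ D := Finset.sum_nonneg fun i _ => div_nonneg (by positivity) (hF.δ_pos i).le
  refine measure_exists_le_sum_le
    (fun l => (hF.integral_norm_sq_estimator_le hτ hG hX (l + 1)).1.const_mul _)
    (fun l ω => mul_nonneg (by positivity) (Finset.sum_nonneg fun i _ => sq_nonneg _))
    (fun j => ?_) hr
  calc _ ≤ ∑ l ∈ Finset.range j, I.η (l + 1) ^ 2 / (2 * K) * D := by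
        refine Finset.sum_le_sum fun l _ => ?_
        rw [integral_const_mul]
        exact mul_le_mul_of_nonneg_left (hF.integral_norm_sq_estimator_le hτ hG hX (l + 1)).2
          (by positivity)
    _ = D / (2 * K) * ∑ l ∈ Finset.range j, I.η (l + 1) ^ 2 := by
        rw [Finset.mul_sum]
        exact Finset.sum_congr rfl fun l _ => by ring
    _ ≤ D / (2 * K) * ∑' l : ℕ, I.η (l + 1) ^ 2 :=
        mul_le_mul_of_nonneg_left (hη_sq.sum_le_tsum _ fun l _ => sq_nonneg _) (by positivity)
    _ = _ := by ring

end Bounds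

/-! ### Tails and limits -/

/-- A family of random variables whose upper tails vanish, uniformly in the index, is almost surely
bounded above. -/
theorem ae_bddAbove_of_tail {f : ℕ → Ω → ℝ} {b : ℝ → ℝ} (hb : Tendsto b atTop (𝓝 0))
    (h : ∀ r, 0 < r → μ.real {ω | ∃ k, r ≤ f k ω} ≤ b r) : ∀ᵐ ω ∂μ, ∃ B, ∀ k, f k ω ≤ B := by
  have h0 : μ.real {ω | ¬ ∃ B, ∀ k, f k ω ≤ B} ≤ 0 := by
    refine ge_of_tendsto hb ?_
    filter_upwards [eventually_gt_atTop 0] with r hr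
    refine le_trans (measureReal_mono fun ω hω => ?_) (h r hr)
    by_contra hno
    exact hω ⟨r, fun k => (not_le.1 fun hk => hno ⟨k, hk⟩).le⟩
  rw [ae_iff]
  exact (measureReal_eq_zero_iff).1 (le_antisymm h0 measureReal_nonneg)

/-- A bound on the weighted gap by `5 ε / 6` times the weight, up to a constant, brings the limit
superior of the averages below `ε`. -/
theorem limsup_div_lt {w g : ℕ → ℝ} {ε B : ℝ} (hε : 0 < ε) (hw : Tendsto w atTop atTop)
    (hg0 : ∀ k, 0 ≤ g k) (hg : ∀ k, g k ≤ 5 * ε / 6 * w k + B) :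
    limsup (fun k => g k / w k) atTop < ε := by
  have hev : ∀ᶠ k in atTop, g k / w k ≤ 11 * ε / 12 := by
    filter_upwards [hw.eventually_ge_atTop (12 * B / ε), hw.eventually_gt_atTop 0] with k h1 h2
    rw [div_le_iff₀ hε] at h1
    rw [div_le_iff₀ h2]
    linarith [hg k]
  refine (limsup_le_of_le ?_ hev).trans_lt (by linarith)
  refine IsBoundedUnder.isCoboundedUnder_le ⟨0, ?_⟩
  rw [eventually_map]
  filter_upwards [hw.eventually_gt_atTop 0] with k hk
  exact div_nonneg (hg0 k) hk.le

/-- If the terms were eventually at least `ε`, then their weighted sums would exceed the bound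
`5 ε / 6` times the weight. -/
theorem frequently_lt_of_sum_le {η : ℕ → ℝ} (hη : ∀ l, 0 < η l) {ψ : ℕ → ℝ} (hψ : ∀ l, 0 ≤ ψ l)
    {ε B : ℝ} (hε : 0 < ε)
    (hw : Tendsto (fun k => ∑ l ∈ Finset.range k, η l) atTop atTop)
    (hsum : ∀ k, ∑ l ∈ Finset.range k, η l * ψ l ≤ 5 * ε / 6 * ∑ l ∈ Finset.range k, η l + B) :
    ∃ᶠ l in atTop, ψ l < ε := by
  intro hno
  simp only [not_lt] at hno
  obtain ⟨N, hN⟩ := eventually_atTop.1 hno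
  have hlow : ∀ m, ε * (∑ l ∈ Finset.range (N + m), η l - ∑ l ∈ Finset.range N, η l) ≤
      ∑ l ∈ Finset.range (N + m), η l * ψ l := by
    intro m
    induction m with
    | zero => simpa using Finset.sum_nonneg fun l _ => mul_nonneg (hη l).le (hψ l)
    | succ m ih =>
      rw [← add_assoc, Finset.sum_range_succ, Finset.sum_range_succ _ (N + m)]
      nlinarith [mul_le_mul_of_nonneg_left (hN (N + m) (by omega)) (hη (N + m)).le]
  have hev := (hw.comp (tendsto_add_atTop_nat N)).eventually_gt_atTop
    (6 * (B + ε * ∑ l ∈ Finset.range N, η l) / ε)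
  obtain ⟨m, hm⟩ := hev.exists
  simp only [Function.comp_apply] at hm
  rw [div_lt_iff₀ hε, add_comm m N] at hm
  linarith [hlow m, hsum (N + m)]

theorem sum_card_le_sum_card_div {G : StochGame n S A} {I : AlgInput S A} (hF : IsFeasible G I) :
    (n : ℝ) ≤ ∑ i, (Fintype.card (S i) : ℝ) * Fintype.card (A i) ∧
    ∑ i, (Fintype.card (S i) : ℝ) * Fintype.card (A i) ≤
      ∑ i, (Fintype.card (S i) : ℝ) * Fintype.card (A i) / I.δ i := by
  have hne : ∀ i, Nonempty (S i) ∧ Nonempty (A i) := fun i =>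
    nonempty_of_mem_polytope (hF.ρ0_mem i).1
  constructor
  · calc (n : ℝ) = ∑ _i : Fin n, (1 : ℝ) := by simp
      _ ≤ _ := by
        refine Finset.sum_le_sum fun i _ => ?_
        have := (hne i).1
        have := (hne i).2
        have h1 : (1 : ℝ) ≤ Fintype.card (S i) := Nat.one_le_cast.2 Fintype.card_pos
        have h2 : (1 : ℝ) ≤ Fintype.card (A i) := Nat.one_le_cast.2 Fintype.card_pos
        exact one_le_mul_of_one_le_of_one_le h1 h2
  · refine Finset.sum_le_sum fun i _ => ?_
    obtain ⟨⟨s⟩, ⟨a⟩⟩ := hne i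
    have h1 : I.δ i ≤ 1 :=
      ((hF.ρ0_mem i).2 (s, a)).trans (le_one_of_mem_polytope (hF.ρ0_mem i).1 (s, a))
    exact le_div_self (by positivity) (hF.δ_pos i) h1

/-- The bad events of the finite-time bound have probability at most `α / 2` each; `D` and `S₂`
stand for `∑ |S i| |A i| / δ i` and `∑ (η l) ^ 2`. -/
theorem tail_bounds_le {N D S₂ K α : ℝ} (hN : 1 ≤ N) (hD : 1 ≤ D) (hK : 0 < K)
    (hKS : K ^ 2 ≤ S₂) (hα : 0 < α) (hα1 : α < 1) :
    D * S₂ / (2 * K) / (D * S₂ / K / α) = α / 2 ∧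
    2 * N * D * S₂ / (10 * N * (D * S₂ / K) / α) ^ 2 ≤ α / 2 := by
  have hS : 0 < S₂ := (by positivity : 0 < K ^ 2).trans_le hKS
  constructor
  · field_simp
  · have h1 : 2 * N * D * S₂ / (10 * N * (D * S₂ / K) / α) ^ 2
        = α * (α * K ^ 2 / (50 * N * D * S₂)) := by
      field_simp
      norm_num
    rw [h1, div_eq_mul_inv α 2]
    refine mul_le_mul_of_nonneg_left ?_ hα.le
    rw [div_le_iff₀ (by positivity)]
    have h2 : α * K ^ 2 ≤ S₂ := by nlinarith [sq_nonneg K]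
    have h3 : 1 ≤ N * D := one_le_mul_of_one_le_of_one_le hN hD
    nlinarith

end Run

end StochGame

theorem mainTheorem5 {n : ℕ} {S A : Fin n → Type*}
    [∀ i, Fintype (S i)] [∀ i, Fintype (A i)]
    [∀ i, DecidableEq (S i)] [∀ i, DecidableEq (A i)]
    (G : StochGame n S A) (τ : ℝ) (hτ : 0 < τ) (hG : G.UniformlyErgodic τ)
    (I : StochGame.AlgInput S A) (s0 : ∀ i, S i)
    (ε : ℝ) (hε : 0 < ε)
    (hδ : ∀ i, 0 < I.δ i)
    (hρ0 : ∀ i, I.ρ0 i ∈ G.shrunk i (I.δ i))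
    (K : ℝ) (hK : 0 < K)
    (hh_cont : ∀ i, ContinuousOn (I.h i) (G.shrunk i (I.δ i)))
    (hh_conv : ∀ i, StrongConvexOn (G.shrunk i (I.δ i)) K (I.h i))
    (hη_pos : ∀ k, 1 ≤ k → 0 < I.η k)
    (hη_sum : Filter.Tendsto (StochGame.weight I.η) Filter.atTop Filter.atTop)
    (hη_sq : Summable fun l : ℕ => I.η (l + 1) ^ 2)
    (hd : τ * Real.log (6 * n / ε * ∑ i, (Fintype.card (A i) : ℝ) * Fintype.card (S i)) ≤ I.d)
    (ρs : Profile S A) (hρs : G.IsStableNE ρs)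
    -- the thresholds are small enough for the accuracy `ε` at the equilibrium
    (hρs_near : ∃ σ : Profile S A, (∀ i, σ i ∈ G.shrunk i (I.δ i)) ∧
      ∑ i, √((Fintype.card (S i) : ℝ) * Fintype.card (A i)) * ‖ρs i - σ i‖ ≤ ε / 2)
    {Ω : Type*} [MeasurableSpace Ω] (μ : MeasureTheory.Measure Ω)
    [MeasureTheory.IsProbabilityMeasure μ]
    (X : ℕ → Ω → (∀ i, S i) × (∀ i, A i)) (hX : G.IsRun I s0 μ X) :
    (∀ᵐ ω ∂μ, Filter.limsup (fun k => G.avgGap I ρs (fun t => X t ω) k) Filter.atTop < ε) ∧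
    (∀ L : ℝ, G.IsStronglyStableNE L ρs →
      ∀ᵐ ω ∂μ, ∃ᶠ k in Filter.atTop,
        StochGame.distSq ρs (G.iter I (fun t => X t ω) k) < ε / L) ∧
    -- normalization of the regularizers and of the step-sizes, for the explicit threshold
    ((∀ θ σ : Profile S A, (∀ i, θ i ∈ G.shrunk i (I.δ i)) →
        (∀ i, σ i ∈ G.shrunk i (I.δ i)) →
        ∑ i, (I.h i (θ i) - I.h i (σ i))
          ≤ ∑ i, (Fintype.card (S i) : ℝ) * Fintype.card (A i)) →
      K ≤ ∑' l : ℕ, I.η (l + 1) ^ 2 → K ^ 2 ≤ ∑' l : ℕ, I.η (l + 1) ^ 2 →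
      ∀ α : ℝ, 0 < α → α < 1 →
        1 - α ≤ μ.real {ω | ∀ k : ℕ,
          72 * n / (α * ε * K)
              * (∑ i, (Fintype.card (S i) : ℝ) * Fintype.card (A i) / I.δ i)
              * ∑' l : ℕ, I.η (l + 1) ^ 2 ≤ StochGame.weight I.η k →
            G.avgGap I ρs (fun t => X t ω) k < ε}) := by
  obtain ⟨σ, hσ, hnear⟩ := hρs_near
  have hF : StochGame.IsFeasible G I := ⟨hδ, hρ0, hh_cont⟩
  have hΨ : ∀ x k, 0 ≤ G.nikaidoIsoda ρs (G.iter I x k) := fun x k =>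
    StochGame.nikaidoIsoda_nonneg hρs fun i => (hF.iter_mem x k i).1
  have hη : ∀ l, 0 < I.η (l + 1) := fun l => hη_pos (l + 1) (Nat.le_add_left 1 l)
  have hgap := hF.ae_gapSum_le hτ hG hX hε hK hh_conv hη_pos hd hσ hnear
  set H : ℝ := ∑ i, (I.h i (σ i) - I.h i (G.argmax i (I.δ i) (I.h i) 0)) with hH
  set D : ℝ := ∑ i, (Fintype.card (S i) : ℝ) * Fintype.card (A i) / I.δ i with hD
  set S₂ : ℝ := ∑' l : ℕ, I.η (l + 1) ^ 2 with hS₂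
  have hnoise := fun r (hr : 0 < r) =>
    hF.measureReal_exists_le_noise hτ hG hX hη_sq (fun i => (hσ i).1) hr
  have henergy := fun r (hr : 0 < r) =>
    hF.measureReal_exists_le_energy hτ hG hX hη_sq hK hr
  have hbdd : ∀ᵐ ω ∂μ, ∃ B, ∀ k, G.gapSum I ρs (fun t => X t ω) k ≤
      5 * ε / 6 * StochGame.weight I.η k + B := by
    have h1 := StochGame.ae_bddAbove_of_tail
      (tendsto_const_nhds.div_atTop (tendsto_pow_atTop two_ne_zero)) hnoise
    have h2 := StochGame.ae_bddAbove_of_tail (tendsto_const_nhds.div_atTop tendsto_id) henergy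
    filter_upwards [hgap, h1, h2] with ω hω ⟨B₁, hB₁⟩ ⟨B₂, hB₂⟩
    exact ⟨H + B₂ + B₁, fun k => by linarith [hω k, hB₁ k, hB₂ k]⟩
  refine ⟨?_, fun L hL => ?_, fun hosc hKS hKS2 α hα hα1 => ?_⟩
  · filter_upwards [hbdd] with ω ⟨B, hB⟩
    simp_rw [StochGame.avgGap_eq]
    exact StochGame.limsup_div_lt hε hη_sum (fun k => Finset.sum_nonneg fun l _ =>
      mul_nonneg (hη l).le (hΨ _ _)) hB
  · filter_upwards [hbdd] with ω ⟨B, hB⟩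
    have hw := hη_sum
    simp_rw [funext (StochGame.weight_eq_sum_range I.η)] at hw
    have hfreq := StochGame.frequently_lt_of_sum_le hη
      (fun l => hΨ (fun t => X t ω) (l + 1)) hε hw fun k => by
        rw [← StochGame.weight_eq_sum_range]; exact hB k
    have hshift := (tendsto_add_atTop_nat 1).frequently
      (p := fun k => G.nikaidoIsoda ρs (G.iter I (fun t => X t ω) k) < ε) hfreq
    refine hshift.mono fun k hk => ?_
    rw [lt_div_iff₀ hL.2.1, mul_comm]
    refine lt_of_le_of_lt (hL.2.2 _ fun i => (hF.iter_mem _ k i).1) ?_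
    rwa [← StochGame.nikaidoIsoda_eq_dot]
  · rcases Nat.eq_zero_or_pos n with rfl | hn
    · -- without players the gap is an empty sum
      have h0 : ∀ x k, G.avgGap I ρs x k = 0 := fun x k => by
        simp [StochGame.avgGap, StochGame.nikaidoIsoda]
      have huniv : {ω | ∀ k : ℕ, 72 * ((0 : ℕ) : ℝ) / (α * ε * K) * D * S₂ ≤
          StochGame.weight I.η k → G.avgGap I ρs (fun t => X t ω) k < ε} = Set.univ :=
        Set.eq_univ_of_forall fun ω k _ => by rw [h0]; exact hε
      rw [huniv, MeasureTheory.probReal_univ]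
      linarith
    have hn1 : (1 : ℝ) ≤ n := Nat.one_le_cast.2 hn
    obtain ⟨hM, hMD⟩ := StochGame.sum_card_le_sum_card_div hF
    have hD1 : 1 ≤ D := hn1.trans (hM.trans hMD)
    have hS : 0 < S₂ := hK.trans_le hKS
    set U : ℝ := D * S₂ / K with hU
    have hU0 : 0 < U := by positivity
    have hHU : H ≤ U := by
      have h1 : H ≤ D := (hosc σ (fun i => G.argmax i (I.δ i) (I.h i) 0) hσ fun i =>
        (StochGame.argmax_spec ⟨_, hσ i⟩ (hh_cont i) 0).1).trans hMD
      have h2 : D ≤ U := by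
        rw [hU, le_div_iff₀ hK]
        exact mul_le_mul_of_nonneg_left hKS (by linarith)
      exact h1.trans h2
    obtain ⟨ht1, ht2⟩ := StochGame.tail_bounds_le hn1 hD1 hK hKS2 hα hα1
    have hb1 := henergy (U / α) (by positivity)
    have hb2 := hnoise (10 * n * U / α) (by positivity)
    rw [ht1] at hb1
    have hb3 := hb2.trans ht2
    set good : Set Ω := {ω | ∀ k : ℕ, 72 * (n : ℝ) / (α * ε * K) * D * S₂ ≤
      StochGame.weight I.η k → G.avgGap I ρs (fun t => X t ω) k < ε} with hgood
    set bad₁ : Set Ω := {ω | ∃ k, U / α ≤ StochGame.energy G I K X k ω}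
    set bad₂ : Set Ω := {ω | ∃ k, 10 * n * U / α ≤ StochGame.noise G I μ σ X k ω}
    have hcover : ∀ᵐ ω ∂μ, ω ∈ good ∪ (bad₁ ∪ bad₂) := by
      filter_upwards [hgap] with ω hω
      by_contra hno
      simp only [Set.mem_union, not_or] at hno
      obtain ⟨h1, h2, h3⟩ := hno
      refine h1 fun k hk => ?_
      have he : StochGame.energy G I K X k ω < U / α := lt_of_not_ge fun h => h2 ⟨k, h⟩
      have hz : StochGame.noise G I μ σ X k ω < 10 * n * U / α := lt_of_not_ge fun h => h3 ⟨k, h⟩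
      have hk' : 12 * n * U / α ≤ ε / 6 * StochGame.weight I.η k := by
        have h4 : 12 * n * U / α = ε / 6 * (72 * (n : ℝ) / (α * ε * K) * D * S₂) := by
          rw [hU]; field_simp; norm_num
        rw [h4]
        exact mul_le_mul_of_nonneg_left hk (by positivity)
      have hUα : U ≤ U / α := le_div_self hU0.le hα hα1.le
      have hUn : 2 * (U / α) + 10 * n * U / α ≤ 12 * n * U / α := by
        have h5 : 12 * n * U / α - 10 * n * U / α = 2 * n * (U / α) := by ring
        have h6 : 0 < U / α := by positivity
        nlinarith
      have hw : 0 < StochGame.weight I.η k :=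
        lt_of_lt_of_le (by positivity) hk
      rw [StochGame.avgGap_eq, div_lt_iff₀ hw]
      linarith [hω k]
    have hone : μ.real (good ∪ (bad₁ ∪ bad₂)) = 1 := by
      have hae : (good ∪ (bad₁ ∪ bad₂) : Set Ω) =ᵐ[μ] Set.univ := eventuallyEq_univ.2 hcover
      rw [MeasureTheory.measureReal_def, MeasureTheory.measure_congr hae,
        MeasureTheory.measure_univ, ENNReal.toReal_one]
    have h7 := MeasureTheory.measureReal_union_le (μ := μ) good (bad₁ ∪ bad₂)
    have h8 := MeasureTheory.measureReal_union_le (μ := μ) bad₁ bad₂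
    have h9 : μ.real bad₁ ≤ α / 2 := hb1
    have h10 : μ.real bad₂ ≤ α / 2 := hb3
    linarith
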